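/- Let $(\mathcal M,\langle\cdot,\cdot\rangle_L)$ be a spacetime, i.e. a smooth, connected, Hausdorff, second countable manifold of finite dimension with a smooth, time-oriented Lorentzian metric (index $1$). Suppose that it has a complete timelike Killing vector field $K$ (which provides a time orientation) and a smooth spacelike Cauchy hypersurface $\mathcal S$, i.e. a smooth embedded spacelike hypersurface which is crossed exactly once by every inextendible timelike curve, and suppose that the Riemannian metric induced on $\mathcal S$ is complete. (The existence of a Cauchy hypersurface is the global hyperbolicity of $\mathcal M$.) For $p,q\in\mathcal M$ let $$C^1_K(p,q)=\{z\in C^1([0,1],\mathcal M): z(0)=p,\ z(1)=q,\ \langle\dot z,K(z)\rangle_L\equiv C_z \text{ on } [0,1] \text{ for some } C_z\in\mathbb R\},$$ let $f(z)=\frac12\int_0^1\langle\dot z,\dot z\rangle_L\,ds$ be the action functional, and let $\Omega^1(p,q)$ be the set of the absolutely continuous curves $z:[0,1]\to\mathcal M$ with $z(0)=p$, $z(1)=q$ and $\int_0^1\langle\dot z,\dot z\rangle_R\,ds<\infty$, where $\langle\zeta,\zeta'\rangle_R=\langle\zeta,\zeta'\rangle_L-2\,\langle\zeta,K\rangle_L\langle\zeta',K\rangle_L/\langle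 K,K\rangle_L$. A sequence $(z_n)$ in $\Omega^1(p,q)$ converges weakly to $z\in\Omega^1(p,q)$ if $\varphi\circ z_n\rightharpoonup\varphi\circ z$ weakly in the Hilbert space $H^1([0,1],\mathbb R)$ for every smooth function $\varphi:\mathcal M\to\mathbb R$. Then, for all $p,q\in\mathcal M$, the restriction of $f$ to $C^1_K(p,q)$ is pseudo-coercive: for every $c\in\mathbb R$, every sequence $(z_n)_n$ in $C^1_K(p,q)$ with $f(z_n)\le c$ for all $n$ has a subsequence that converges weakly in $\Omega^1(p,q)$, and uniformly on $[0,1]$, to some $z\in\Omega^1(p,q)$. -/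

import Mathlib

open Set Filter MeasureTheory
open scoped Manifold ContDiff Topology ENNReal

noncomputable section

namespace StationarySpacetime

variable {E : Type*} [NormedAddCommGroup E] [NormedSpace ℝ E]
  {M : Type*} [TopologicalSpace M] [ChartedSpace E M]

/-- A smooth Lorentzian metric on the manifold `M` modelled on `E`: a smooth field of symmetric
bilinear forms on the tangent spaces, each of index `1`, i.e. at every point there is a vector `v`
with `⟨v, v⟩ < 0` on whose orthogonal complement the form is positive definite. -/
structure LorentzMetric (E : Type*) [NormedAddCommGroup E] [NormedSpace ℝ E]
    (M : Type*) [TopologicalSpace M] [ChartedSpace E M] [IsManifold 𝓘(ℝ, E) ∞ M] where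
  /-- The bilinear form on each tangent space. -/
  inner (x : M) : TangentSpace 𝓘(ℝ, E) x →L[ℝ] TangentSpace 𝓘(ℝ, E) x →L[ℝ] ℝ
  symm (x : M) (v w : TangentSpace 𝓘(ℝ, E) x) : inner x v w = inner x w v
  index_one (x : M) : ∃ v : TangentSpace 𝓘(ℝ, E) x, inner x v v < 0 ∧
    ∀ w : TangentSpace 𝓘(ℝ, E) x, inner x v w = 0 → w ≠ 0 → 0 < inner x w w
  contMDiff : ContMDiff 𝓘(ℝ, E) (𝓘(ℝ, E).prod 𝓘(ℝ, E →L[ℝ] E →L[ℝ] ℝ)) ∞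
    (fun x ↦ Bundle.TotalSpace.mk' (E →L[ℝ] E →L[ℝ] ℝ)
      (E := fun x : M ↦ TangentSpace 𝓘(ℝ, E) x →L[ℝ] TangentSpace 𝓘(ℝ, E) x →L[ℝ] ℝ)
      x (inner x))

/-- A vector field on `M`, as a (not yet smooth) section of the tangent bundle. -/
abbrev VField (E : Type*) [NormedAddCommGroup E] [NormedSpace ℝ E]
    (M : Type*) [TopologicalSpace M] [ChartedSpace E M] : Type _ :=
  (x : M) → TangentSpace 𝓘(ℝ, E) x

/-- The vector field `X` is smooth on the set `U`. -/
def SmoothVFieldOn [IsManifold 𝓘(ℝ, E) ∞ M] (X : VField E M) (U : Set M) : Prop :=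
  ContMDiffOn 𝓘(ℝ, E) 𝓘(ℝ, E).tangent ∞ (fun x ↦ (⟨x, X x⟩ : TangentBundle 𝓘(ℝ, E) M)) U

/-- The derivative of the real function `φ` at `x` in the direction of the tangent vector `v`. -/
def dirDeriv (φ : M → ℝ) (x : M) (v : TangentSpace 𝓘(ℝ, E) x) : ℝ :=
  mfderiv 𝓘(ℝ, E) 𝓘(ℝ, ℝ) φ x v

variable [IsManifold 𝓘(ℝ, E) ∞ M]

/-- The vector field `K` is timelike at every point. -/
def IsTimelikeField (g : LorentzMetric E M) (K : VField E M) : Prop :=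
  ∀ x, g.inner x (K x) (K x) < 0

/-- `K` is a Killing vector field: it is smooth and the Lie derivative of the metric along `K`,
`(L_K g)(X, Y) = K(g(X, Y)) - g([K, X], Y) - g(X, [K, Y])`, vanishes for all smooth vector fields
`X`, `Y` defined on an open set. -/
def IsKilling (g : LorentzMetric E M) (K : VField E M) : Prop :=
  SmoothVFieldOn K univ ∧
  ∀ (U : Set M) (X Y : VField E M), IsOpen U → SmoothVFieldOn X U → SmoothVFieldOn Y U →
    ∀ x ∈ U,
      dirDeriv (fun y ↦ g.inner y (X y) (Y y)) x (K x)
        - g.inner x (VectorField.mlieBracket 𝓘(ℝ, E) K X x) (Y x)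
        - g.inner x (X x) (VectorField.mlieBracket 𝓘(ℝ, E) K Y x) = 0

/-- The vector field `K` is complete: through every point passes an integral curve of `K` which is
defined on the whole real line. -/
def IsCompleteField (K : VField E M) : Prop :=
  ∀ x : M, ∃ γ : ℝ → M, γ 0 = x ∧ IsMIntegralCurve γ K

/-- A `C¹` timelike curve `ℝ → M` that is inextendible: it has no limit at either end.
(An inextendible curve is defined on an open interval, which may be reparametrized to `ℝ`.) -/
def IsInextendibleTimelike (g : LorentzMetric E M) (γ : ℝ → M) : Prop :=
  ContMDiff 𝓘(ℝ, ℝ) 𝓘(ℝ, E) 1 γ ∧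
  (∀ s : ℝ, g.inner (γ s) (mfderiv 𝓘(ℝ, ℝ) 𝓘(ℝ, E) γ s (1 : ℝ))
    (mfderiv 𝓘(ℝ, ℝ) 𝓘(ℝ, E) γ s (1 : ℝ)) < 0) ∧
  (¬ ∃ y, Tendsto γ atTop (𝓝 y)) ∧ (¬ ∃ y, Tendsto γ atBot (𝓝 y))

/-- `S` is a Cauchy hypersurface: it is crossed exactly once by every inextendible timelike
curve. -/
def IsCauchyHypersurface (g : LorentzMetric E M) (S : Set M) : Prop :=
  ∀ γ : ℝ → M, IsInextendibleTimelike g γ → ∃! s : ℝ, γ s ∈ S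

/-- `S` is a smooth (embedded) spacelike hypersurface: around each of its points `x` it is the zero
set of a smooth function `h` with `dh_x ≠ 0`, and the metric is positive definite on
`T_x S = ker dh_x`. -/
def IsSpacelikeHypersurface (g : LorentzMetric E M) (S : Set M) : Prop :=
  ∀ x ∈ S, ∃ (U : Set M) (h : M → ℝ), IsOpen U ∧ x ∈ U ∧ ContMDiffOn 𝓘(ℝ, E) 𝓘(ℝ, ℝ) ∞ h U ∧
    (∀ y ∈ U, y ∈ S ↔ h y = 0) ∧
    (∃ v : TangentSpace 𝓘(ℝ, E) x, dirDeriv h x v ≠ 0) ∧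
    ∀ v : TangentSpace 𝓘(ℝ, E) x, dirDeriv h x v = 0 → v ≠ 0 → 0 < g.inner x v v

/-- The velocity of a curve defined on `[0, 1]` (one-sided at the end points). -/
def velocity (z : ℝ → M) (s : ℝ) : TangentSpace 𝓘(ℝ, E) (z s) :=
  mfderivWithin 𝓘(ℝ, ℝ) 𝓘(ℝ, E) z (Icc 0 1) s (1 : ℝ)

/-- The distance on `S` induced by the metric: the infimum of the lengths of the `C¹` curves
`[0, 1] → M` that lie in `S` and join the two points (`⊤` if there is none). -/
def inducedEDist (g : LorentzMetric E M) (S : Set M) (x y : M) : ℝ≥0∞ :=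
  ⨅ (γ : ℝ → M) (_ : ContMDiffOn 𝓘(ℝ, ℝ) 𝓘(ℝ, E) 1 γ (Icc 0 1) ∧ MapsTo γ (Icc 0 1) S ∧
      γ 0 = x ∧ γ 1 = y),
    ∫⁻ s in Icc (0 : ℝ) 1,
      ENNReal.ofReal (Real.sqrt (g.inner (γ s) (velocity (E := E) γ s) (velocity (E := E) γ s)))

/-- `S` is complete: every sequence of points of `S` that is Cauchy for the induced distance
converges, in this distance, to a point of `S`. -/
def IsCompleteHypersurface (g : LorentzMetric E M) (S : Set M) : Prop :=
  ∀ u : ℕ → M, (∀ n, u n ∈ S) →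
    (∀ ε : ℝ≥0∞, 0 < ε → ∃ N, ∀ m ≥ N, ∀ n ≥ N, inducedEDist g S (u m) (u n) < ε) →
    ∃ x ∈ S, Tendsto (fun n ↦ inducedEDist g S (u n) x) atTop (𝓝 0)

/-- The action functional `f(z) = ½ ∫₀¹ ⟨z', z'⟩ ds`. -/
def action (g : LorentzMetric E M) (z : ℝ → M) : ℝ :=
  (1 / 2) * ∫ s in (0 : ℝ)..1, g.inner (z s) (velocity (E := E) z s) (velocity (E := E) z s)

/-- The set `C¹_K(p, q)` of the `C¹` curves `[0, 1] → M` from `p` to `q` along which `⟨z', K⟩` is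
constant. (The values of `z : ℝ → M` outside `[0, 1]` are irrelevant.) -/
def C1K (g : LorentzMetric E M) (K : VField E M) (p q : M) : Set (ℝ → M) :=
  {z | ContMDiffOn 𝓘(ℝ, ℝ) 𝓘(ℝ, E) 1 z (Icc 0 1) ∧ z 0 = p ∧ z 1 = q ∧
    ∃ C : ℝ, ∀ s ∈ Icc (0 : ℝ) 1, g.inner (z s) (velocity (E := E) z s) (K (z s)) = C}

/-- The auxiliary Riemannian metric
`⟨v, w⟩_R = ⟨v, w⟩ - 2 ⟨v, K⟩ ⟨w, K⟩ / ⟨K, K⟩` obtained by reversing the sign of the Lorentzian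
metric on `K`. -/
def riemInner (g : LorentzMetric E M) (K : VField E M) (x : M) (v w : TangentSpace 𝓘(ℝ, E) x) : ℝ :=
  g.inner x v w - 2 * (g.inner x v (K x) * g.inner x w (K x)) / g.inner x (K x) (K x)

/-- The set `Ω¹(p, q)` of the absolutely continuous curves `z : [0, 1] → M` from `p` to `q` with
`∫₀¹ ⟨z', z'⟩_R ds < ∞`. A continuous curve is absolutely continuous (in charts) if and only if its
composition with every smooth function on `M` is. -/
def Omega1 (g : LorentzMetric E M) (K : VField E M) (p q : M) : Set (ℝ → M) :=
  {z | ContinuousOn z (Icc 0 1) ∧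
    (∀ φ : M → ℝ, ContMDiff 𝓘(ℝ, E) 𝓘(ℝ, ℝ) ∞ φ → AbsolutelyContinuousOnInterval (φ ∘ z) 0 1) ∧
    z 0 = p ∧ z 1 = q ∧
    ∫⁻ s in Icc (0 : ℝ) 1,
      ENNReal.ofReal (riemInner g K (z s) (velocity (E := E) z s) (velocity (E := E) z s)) < ⊤}

/-- Weak `H¹` convergence of curves `[0, 1] → M`: for every smooth function `φ : M → ℝ` the
functions `φ ∘ u n` converge to `φ ∘ z` weakly in the Hilbert space `H¹([0, 1], ℝ)`, i.e. the
functions converge weakly in `L²` and so do their derivatives. (When `M` is embedded in some `ℝᴺ`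
this is weak convergence in `H¹([0, 1], ℝᴺ)`, whichever embedding is used.) -/
def WeaklyConverges (E : Type*) [NormedAddCommGroup E] [NormedSpace ℝ E]
    {M : Type*} [TopologicalSpace M] [ChartedSpace E M]
    (u : ℕ → ℝ → M) (z : ℝ → M) : Prop :=
  ∀ φ : M → ℝ, ContMDiff 𝓘(ℝ, E) 𝓘(ℝ, ℝ) ∞ φ →
    ∀ ψ : ℝ → ℝ, MemLp ψ 2 (volume.restrict (Icc (0 : ℝ) 1)) →
      Tendsto (fun n ↦ ∫ s in (0 : ℝ)..1, φ (u n s) * ψ s) atTop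
        (𝓝 (∫ s in (0 : ℝ)..1, φ (z s) * ψ s)) ∧
      Tendsto (fun n ↦ ∫ s in (0 : ℝ)..1, deriv (φ ∘ u n) s * ψ s) atTop
        (𝓝 (∫ s in (0 : ℝ)..1, deriv (φ ∘ z) s * ψ s))

/-- Uniform convergence on `[0, 1]` of curves in `M`, with respect to every uniform structure
(for instance the distance of any auxiliary Riemannian metric) that induces the topology of `M`. -/
def UniformlyConverges {M : Type*} [τ : TopologicalSpace M] (u : ℕ → ℝ → M) (z : ℝ → M) : Prop :=
  ∀ 𝒰 : UniformSpace M, 𝒰.toTopologicalSpace = τ →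
    @TendstoUniformlyOn ℝ M ℕ 𝒰 u z atTop (Icc (0 : ℝ) 1)

/-- A set `𝒞` of curves from `p` to `q` is `c`-precompact for the action: every sequence in `𝒞`
with action at most `c` has a subsequence that converges weakly in `Ω¹(p, q)`, hence uniformly. -/
def IsPrecompact (g : LorentzMetric E M) (K : VField E M) (p q : M) (𝒞 : Set (ℝ → M)) (c : ℝ) :
    Prop :=
  ∀ u : ℕ → ℝ → M, (∀ n, u n ∈ 𝒞) → (∀ n, action g (u n) ≤ c) →
    ∃ z ∈ Omega1 g K p q, ∃ σ : ℕ → ℕ, StrictMono σ ∧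
      WeaklyConverges E (u ∘ σ) z ∧ UniformlyConverges (u ∘ σ) z

/-- The restriction of the action to `𝒞` is pseudo-coercive: `𝒞` is `c`-precompact for every real
`c`. (For `c` below the infimum of the action on `𝒞` this condition is void.) -/
def IsPseudoCoercive (g : LorentzMetric E M) (K : VField E M) (p q : M) (𝒞 : Set (ℝ → M)) : Prop :=
  ∀ c : ℝ, IsPrecompact g K p q 𝒞 c

end StationarySpacetime

end

/-! The orbits of `K` are inextendible timelike curves, so each meets `S` exactly once. This gives a
C¹ time function T with dT(K) = 1 and a projection onto `S` along the orbits. The flow consists of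
isometries, so the metric does not depend on T, and it is positive definite on ker dT. In effect the
spacetime is ℝ × S with a metric independent of the first factor.

For a curve z with velocity v put e = ⟨v, v⟩, a = dT(v), β = -⟨K, K⟩, C = ⟨v, K⟩ (constant along z),
and let w = v - aK be the horizontal part, with P = ⟨w, w⟩ and b = ⟨w, K⟩. Then b = C + βa and P = e
- 2aC - βa². The integral of a is the fixed number Δ = T(q) - T(p), and the integral of e is at most
2c. What is missing is a bound on C. It is obtained after confining the projected curve γ in `S` to
a fixed compact set, by one of two arguments (`IsStationary.exists_projection_bound`).

If |C| < 1, then √P ≤ 1/2 + P/2 ≤ 1/2 + e/2 - Ca, so γ has bounded Riemannian length. Completeness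
of `S` and the Hopf–Rinow theorem give compactness.

If |C| ≥ 1, let ε be the sign of -C. The cone speed (εb + √(b² + βP))/β is an asymmetric length
density of Fermat type. Since b² + βP = C² + βe, and √(C² + βe) ≤ |C| + βe/(2|C|), it is at most εa
+ e/(2|C|) (`IsStationary.coneSpeed_horiz_le`), so γ has bounded cone length. Balls for the cone
length are relatively compact because `S` is Cauchy: a curve in `S` of finite cone length without a
limit could be lifted to an inextendible timelike curve which stays on one side of `S`
(`IsStationary.exists_limit_coneSpeed`). Both cases use one Hopf–Rinow theorem for asymmetric length
structures (`IsLengthRelation.exists_isCompact`).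

On the compact set β lies between positive constants, and ∫|b| is bounded by the length. Integrating
b/β = C/β + a bounds C. Then a = (b - C)/β bounds T along z, and ⟨v, v⟩_R = e + 2C²/β has bounded
integral (`IsStationary.exists_energy_bound`). Bounded Riemannian energy in a compact set gives
uniform convergence of a subsequence by Arzelà–Ascoli. Weak compactness in L² gives weak convergence
of the derivatives of its compositions with smooth functions
(`IsStationary.exists_subseq_weaklyConverges`). -/

noncomputable section

namespace StationarySpacetime

/-! ### Differentiable dependence of an ordinary differential equation on the initial point -/

section LocalFlow

open scoped NNReal

variable {E : Type*} [NormedAddCommGroup E] [NormedSpace ℝ E]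

/-- Two-sided Grönwall estimate around the initial time `0`. -/
theorem norm_le_gronwallBound_abs {u u' : ℝ → E} {ε L δ : ℝ}
    (hu : ∀ t ∈ Ioo (-ε) ε, HasDerivAt u (u' t) t) (h0 : u 0 = 0)
    (hb : ∀ t ∈ Ioo (-ε) ε, ‖u' t‖ ≤ L * ‖u t‖ + δ) {t : ℝ} (ht : t ∈ Ioo (-ε) ε) :
    ‖u t‖ ≤ gronwallBound 0 L δ |t| := by
  rcases le_total 0 t with h | h
  · have key := norm_le_gronwallBound_of_norm_deriv_right_le (f := u) (f' := u') (δ := 0) (K := L)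
      (ε := δ) (a := 0) (b := t)
      (fun s hs ↦ (hu s ⟨by linarith [ht.1, ht.2, hs.1, hs.2],
        by linarith [ht.1, ht.2, hs.1, hs.2]⟩).continuousAt.continuousWithinAt)
      (fun s hs ↦ (hu s ⟨by linarith [ht.1, ht.2, hs.1, hs.2],
        by linarith [ht.1, ht.2, hs.1, hs.2]⟩).hasDerivWithinAt) (by simp [h0])
      (fun s hs ↦ hb s ⟨by linarith [ht.1, ht.2, hs.1, hs.2],
        by linarith [ht.1, ht.2, hs.1, hs.2]⟩) t ⟨h, le_rfl⟩
    simpa [abs_of_nonneg h] using key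
  · have hd : ∀ s ∈ Ioo (-ε) ε, HasDerivAt (fun s ↦ u (-s)) (-u' (-s)) s := by
      intro s hs
      have := (hu (-s) ⟨by linarith [hs.2], by linarith [hs.1]⟩).scomp s (hasDerivAt_neg s)
      simpa [Function.comp_def] using this
    have key := norm_le_gronwallBound_of_norm_deriv_right_le (f := fun s ↦ u (-s))
      (f' := fun s ↦ -u' (-s)) (δ := 0) (K := L) (ε := δ) (a := 0) (b := -t)
      (fun s hs ↦ (hd s ⟨by linarith [ht.1, ht.2, hs.1, hs.2],
        by linarith [ht.1, ht.2, hs.1, hs.2]⟩).continuousAt.continuousWithinAt)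
      (fun s hs ↦ (hd s ⟨by linarith [ht.1, ht.2, hs.1, hs.2],
        by linarith [ht.1, ht.2, hs.1, hs.2]⟩).hasDerivWithinAt) (by simp [h0])
      (fun s hs ↦ by
        simpa using hb (-s) ⟨by linarith [ht.1, ht.2, hs.1, hs.2],
          by linarith [ht.1, ht.2, hs.1, hs.2]⟩) (-t) ⟨by linarith, le_rfl⟩
    simpa [abs_of_nonpos h] using key

variable [CompleteSpace E]

/-- A `C²` vector field has a local flow `Φ` which is differentiable in the initial point; the
derivative `W` solves the variational equation. -/
theorem exists_local_flow {f : E → E} {x₀ : E} (hf : ContDiffAt ℝ 2 f x₀) :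
    ∃ (Φ : ℝ → E → E) (W : ℝ → E → E →L[ℝ] E) (ε : ℝ) (V : Set E), 0 < ε ∧ IsOpen V ∧ x₀ ∈ V ∧
      (∀ x ∈ V, Φ 0 x = x ∧ W 0 x = ContinuousLinearMap.id ℝ E) ∧
      (∀ t ∈ Ioo (-ε) ε, ∀ x ∈ V, HasDerivAt (Φ · x) (f (Φ t x)) t ∧
        HasFDerivAt (Φ t) (W t x) x ∧
        HasDerivAt (W · x) ((fderiv ℝ f (Φ t x)).comp (W t x)) t) ∧
      ContinuousOn (fun p : ℝ × E ↦ Φ p.1 p.2) (Ioo (-ε) ε ×ˢ V) ∧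
      ContinuousOn (fun p : ℝ × E ↦ W p.1 p.2) (Ioo (-ε) ε ×ˢ V) := by
  have hf' : ContDiffAt ℝ 1 (fderiv ℝ f) x₀ := hf.fderiv_right (by norm_num)
  have hf1 : ContDiffAt ℝ 1 f x₀ := hf.of_le (by norm_num)
  -- The equation is coupled with its linearization. The coupled field is C¹ because `f` is C², so
  -- Picard–Lindelöf yields the flow and the candidate for its derivative at once.
  let F : E × (E →L[ℝ] E) → E × (E →L[ℝ] E) := fun p ↦ (f p.1, (fderiv ℝ f p.1).comp p.2)
  have hF : ContDiffAt ℝ 1 F (x₀, ContinuousLinearMap.id ℝ E) := by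
    refine ContDiffAt.prodMk (hf1.comp (x₀, ContinuousLinearMap.id ℝ E) contDiffAt_fst) ?_
    exact ContDiffAt.clm_comp (hf'.comp (x₀, ContinuousLinearMap.id ℝ E) contDiffAt_fst)
      contDiffAt_snd
  obtain ⟨ε, hε, a, r, L, K, hr, hpl⟩ := IsPicardLindelof.of_contDiffAt_one hF
  obtain ⟨α, hα, L', hL'⟩ :=
    (hpl 0).exists_forall_mem_closedBall_eq_hasDerivWithinAt_lipschitzOnWith
  have hαc : ContinuousOn (Function.uncurry α) (Metric.closedBall (x₀, ContinuousLinearMap.id ℝ E) r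
      ×ˢ Icc (0 - ε) (0 + ε)) := by
    apply continuousOn_prod_of_continuousOn_lipschitzOnWith _ L' _ hL'
    exact fun x hx ↦ HasDerivWithinAt.continuousOn (hα x hx).2
  -- a convex neighbourhood on which `f` is under control
  obtain ⟨K₂, s₂, hs₂, hK₂⟩ := hf'.exists_lipschitzOnWith
  have hdiff : ∀ᶠ x in 𝓝 x₀, DifferentiableAt ℝ f x := by
    filter_upwards [hf1.eventually (by simp)] with x hx using hx.differentiableAt (by simp)
  have hbd : ∀ᶠ x in 𝓝 x₀, ‖fderiv ℝ f x‖ < ‖fderiv ℝ f x₀‖ + 1 :=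
    hf'.continuousAt.norm.eventually (gt_mem_nhds (by linarith))
  obtain ⟨ρ, hρ, hball⟩ := Metric.eventually_nhds_iff_ball.1
    ((hdiff.and hbd).and (eventually_mem_set.2 hs₂))
  let B := Metric.ball x₀ ρ
  have hmk : Continuous fun x : E ↦ (x, ContinuousLinearMap.id ℝ E) := by fun_prop
  have hmem : ∀ x ∈ Metric.closedBall x₀ r,
      ((x, ContinuousLinearMap.id ℝ E) : E × (E →L[ℝ] E)) ∈
        Metric.closedBall (x₀, ContinuousLinearMap.id ℝ E) (r : ℝ) := by
    intro x hx
    simpa [Prod.dist_eq] using hx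
  let Φ : ℝ → E → E := fun t x ↦ (α (x, ContinuousLinearMap.id ℝ E) t).1
  let W : ℝ → E → E →L[ℝ] E := fun t x ↦ (α (x, ContinuousLinearMap.id ℝ E) t).2
  have hcont : ContinuousOn (fun p : ℝ × E ↦ α (p.2, ContinuousLinearMap.id ℝ E) p.1)
      (Icc (-ε) ε ×ˢ Metric.closedBall x₀ r) := by
    have : ContinuousOn (fun p : ℝ × E ↦ ((p.2, ContinuousLinearMap.id ℝ E), p.1))
      (Icc (-ε) ε ×ˢ Metric.closedBall x₀ r) := by fun_prop
    refine hαc.comp this fun p hp ↦ ⟨hmem _ hp.2, by simpa using hp.1⟩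
  have hn : Icc (-ε) ε ×ˢ Metric.closedBall x₀ (r : ℝ) ∈ 𝓝 ((0 : ℝ), x₀) :=
    prod_mem_nhds (Icc_mem_nhds (by linarith) hε) (Metric.closedBall_mem_nhds _ hr)
  have hΦ0 : Φ 0 x₀ = x₀ := by
    have := (hα _ (hmem x₀ (by simp))).1
    simp [Φ, this]
  have hev : ∀ᶠ p : ℝ × E in 𝓝 ((0 : ℝ), x₀), Φ p.1 p.2 ∈ B := by
    have h1 : ContinuousAt (fun p : ℝ × E ↦ Φ p.1 p.2) (0, x₀) :=
      continuous_fst.continuousAt.comp (hcont.continuousAt hn)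
    apply h1.eventually
    simpa [hΦ0] using Metric.ball_mem_nhds x₀ hρ
  obtain ⟨u, hu, v, hv, huv⟩ := mem_nhds_prod_iff.1 (hev.and (eventually_mem_set.2 hn))
  obtain ⟨ε₁, hε₁, hu₁⟩ := Metric.mem_nhds_iff.1 hu
  obtain ⟨r₁, hr₁, hv₁⟩ := Metric.mem_nhds_iff.1 hv
  have hio : Ioo (-ε₁) ε₁ ⊆ u := by
    rw [Real.ball_eq_Ioo] at hu₁; simpa using hu₁
  have hmain : ∀ t ∈ Ioo (-(min ε₁ ε)) (min ε₁ ε), ∀ x ∈ Metric.ball x₀ r₁,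
      Φ t x ∈ B ∧ x ∈ Metric.closedBall x₀ (r : ℝ) ∧ t ∈ Ioo (-ε) ε := by
    intro t ht x hx
    have ht' : t ∈ Ioo (-ε₁) ε₁ := ⟨by linarith [ht.1, min_le_left ε₁ ε],
      lt_of_lt_of_le ht.2 (min_le_left _ _)⟩
    have := huv (⟨hio ht', hv₁ hx⟩ : (t, x) ∈ u ×ˢ v)
    exact ⟨this.1, this.2.2, ⟨by linarith [ht.1, min_le_right ε₁ ε],
      lt_of_lt_of_le ht.2 (min_le_right _ _)⟩⟩
  have hder : ∀ t ∈ Ioo (-(min ε₁ ε)) (min ε₁ ε), ∀ x ∈ Metric.ball x₀ r₁,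
      HasDerivAt (α (x, ContinuousLinearMap.id ℝ E)) (F (α (x, ContinuousLinearMap.id ℝ E) t)) t := by
    intro t ht x hx
    obtain ⟨-, h2, h3⟩ := hmain t ht x hx
    exact ((hα _ (hmem x h2)).2 t (by simpa using Ioo_subset_Icc_self h3)).hasDerivAt
      (Icc_mem_nhds (by simpa using h3.1) (by simpa using h3.2))
  have hinit : ∀ x ∈ Metric.ball x₀ r₁, α (x, ContinuousLinearMap.id ℝ E) 0 =
      (x, ContinuousLinearMap.id ℝ E) := fun x hx ↦
    (hα _ (hmem x (hmain 0 ⟨by simp [hε, hε₁], by simp [hε, hε₁]⟩ x hx).2.1)).1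
  have hdΦ : ∀ t ∈ Ioo (-(min ε₁ ε)) (min ε₁ ε), ∀ x ∈ Metric.ball x₀ r₁,
      HasDerivAt (Φ · x) (f (Φ t x)) t := fun t ht x hx ↦ (hder t ht x hx).fst
  have hdW : ∀ t ∈ Ioo (-(min ε₁ ε)) (min ε₁ ε), ∀ x ∈ Metric.ball x₀ r₁,
      HasDerivAt (W · x) ((fderiv ℝ f (Φ t x)).comp (W t x)) t :=
    fun t ht x hx ↦ (hder t ht x hx).snd
  have hsub : Ioo (-(min ε₁ ε)) (min ε₁ ε) ×ˢ Metric.ball x₀ r₁ ⊆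
      Icc (-ε) ε ×ˢ Metric.closedBall x₀ (r : ℝ) := fun p hp ↦
    ⟨Ioo_subset_Icc_self (hmain _ hp.1 _ hp.2).2.2, (hmain _ hp.1 _ hp.2).2.1⟩
  refine ⟨Φ, W, min ε₁ ε, Metric.ball x₀ r₁, lt_min hε₁ hε, Metric.isOpen_ball,
    Metric.mem_ball_self hr₁, fun x hx ↦ ?_, fun t ht x hx ↦ ⟨hdΦ t ht x hx, ?_, hdW t ht x hx⟩,
    continuous_fst.comp_continuousOn (hcont.mono hsub),
    continuous_snd.comp_continuousOn (hcont.mono hsub)⟩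
  · simp [Φ, W, hinit x hx]
  -- the derivative in the initial point
  set Λ : ℝ := ‖fderiv ℝ f x₀‖ + 1
  have hLip : ∀ t ∈ Ioo (-(min ε₁ ε)) (min ε₁ ε), ∀ y ∈ Metric.ball x₀ r₁,
      ‖Φ t y - Φ t x‖ ≤ L' * ‖y - x‖ := by
    intro t ht y hy
    have h3 := (hL' t (by simpa using Ioo_subset_Icc_self (hmain t ht x hx).2.2)).dist_le_mul
      _ (hmem y (hmain t ht y hy).2.1) _ (hmem x (hmain t ht x hx).2.1)
    rw [Prod.dist_eq, Prod.dist_eq] at h3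
    simp only [dist_self] at h3
    rw [max_eq_left (dist_nonneg : 0 ≤ dist y x)] at h3
    rw [← dist_eq_norm, ← dist_eq_norm]
    exact (le_max_left _ _).trans h3
  -- Quadratic Taylor remainder, from the Lipschitz bound for `fderiv ℝ f` on a ball.
  have hrem : ∀ y ∈ B, ∀ z ∈ B, ‖f y - f z - fderiv ℝ f z (y - z)‖ ≤ K₂ * ‖y - z‖ * ‖y - z‖ := by
    intro y hy z hz
    have hseg : segment ℝ z y ⊆ B := (convex_ball x₀ ρ).segment_subset hz hy
    refine Convex.norm_image_sub_le_of_norm_hasFDerivWithin_le' (s := segment ℝ z y)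
      (f := f) (f' := fderiv ℝ f) (φ := fderiv ℝ f z)
      (fun w hw ↦ (hball w (hseg hw)).1.1.hasFDerivAt.hasFDerivWithinAt) (fun w hw ↦ ?_)
      (convex_segment _ _) (left_mem_segment _ _ _) (right_mem_segment _ _ _)
    have h1 := hK₂.dist_le_mul _ (hball w (hseg hw)).2 _ (hball z hz).2
    rw [dist_eq_norm, dist_eq_norm] at h1
    refine h1.trans ?_
    gcongr
    have := norm_sub_le_of_mem_segment hw
    simpa using this
  -- The error u of the linear approximation starts at 0 and satisfies ‖u'‖ ≤ Λ‖u‖ + K₂ (L' ‖y -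
  -- x‖)², so Grönwall makes it quadratic in ‖y - x‖.
  have hquad : ∀ y ∈ Metric.ball x₀ r₁, ‖Φ t y - Φ t x - W t x (y - x)‖ ≤
      gronwallBound 0 Λ (K₂ * L' * L') |t| * ‖y - x‖ * ‖y - x‖ := by
    intro y hy
    have key := norm_le_gronwallBound_abs (ε := min ε₁ ε) (L := Λ)
      (δ := K₂ * (L' * ‖y - x‖) * (L' * ‖y - x‖))
      (u := fun s ↦ Φ s y - Φ s x - W s x (y - x))
      (u' := fun s ↦ f (Φ s y) - f (Φ s x) - fderiv ℝ f (Φ s x) (W s x (y - x)))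
      (fun s hs ↦ ((hdΦ s hs y hy).sub (hdΦ s hs x hx)).sub
        ((hdW s hs x hx).clm_apply (hasDerivAt_const s (y - x)) |>.congr_deriv (by simp)))
      (by simp [Φ, W, hinit x hx, hinit y hy])
      (fun s hs ↦ by
        have h1 := hrem _ (hmain s hs y hy).1 _ (hmain s hs x hx).1
        have h2 : ‖fderiv ℝ f (Φ s x)‖ ≤ Λ := (hball _ (hmain s hs x hx).1).1.2.le
        have h3 := hLip s hs y hy
        calc ‖f (Φ s y) - f (Φ s x) - fderiv ℝ f (Φ s x) (W s x (y - x))‖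
            = ‖fderiv ℝ f (Φ s x) (Φ s y - Φ s x - W s x (y - x)) +
                (f (Φ s y) - f (Φ s x) - fderiv ℝ f (Φ s x) (Φ s y - Φ s x))‖ := by
              congr 1; simp only [map_sub]; abel
          _ ≤ ‖fderiv ℝ f (Φ s x)‖ * ‖Φ s y - Φ s x - W s x (y - x)‖ +
                K₂ * ‖Φ s y - Φ s x‖ * ‖Φ s y - Φ s x‖ :=
              (norm_add_le _ _).trans (add_le_add (ContinuousLinearMap.le_opNorm _ _) h1)
          _ ≤ _ := by gcongr) ht
    -- With zero initial value the Grönwall bound is linear in its inhomogeneity, so the factor ‖y -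
    -- x‖² can be taken out. The bound is given by a separate formula when Λ = 0.
    refine key.trans (le_of_eq ?_)
    by_cases hΛ : Λ = 0
    · simp only [hΛ, gronwallBound_K0]; ring
    · simp only [gronwallBound_of_K_ne_0 hΛ]; ring
  rw [hasFDerivAt_iff_isLittleO]
  have hO : (fun y ↦ Φ t y - Φ t x - W t x (y - x)) =O[𝓝 x] fun y ↦ ‖y - x‖ * ‖y - x‖ := by
    refine Asymptotics.IsBigO.of_bound (gronwallBound 0 Λ (K₂ * L' * L') |t|) ?_
    filter_upwards [Metric.isOpen_ball.mem_nhds hx] with y hy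
    simpa [mul_assoc] using hquad y hy
  refine hO.trans_isLittleO ?_
  have h1 : (fun y : E ↦ ‖y - x‖) =o[𝓝 x] fun _ ↦ (1 : ℝ) := by
    rw [Asymptotics.isLittleO_one_iff]
    have : Continuous fun y : E ↦ ‖y - x‖ := by fun_prop
    simpa using this.tendsto x
  have h2 : (fun y : E ↦ ‖y - x‖) =O[𝓝 x] fun y ↦ ‖y - x‖ := Asymptotics.isBigO_refl _ _
  have h3 := h1.mul_isBigO h2
  simp only [one_mul] at h3
  exact h3.norm_right.trans_isBigO (by simpa using Asymptotics.isBigO_refl _ _)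

end LocalFlow

/-! ### The flow of a complete field and its representation in a chart -/

section Flow

variable {E : Type*} [NormedAddCommGroup E] [NormedSpace ℝ E]
  {M : Type*} [TopologicalSpace M] [ChartedSpace E M]

/-- The flow of a complete vector field. -/
def flow {K : VField E M} (hc : IsCompleteField K) (t : ℝ) (x : M) : M := (hc x).choose t

variable {K : VField E M} (hc : IsCompleteField K)

theorem flow_zero (x : M) : flow hc 0 x = x := (hc x).choose_spec.1

theorem isMIntegralCurve_flow (x : M) : IsMIntegralCurve (fun t ↦ flow hc t x) K :=
  (hc x).choose_spec.2

/-- The representation of a vector field in the preferred chart at `x₀`. -/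
def chartField (K : VField E M) (x₀ : M) : E → E :=
  VectorField.mpullback 𝓘(ℝ, E) 𝓘(ℝ, E) (extChartAt 𝓘(ℝ, E) x₀).symm K

variable [IsManifold 𝓘(ℝ, E) ∞ M]

instance isManifold_one : IsManifold 𝓘(ℝ, E) 1 M := IsManifold.of_le (n := ∞) (by simp)

theorem two_le_infty : (2 : WithTop ℕ∞) ≤ ((⊤ : ℕ∞) : WithTop ℕ∞) :=
  WithTop.coe_le_coe.2 (le_top : (2 : ℕ∞) ≤ ⊤)

theorem one_le_infty : (1 : WithTop ℕ∞) ≤ ((⊤ : ℕ∞) : WithTop ℕ∞) :=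
  WithTop.coe_le_coe.2 (le_top : (1 : ℕ∞) ≤ ⊤)

instance isManifold_two : IsManifold 𝓘(ℝ, E) 2 M := IsManifold.of_le (n := ∞) two_le_infty

theorem mdifferentiableAt_extChartAt_symm {x₀ : M} {u : E}
    (hu : u ∈ (extChartAt 𝓘(ℝ, E) x₀).target) :
    MDifferentiableAt 𝓘(ℝ, E) 𝓘(ℝ, E) (extChartAt 𝓘(ℝ, E) x₀).symm u := by
  have := mdifferentiableWithinAt_extChartAt_symm (I := 𝓘(ℝ, E)) hu
  rwa [modelWithCornersSelf_coe, range_id, mdifferentiableWithinAt_univ] at this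

theorem isInvertible_mfderiv_extChartAt_symm {x₀ : M} {u : E}
    (hu : u ∈ (extChartAt 𝓘(ℝ, E) x₀).target) :
    (mfderiv 𝓘(ℝ, E) 𝓘(ℝ, E) (extChartAt 𝓘(ℝ, E) x₀).symm u).IsInvertible := by
  have := isInvertible_mfderivWithin_extChartAt_symm (I := 𝓘(ℝ, E)) hu
  rwa [modelWithCornersSelf_coe, range_id, mfderivWithin_univ] at this

theorem mfderiv_extChartAt_symm_chartField {x₀ : M} {u : E}
    (hu : u ∈ (extChartAt 𝓘(ℝ, E) x₀).target) :
    mfderiv 𝓘(ℝ, E) 𝓘(ℝ, E) (extChartAt 𝓘(ℝ, E) x₀).symm u (chartField K x₀ u : E) =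
      K ((extChartAt 𝓘(ℝ, E) x₀).symm u) := by
  rw [chartField, VectorField.mpullback_apply]
  exact (isInvertible_mfderiv_extChartAt_symm hu).self_apply_inverse _

theorem hasMFDerivAt_extChartAt_symm_comp {x₀ : M} {c : ℝ → E} {t : ℝ} {w : E}
    (hw : HasDerivAt c w t) (hu : c t ∈ (extChartAt 𝓘(ℝ, E) x₀).target) :
    HasMFDerivAt 𝓘(ℝ, ℝ) 𝓘(ℝ, E) (fun s ↦ (extChartAt 𝓘(ℝ, E) x₀).symm (c s)) t
      ((1 : ℝ →L[ℝ] ℝ).smulRight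
        (mfderiv 𝓘(ℝ, E) 𝓘(ℝ, E) (extChartAt 𝓘(ℝ, E) x₀).symm (c t) w)) := by
  have h := (mdifferentiableAt_extChartAt_symm hu).hasMFDerivAt.comp t
    hw.hasFDerivAt.hasMFDerivAt
  have h' : (mfderiv 𝓘(ℝ, E) 𝓘(ℝ, E) (extChartAt 𝓘(ℝ, E) x₀).symm (c t)).comp
      (ContinuousLinearMap.toSpanSingleton ℝ w) = ((1 : ℝ →L[ℝ] ℝ).smulRight
        (mfderiv 𝓘(ℝ, E) 𝓘(ℝ, E) (extChartAt 𝓘(ℝ, E) x₀).symm (c t) w)) :=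
    ContinuousLinearMap.ext fun a ↦
      (mfderiv 𝓘(ℝ, E) 𝓘(ℝ, E) (extChartAt 𝓘(ℝ, E) x₀).symm (c t)).map_smul a w
  exact h' ▸ h

theorem SmoothVFieldOn.contMDiff_one (hK : SmoothVFieldOn K univ) :
    ContMDiff 𝓘(ℝ, E) 𝓘(ℝ, E).tangent 1 (fun x ↦ (⟨x, K x⟩ : TangentBundle 𝓘(ℝ, E) M)) :=
  (contMDiffOn_univ.1 hK).of_le (by simp)

theorem contDiffAt_chartField [CompleteSpace E] (hK : SmoothVFieldOn K univ) (x₀ : M) :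
    ContDiffAt ℝ ∞ (chartField K x₀) (extChartAt 𝓘(ℝ, E) x₀ x₀) := by
  have h1 : ContMDiffAt 𝓘(ℝ, E) 𝓘(ℝ, E).tangent ∞
      (fun x ↦ (⟨x, K x⟩ : TangentBundle 𝓘(ℝ, E) M))
      ((extChartAt 𝓘(ℝ, E) x₀).symm (extChartAt 𝓘(ℝ, E) x₀ x₀)) :=
    (hK _ (mem_univ _)).contMDiffAt univ_mem
  have h2 : ContMDiffAt 𝓘(ℝ, E) 𝓘(ℝ, E) ∞ (extChartAt 𝓘(ℝ, E) x₀).symm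
      (extChartAt 𝓘(ℝ, E) x₀ x₀) :=
    (contMDiffOn_extChartAt_symm x₀).contMDiffAt (extChartAt_target_mem_nhds x₀)
  have h3 := h1.mpullback_vectorField_preimage h2
    (isInvertible_mfderiv_extChartAt_symm (mem_extChartAt_target x₀)) (m := ∞) (by simp)
  rwa [contMDiffAt_vectorSpace_iff_contDiffAt] at h3

variable [T2Space M]

theorem flow_unique (hK : SmoothVFieldOn K univ) {γ : ℝ → M} (hγ : IsMIntegralCurve γ K) (t : ℝ) :
    γ t = flow hc t (γ 0) :=
  congrFun (isMIntegralCurve_Ioo_eq_of_contMDiff_boundaryless (t₀ := 0) hK.contMDiff_one hγ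
    (isMIntegralCurve_flow hc (γ 0)) (flow_zero hc _).symm) t

theorem flow_add (hK : SmoothVFieldOn K univ) (s t : ℝ) (x : M) :
    flow hc (s + t) x = flow hc s (flow hc t x) := by
  have := flow_unique hc hK ((isMIntegralCurve_flow hc x).comp_add t) s
  simpa using this

theorem flow_flow_neg (hK : SmoothVFieldOn K univ) (t : ℝ) (x : M) :
    flow hc t (flow hc (-t) x) = x := by
  rw [← flow_add hc hK, add_neg_cancel, flow_zero]

variable [CompleteSpace E]

/-- In a chart the flow is given by a local flow of the chart representation of the field. -/
theorem exists_flow_eq_extChartAt_symm (hK : SmoothVFieldOn K univ) (x₀ : M) :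
    ∃ (Φ : ℝ → E → E) (W : ℝ → E → E →L[ℝ] E) (ε : ℝ) (V : Set E), 0 < ε ∧ IsOpen V ∧
      extChartAt 𝓘(ℝ, E) x₀ x₀ ∈ V ∧ V ⊆ (extChartAt 𝓘(ℝ, E) x₀).target ∧
      (∀ u ∈ V, Φ 0 u = u ∧ W 0 u = ContinuousLinearMap.id ℝ E) ∧
      (∀ t ∈ Ioo (-ε) ε, ∀ u ∈ V, Φ t u ∈ (extChartAt 𝓘(ℝ, E) x₀).target ∧
        flow hc t ((extChartAt 𝓘(ℝ, E) x₀).symm u) = (extChartAt 𝓘(ℝ, E) x₀).symm (Φ t u) ∧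
        HasDerivAt (Φ · u) (chartField K x₀ (Φ t u)) t ∧
        HasFDerivAt (Φ t) (W t u) u ∧
        HasDerivAt (W · u) ((fderiv ℝ (chartField K x₀) (Φ t u)).comp (W t u)) t) ∧
      ContDiffOn ℝ 1 (fun p : ℝ × E ↦ Φ p.1 p.2) (Ioo (-ε) ε ×ˢ V) := by
  set φ := extChartAt 𝓘(ℝ, E) x₀
  have hf := contDiffAt_chartField hK x₀
  obtain ⟨Φ, W, ε, V, hε, hV, hx₀, h0, h, hΦ, hW⟩ :=
    exists_local_flow (hf.of_le two_le_infty)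
  have hnhds : Ioo (-ε) ε ×ˢ V ∈ 𝓝 ((0 : ℝ), φ x₀) :=
    prod_mem_nhds (Ioo_mem_nhds (by linarith) hε) (hV.mem_nhds hx₀)
  have hfc : ∀ᶠ u in 𝓝 (φ x₀), ContinuousAt (chartField K x₀) u := by
    filter_upwards [(hf.of_le one_le_infty).eventually (by simp)] with u hu
      using hu.continuousAt
  have htend : Tendsto (fun p : ℝ × E ↦ Φ p.1 p.2) (𝓝 ((0 : ℝ), φ x₀)) (𝓝 (φ x₀)) := by
    have := (hΦ.continuousAt hnhds).tendsto
    rwa [(h0 _ hx₀).1] at this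
  have hsnd : Tendsto (fun p : ℝ × E ↦ p.2) (𝓝 ((0 : ℝ), φ x₀)) (𝓝 (φ x₀)) :=
    continuous_snd.continuousAt
  have hev : ∀ᶠ p : ℝ × E in 𝓝 ((0 : ℝ), φ x₀), (Φ p.1 p.2 ∈ φ.target ∧
      ContinuousAt (chartField K x₀) (Φ p.1 p.2)) ∧ p.2 ∈ φ.target :=
    (htend.eventually ((eventually_mem_set.2 (extChartAt_target_mem_nhds x₀)).and hfc)).and
      (hsnd.eventually
        (eventually_mem_set.2 (extChartAt_target_mem_nhds x₀)))
  obtain ⟨s, hs, v, hv, hsv⟩ := mem_nhds_prod_iff.1 (hev.and (eventually_mem_set.2 hnhds))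
  obtain ⟨δ, hδ, hsδ⟩ := Metric.mem_nhds_iff.1 hs
  obtain ⟨v', hv'v, hv'o, hv'⟩ := mem_nhds_iff.1 hv
  rw [Real.ball_eq_Ioo, zero_sub, zero_add] at hsδ
  have hall : ∀ t ∈ Ioo (-δ) δ, ∀ u ∈ v', ((Φ t u ∈ φ.target ∧
      ContinuousAt (chartField K x₀) (Φ t u)) ∧ u ∈ φ.target) ∧ t ∈ Ioo (-ε) ε ∧ u ∈ V :=
    fun t ht u hu ↦ hsv (⟨hsδ ht, hv'v hu⟩ : (t, u) ∈ s ×ˢ v)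
  have h00 : (0 : ℝ) ∈ Ioo (-δ) δ := ⟨by linarith, hδ⟩
  refine ⟨Φ, W, δ, v', hδ, hv'o, hv', fun u hu ↦ (hall 0 h00 u hu).1.2,
    fun u hu ↦ h0 u (hall 0 h00 u hu).2.2, fun t ht u hu ↦ ?_, ?_⟩
  · obtain ⟨⟨⟨h1, h2⟩, h3⟩, h4, h5⟩ := hall t ht u hu
    refine ⟨h1, ?_, h t h4 u h5⟩
    -- The local flow of the chart field, carried to the manifold, is an integral curve of `K`;
    -- uniqueness identifies it with the chosen global one.
    have hint : IsMIntegralCurveOn (fun s ↦ φ.symm (Φ s u)) K (Ioo (-δ) δ) := by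
      intro s hs
      obtain ⟨⟨⟨g1, -⟩, -⟩, g4, g5⟩ := hall s hs u hu
      have := hasMFDerivAt_extChartAt_symm_comp (h s g4 u g5).1 g1
      rw [mfderiv_extChartAt_symm_chartField g1] at this
      exact this.hasMFDerivWithinAt
    have := isMIntegralCurveOn_Ioo_eqOn_of_contMDiff_boundaryless (t₀ := 0) h00 hK.contMDiff_one
      ((isMIntegralCurve_flow hc (φ.symm u)).isMIntegralCurveOn _) hint
      (by simp [flow_zero, (h0 u h5).1])
    exact this ht
  · intro p hp
    refine ContDiffAt.contDiffWithinAt ?_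
    have hopen : IsOpen (Ioo (-δ) δ ×ˢ v') := isOpen_Ioo.prod hv'o
    have hsub : Ioo (-δ) δ ×ˢ v' ⊆ Ioo (-ε) ε ×ˢ V := fun p hp ↦
      ⟨(hall _ hp.1 _ hp.2).2.1, (hall _ hp.1 _ hp.2).2.2⟩
    rw [contDiffAt_one_iff]
    have hc1 : ContinuousOn (fun p : ℝ × E ↦
        (1 : ℝ →L[ℝ] ℝ).smulRight (chartField K x₀ (Φ p.1 p.2))) (Ioo (-δ) δ ×ˢ v') := by
      have : ContinuousOn (fun p : ℝ × E ↦ chartField K x₀ (Φ p.1 p.2)) (Ioo (-δ) δ ×ˢ v') := by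
        intro q hq
        exact ContinuousAt.comp_continuousWithinAt (f := fun p : ℝ × E ↦ Φ p.1 p.2)
          (hall _ hq.1 _ hq.2).1.1.2 ((hΦ.mono hsub) q hq)
      exact (ContinuousLinearMap.smulRightL ℝ ℝ E (1 : ℝ →L[ℝ] ℝ)).continuous.comp_continuousOn this
    have hc2 := hW.mono hsub
    refine ⟨fun p ↦ ((1 : ℝ →L[ℝ] ℝ).smulRight (chartField K x₀ (Φ p.1 p.2))).coprod (W p.1 p.2),
      Ioo (-δ) δ ×ˢ v', hopen.mem_nhds hp, ?_, ?_⟩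
    · have : Continuous fun q : (ℝ →L[ℝ] E) × (E →L[ℝ] E) ↦ q.1.coprod q.2 :=
        (ContinuousLinearMap.coprodEquivL ℝ).continuous
      exact this.comp_continuousOn (hc1.prodMk hc2)
    · intro q hq
      refine (hasStrictFDerivAt_uncurry_coprod (f := fun t u ↦ Φ t u)
        (f₁ := fun t u ↦ (1 : ℝ →L[ℝ] ℝ).smulRight (chartField K x₀ (Φ t u)))
        (f₂ := fun t u ↦ W t u) (u := q) ?_ ?_ (hc1.continuousAt (hopen.mem_nhds hq))
        (hc2.continuousAt (hopen.mem_nhds hq))).hasFDerivAt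
      · filter_upwards [hopen.mem_nhds hq] with r hr
        exact (h _ (hsub hr).1 _ (hsub hr).2).1.hasFDerivAt
      · filter_upwards [hopen.mem_nhds hq] with r hr
        exact (h _ (hsub hr).1 _ (hsub hr).2).2.1

end Flow

/-! ### Regularity of the global flow -/

section SmoothFlow

variable {E : Type*} [NormedAddCommGroup E] [NormedSpace ℝ E]
  {M : Type*} [TopologicalSpace M] [ChartedSpace E M] [IsManifold 𝓘(ℝ, E) ∞ M] [T2Space M]
  [CompleteSpace E] {K : VField E M} (hc : IsCompleteField K)

theorem exists_contMDiffOn_flow (hK : SmoothVFieldOn K univ) (x₀ : M) :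
    ∃ ε > 0, ∃ U : Set M, IsOpen U ∧ x₀ ∈ U ∧
      ContMDiffOn (𝓘(ℝ, ℝ).prod 𝓘(ℝ, E)) 𝓘(ℝ, E) 1 (fun p : ℝ × M ↦ flow hc p.1 p.2)
        (Ioo (-ε) ε ×ˢ U) := by
  obtain ⟨Φ, W, ε, V, hε, hV, hx₀, hVt, -, h, hΦ⟩ := exists_flow_eq_extChartAt_symm hc hK x₀
  set φ := extChartAt 𝓘(ℝ, E) x₀
  refine ⟨ε, hε, φ.source ∩ φ ⁻¹' V, ?_, ⟨mem_extChartAt_source x₀, hx₀⟩, ?_⟩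
  · exact (continuousOn_extChartAt x₀).isOpen_inter_preimage (isOpen_extChartAt_source x₀) hV
  · have h1 : ContMDiffOn (𝓘(ℝ, ℝ).prod 𝓘(ℝ, E)) 𝓘(ℝ, E) 1
        (fun p : ℝ × M ↦ φ p.2) (Ioo (-ε) ε ×ˢ (φ.source ∩ φ ⁻¹' V)) := by
      refine (contMDiffOn_extChartAt (I := 𝓘(ℝ, E)) (x := x₀) (n := 1)).comp
        contMDiffOn_snd fun p hp ↦ ?_
      rw [← extChartAt_source (I := 𝓘(ℝ, E))]
      exact hp.2.1
    have h2 : ContMDiffOn (𝓘(ℝ, ℝ).prod 𝓘(ℝ, E)) 𝓘(ℝ, ℝ × E) 1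
        (fun p : ℝ × M ↦ (p.1, φ p.2)) (Ioo (-ε) ε ×ˢ (φ.source ∩ φ ⁻¹' V)) :=
      contMDiffOn_fst.prodMk_space h1
    have h3 := hΦ.contMDiffOn.comp h2 fun p hp ↦ ⟨hp.1, hp.2.2⟩
    have h4 := (contMDiffOn_extChartAt_symm (I := 𝓘(ℝ, E)) (n := 1) x₀).comp h3
      fun p hp ↦ (h p.1 hp.1 _ hp.2.2).1
    refine h4.congr fun p hp ↦ ?_
    have := (h p.1 hp.1 _ hp.2.2).2.1
    rw [φ.left_inv hp.2.1] at this
    exact this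

/-- Local regularity holds only for short times. The group law propagates it: near t₁ the maps at
times t and t₁ differ by a short-time flow near the point reached at t₁. Hence the set of times at
which the flow is C¹ at x₀ is open and closed, and it contains 0. -/
theorem contMDiff_flow_const (hK : SmoothVFieldOn K univ) (t : ℝ) :
    ContMDiff 𝓘(ℝ, E) 𝓘(ℝ, E) 1 (flow hc t) := by
  intro x₀
  have key : ∀ t₁ : ℝ, ∀ᶠ t in 𝓝 t₁, (ContMDiffAt 𝓘(ℝ, E) 𝓘(ℝ, E) 1 (flow hc t) x₀ ↔
      ContMDiffAt 𝓘(ℝ, E) 𝓘(ℝ, E) 1 (flow hc t₁) x₀) := by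
    intro t₁
    obtain ⟨ε, hε, U, hU, hxU, hs⟩ := exists_contMDiffOn_flow hc hK (flow hc t₁ x₀)
    have hs' : ∀ s ∈ Ioo (-ε) ε, ∀ y ∈ U, ContMDiffAt 𝓘(ℝ, E) 𝓘(ℝ, E) 1 (flow hc s) y := by
      intro s hs1 y hy
      have h1 : ContMDiffAt (𝓘(ℝ, ℝ).prod 𝓘(ℝ, E)) 𝓘(ℝ, E) 1
          (fun p : ℝ × M ↦ flow hc p.1 p.2) (s, y) :=
        hs.contMDiffAt (prod_mem_nhds (Ioo_mem_nhds hs1.1 hs1.2) (hU.mem_nhds hy))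
      exact h1.comp y (contMDiffAt_const.prodMk contMDiffAt_id)
    have hcont : ContinuousAt (fun t ↦ flow hc t x₀) t₁ :=
      (isMIntegralCurve_flow hc x₀).continuous.continuousAt
    filter_upwards [Ioo_mem_nhds (show t₁ - ε < t₁ by linarith) (show t₁ < t₁ + ε by linarith),
      hcont.eventually (hU.mem_nhds hxU)] with t ht htU
    constructor
    · intro h
      have e : flow hc t₁ = flow hc (t₁ - t) ∘ flow hc t := by
        ext x; simp [← flow_add hc hK]
      rw [e]
      exact (hs' _ ⟨by linarith [ht.2], by linarith [ht.1]⟩ _ htU).comp x₀ h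
    · intro h
      have e : flow hc t = flow hc (t - t₁) ∘ flow hc t₁ := by
        ext x; simp [← flow_add hc hK]
      rw [e]
      exact (hs' _ ⟨by linarith [ht.1], by linarith [ht.2]⟩ _ hxU).comp x₀ h
  have hclopen : IsClopen {t : ℝ | ContMDiffAt 𝓘(ℝ, E) 𝓘(ℝ, E) 1 (flow hc t) x₀} := by
    constructor
    · rw [← isOpen_compl_iff, isOpen_iff_mem_nhds]
      intro t₁ ht₁
      filter_upwards [key t₁] with t ht h
      exact ht₁ (ht.1 h)
    · rw [isOpen_iff_mem_nhds]
      intro t₁ ht₁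
      filter_upwards [key t₁] with t ht using ht.2 ht₁
  have h0 : (0 : ℝ) ∈ {t : ℝ | ContMDiffAt 𝓘(ℝ, E) 𝓘(ℝ, E) 1 (flow hc t) x₀} := by
    have : flow hc 0 = id := funext fun x ↦ flow_zero hc x
    simp only [mem_ofPred_eq, this]
    exact contMDiffAt_id
  exact (hclopen.eq_univ ⟨0, h0⟩).ge (mem_univ t)

/-- The flow of a complete smooth vector field is `C¹` jointly in both variables. -/
theorem contMDiff_flow (hK : SmoothVFieldOn K univ) :
    ContMDiff (𝓘(ℝ, ℝ).prod 𝓘(ℝ, E)) 𝓘(ℝ, E) 1 (fun p : ℝ × M ↦ flow hc p.1 p.2) := by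
  intro ⟨t₀, x₀⟩
  -- Near (t₀, x₀) the flow is the short-time flow at time t - t₀ applied to the image under the
  -- fixed C¹ map at time t₀.
  obtain ⟨ε, hε, U, hU, hxU, hs⟩ := exists_contMDiffOn_flow hc hK (flow hc t₀ x₀)
  have h1 : ContMDiffAt (𝓘(ℝ, ℝ).prod 𝓘(ℝ, E)) 𝓘(ℝ, E) 1
      (fun p : ℝ × M ↦ flow hc p.1 p.2) (t₀ - t₀, flow hc t₀ x₀) :=
    hs.contMDiffAt (prod_mem_nhds (Ioo_mem_nhds (by simpa using hε) (by simpa using hε))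
      (hU.mem_nhds hxU))
  have h2 : ContMDiffAt (𝓘(ℝ, ℝ).prod 𝓘(ℝ, E)) (𝓘(ℝ, ℝ).prod 𝓘(ℝ, E)) 1
      (fun p : ℝ × M ↦ (p.1 - t₀, flow hc t₀ p.2)) (t₀, x₀) := by
    refine ContMDiffAt.prodMk ?_ ?_
    · exact ((contDiff_id.sub contDiff_const).contMDiff.comp contMDiff_fst).contMDiffAt
    · exact ((contMDiff_flow_const hc hK t₀).comp contMDiff_snd).contMDiffAt
  refine (h1.comp (t₀, x₀) h2).congr_of_eventuallyEq (Eventually.of_forall fun p ↦ ?_)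
  simp [← flow_add hc hK]

theorem mdifferentiableAt_flow (hK : SmoothVFieldOn K univ) (t : ℝ) (x : M) :
    MDifferentiableAt 𝓘(ℝ, E) 𝓘(ℝ, E) (flow hc t) x :=
  (contMDiff_flow_const hc hK t).mdifferentiable (by simp) x

theorem mfderiv_flow_add (hK : SmoothVFieldOn K univ) (s t : ℝ) (x : M)
    (v : TangentSpace 𝓘(ℝ, E) x) :
    mfderiv 𝓘(ℝ, E) 𝓘(ℝ, E) (flow hc (s + t)) x v =
      mfderiv 𝓘(ℝ, E) 𝓘(ℝ, E) (flow hc s) (flow hc t x)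
        (mfderiv 𝓘(ℝ, E) 𝓘(ℝ, E) (flow hc t) x v) := by
  have h : flow hc (s + t) = flow hc s ∘ flow hc t := funext fun x ↦ flow_add hc hK s t x
  rw [h, mfderiv_comp x (mdifferentiableAt_flow hc hK _ _) (mdifferentiableAt_flow hc hK _ _)]
  rfl

/-- The field is invariant under its flow. -/
theorem mfderiv_flow_field (hK : SmoothVFieldOn K univ) (t : ℝ) (x : M) :
    mfderiv 𝓘(ℝ, E) 𝓘(ℝ, E) (flow hc t) x (K x) = K (flow hc t x) := by
  have h1 : ∀ y z, flow hc 0 y = z → HasMFDerivAt 𝓘(ℝ, ℝ) 𝓘(ℝ, E) (fun s ↦ flow hc s y) 0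
      ((1 : ℝ →L[ℝ] ℝ).smulRight (K z : E)) := by
    rintro y _ rfl
    exact isMIntegralCurve_flow hc y 0
  have hd : ∀ y, y = x → HasMFDerivAt 𝓘(ℝ, E) 𝓘(ℝ, E) (flow hc t) y
      (mfderiv 𝓘(ℝ, E) 𝓘(ℝ, E) (flow hc t) x : E →L[ℝ] E) := by
    rintro _ rfl
    exact (mdifferentiableAt_flow hc hK t _).hasMFDerivAt
  have h2 := HasMFDerivAt.comp (f := fun s ↦ flow hc s x) (g := flow hc t) (0 : ℝ)
    (hd _ (flow_zero hc x)) (h1 x x (flow_zero hc x))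
  have h3 := h1 (flow hc t x) (flow hc t x) (flow_zero hc _)
  -- The flow maps at times s and t commute; the two sides are compared by differentiating at s = 0.
  have e : (flow hc t ∘ fun s ↦ flow hc s x) = fun s ↦ flow hc s (flow hc t x) := by
    ext s
    simp only [Function.comp_apply, ← flow_add hc hK, add_comm]
  have h4 := hasMFDerivAt_unique (h2.congr_of_eventuallyEq (Eventually.of_forall
    fun s ↦ (congrFun e s).symm)) h3
  have h5 := DFunLike.congr_fun (F := ℝ →L[ℝ] E) h4 (1 : ℝ)
  have h6 : (mfderiv 𝓘(ℝ, E) 𝓘(ℝ, E) (flow hc t) x : E →L[ℝ] E) ((1 : ℝ) • (K x : E)) =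
    (1 : ℝ) • (K (flow hc t x) : E) := h5
  rw [one_smul, one_smul] at h6
  exact h6

end SmoothFlow

/-! ### The flow of a Killing field preserves the metric -/

section Isometry

variable {E : Type*} [NormedAddCommGroup E] [NormedSpace ℝ E]
  {M : Type*} [TopologicalSpace M] [ChartedSpace E M] [IsManifold 𝓘(ℝ, E) ∞ M]
  (g : LorentzMetric E M)

/-- The metric applied to two smooth (local) lifts into the tangent bundle is smooth. -/
theorem LorentzMetric.contMDiffOn_inner {E' : Type*} [NormedAddCommGroup E'] [NormedSpace ℝ E']
    {H' : Type*} [TopologicalSpace H'] {I' : ModelWithCorners ℝ E' H'}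
    {N : Type*} [TopologicalSpace N] [ChartedSpace H' N] {s : Set N} {n : WithTop ℕ∞}
    (hn : n ≤ ((⊤ : ℕ∞) : WithTop ℕ∞))
    {b : N → M} {v w : ∀ x, TangentSpace 𝓘(ℝ, E) (b x)}
    (hv : ContMDiffOn I' 𝓘(ℝ, E).tangent n (fun x ↦ (⟨b x, v x⟩ : TangentBundle 𝓘(ℝ, E) M)) s)
    (hw : ContMDiffOn I' 𝓘(ℝ, E).tangent n (fun x ↦ (⟨b x, w x⟩ : TangentBundle 𝓘(ℝ, E) M)) s) :
    ContMDiffOn I' 𝓘(ℝ, ℝ) n (fun x ↦ g.inner (b x) (v x) (w x)) s := by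
  intro x hx
  have hv' := hv x hx
  have hb : ContMDiffWithinAt I' 𝓘(ℝ, E) n b s x := by
    rw [Bundle.contMDiffWithinAt_totalSpace] at hv'
    exact hv'.1
  have : ContMDiffWithinAt I' (𝓘(ℝ, E).prod 𝓘(ℝ)) n
      (fun m ↦ Bundle.TotalSpace.mk' ℝ (E := Bundle.Trivial M ℝ) (b m)
        (g.inner (b m) (v m) (w m))) s x := by
    apply ContMDiffWithinAt.clm_bundle_apply₂ (F₁ := E) (F₂ := E)
    · exact ((g.contMDiff.of_le hn).contMDiffAt (x := b x)).comp_contMDiffWithinAt x hb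
    · exact hv'
    · exact hw x hx
  simp only [Bundle.contMDiffWithinAt_totalSpace] at this
  exact this.2

/-- The metric at a point, as a bilinear form on the model space. -/
def modelInner (x : M) : E →L[ℝ] E →L[ℝ] ℝ := g.inner x

/-- The derivative of the inverse of the preferred chart at `x₀`. -/
def chartInv (x₀ : M) (u : E) : E →L[ℝ] E :=
  mfderiv 𝓘(ℝ, E) 𝓘(ℝ, E) (extChartAt 𝓘(ℝ, E) x₀).symm u

/-- The metric in the preferred chart at `x₀`. -/
def chartMetric (x₀ : M) (u : E) : E →L[ℝ] E →L[ℝ] ℝ :=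
  (modelInner g ((extChartAt 𝓘(ℝ, E) x₀).symm u)).bilinearComp (chartInv x₀ u) (chartInv x₀ u)

/-- The constant vector field on the model space. -/
def modelField (a : E) : VField E E := fun _ ↦ a

/-- The vector field with constant coefficients in the preferred chart at `x₀`. -/
def constField (x₀ : M) (a : E) : VField E M :=
  VectorField.mpullback 𝓘(ℝ, E) 𝓘(ℝ, E) (extChartAt 𝓘(ℝ, E) x₀) (modelField a)

theorem constField_eq {x₀ y : M} (hy : y ∈ (extChartAt 𝓘(ℝ, E) x₀).source) (a : E) :
    constField x₀ a y = chartInv x₀ (extChartAt 𝓘(ℝ, E) x₀ y) a := by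
  have h := mfderivWithin_extChartAt_symm_comp_mfderiv_extChartAt' (I := 𝓘(ℝ, E)) hy
  have h' := mfderiv_extChartAt_comp_mfderivWithin_extChartAt_symm' (I := 𝓘(ℝ, E)) hy
  simp only [modelWithCornersSelf_coe, range_id, mfderivWithin_univ] at h h'
  rw [constField, VectorField.mpullback_apply, ContinuousLinearMap.inverse_eq h' h]
  rfl

theorem chartMetric_apply {x₀ : M} (u a b : E) :
    chartMetric g x₀ u a b = modelInner g ((extChartAt 𝓘(ℝ, E) x₀).symm u)
      (chartInv x₀ u a) (chartInv x₀ u b) := rfl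

theorem chartMetric_extChartAt {x₀ y : M} (hy : y ∈ (extChartAt 𝓘(ℝ, E) x₀).source) (a b : E) :
    chartMetric g x₀ (extChartAt 𝓘(ℝ, E) x₀ y) a b =
      g.inner y (constField x₀ a y) (constField x₀ b y) := by
  rw [constField_eq hy, constField_eq hy, chartMetric_apply, (extChartAt 𝓘(ℝ, E) x₀).left_inv hy]
  rfl

variable [CompleteSpace E]

theorem smoothVFieldOn_constField (x₀ : M) (a : E) :
    SmoothVFieldOn (constField x₀ a) (extChartAt 𝓘(ℝ, E) x₀).source := by
  intro y hy
  refine ContMDiffAt.contMDiffWithinAt ?_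
  have h1 : ContMDiffAt 𝓘(ℝ, E) 𝓘(ℝ, E).tangent ∞
      (fun x ↦ (⟨x, modelField a x⟩ : TangentBundle 𝓘(ℝ, E) E)) (extChartAt 𝓘(ℝ, E) x₀ y) :=
    contMDiffAt_vectorSpace_iff_contDiffAt.2 (contDiffAt_const (c := a))
  refine h1.mpullback_vectorField_preimage (n := ∞) ?_ (isInvertible_mfderiv_extChartAt hy)
    (by simp)
  rw [extChartAt_source] at hy
  exact contMDiffAt_extChartAt' hy

variable [FiniteDimensional ℝ E]

theorem contDiffOn_chartMetric (x₀ : M) :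
    ContDiffOn ℝ ∞ (chartMetric g x₀) (extChartAt 𝓘(ℝ, E) x₀).target := by
  rw [contDiffOn_clm_apply]
  intro a
  rw [contDiffOn_clm_apply]
  intro b
  rw [← contMDiffOn_iff_contDiffOn]
  have h := (g.contMDiffOn_inner le_rfl (smoothVFieldOn_constField x₀ a)
    (smoothVFieldOn_constField x₀ b)).comp (contMDiffOn_extChartAt_symm x₀)
    (fun u hu ↦ (extChartAt 𝓘(ℝ, E) x₀).map_target hu)
  refine h.congr fun u hu ↦ ?_
  have := chartMetric_extChartAt g ((extChartAt 𝓘(ℝ, E) x₀).map_target hu) a b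
  rw [(extChartAt 𝓘(ℝ, E) x₀).right_inv hu] at this
  exact this

variable {K : VField E M}

omit [FiniteDimensional ℝ E] in
-- The bracket commutes with pullback, so it may be computed in the chart, where the second field is
-- constant and only the term -DK(a) survives.
theorem mlieBracket_constField (hK : SmoothVFieldOn K univ) (x₀ : M) (a : E) :
    VectorField.mlieBracket 𝓘(ℝ, E) K (constField x₀ a) x₀ =
      constField x₀ (-(fderiv ℝ (chartField K x₀) (extChartAt 𝓘(ℝ, E) x₀ x₀) a)) x₀ := by
  have : IsManifold 𝓘(ℝ, E) (minSmoothness ℝ 2) M := by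
    rw [minSmoothness_of_isRCLikeNormedField]; exact isManifold_two
  have h0 : K =ᶠ[𝓝 x₀] VectorField.mpullback 𝓘(ℝ, E) 𝓘(ℝ, E) (extChartAt 𝓘(ℝ, E) x₀)
      (chartField K x₀) := by
    have := VectorField.eventuallyEq_mpullback_mpullbackWithin_extChartAt (I := 𝓘(ℝ, E))
      (s := univ) (x := x₀) K
    simpa [chartField, nhdsWithin_univ] using this
  have e0 := h0.mlieBracket_vectorField_eq (EventuallyEq.refl (𝓝 x₀) (constField x₀ a))
  refine e0.trans ?_
  have hf := contDiffAt_chartField hK x₀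
  have h1 := VectorField.mpullback_mlieBracket (I := 𝓘(ℝ, E)) (I' := 𝓘(ℝ, E)) (n := ∞)
    (f := extChartAt 𝓘(ℝ, E) x₀)
    (V := chartField K x₀) (W := modelField a) (x₀ := x₀)
    ((contMDiffAt_vectorSpace_iff_contDiffAt.2 hf).mdifferentiableAt (by simp))
    ((contMDiffAt_vectorSpace_iff_contDiffAt.2
      (contDiffAt_const (c := a) (n := ∞))).mdifferentiableAt (by simp))
    contMDiffAt_extChartAt (by simpa using two_le_infty)
  refine h1.symm.trans ?_
  rw [constField, VectorField.mpullback_apply, VectorField.mpullback_apply]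
  congr 1
  have e1 : fderiv ℝ (modelField a : E → E) (extChartAt 𝓘(ℝ, E) x₀ x₀) = 0 :=
    fderiv_const_apply (𝕜 := ℝ) a
  have e2 : ∀ (V W : VField E E) (u : E), VectorField.mlieBracket 𝓘(ℝ, E) V W u =
      VectorField.lieBracket ℝ V W u := by
    intro V W u
    rw [← VectorField.mlieBracketWithin_univ, VectorField.mlieBracketWithin_eq_lieBracketWithin]
    exact congrFun (VectorField.lieBracketWithin_univ (𝕜 := ℝ) (V := (V : E → E)) (W := W)) u
  refine (e2 (chartField K x₀) (modelField a) _).trans ?_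
  change (fderiv ℝ (modelField a : E → E) (extChartAt 𝓘(ℝ, E) x₀ x₀) : E →L[ℝ] E) _ - _ = _
  rw [e1]
  exact zero_sub _

/-- This is the Killing equation in coordinates, obtained by inserting the coordinate fields into
the vanishing Lie derivative. Only the centre of the chart is needed, since every point is the
centre of its own chart. -/
theorem fderiv_chartMetric_killing (hK : IsKilling g K) (x₀ : M) (a b : E) :
    fderiv ℝ (chartMetric g x₀) (extChartAt 𝓘(ℝ, E) x₀ x₀)
        (chartField K x₀ (extChartAt 𝓘(ℝ, E) x₀ x₀)) a b +
      chartMetric g x₀ (extChartAt 𝓘(ℝ, E) x₀ x₀)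
        (fderiv ℝ (chartField K x₀) (extChartAt 𝓘(ℝ, E) x₀ x₀) a) b +
      chartMetric g x₀ (extChartAt 𝓘(ℝ, E) x₀ x₀) a
        (fderiv ℝ (chartField K x₀) (extChartAt 𝓘(ℝ, E) x₀ x₀) b) = 0 := by
  set φ := extChartAt 𝓘(ℝ, E) x₀
  have hx₀ : x₀ ∈ φ.source := mem_extChartAt_source x₀
  have h := hK.2 φ.source (constField x₀ a) (constField x₀ b) (isOpen_extChartAt_source x₀)
    (smoothVFieldOn_constField x₀ a) (smoothVFieldOn_constField x₀ b) x₀ hx₀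
  rw [mlieBracket_constField hK.1, mlieBracket_constField hK.1, ← chartMetric_extChartAt g hx₀,
    ← chartMetric_extChartAt g hx₀] at h
  have hd : DifferentiableAt ℝ (chartMetric g x₀) (φ x₀) :=
    ((contDiffOn_chartMetric g x₀).contDiffAt (extChartAt_target_mem_nhds x₀)).differentiableAt
      (by simp)
  have hd' : HasFDerivAt (fun u ↦ chartMetric g x₀ u a b)
      (((fderiv ℝ (chartMetric g x₀) (φ x₀)).flip a).flip b) (φ x₀) := by
    have := (hd.hasFDerivAt.clm_apply (hasFDerivAt_const a _)).clm_apply (hasFDerivAt_const b _)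
    exact this.congr_fderiv (by ext; simp)
  have hφ : MDifferentiableAt 𝓘(ℝ, E) 𝓘(ℝ, E) φ x₀ :=
    mdifferentiableAt_extChartAt (mem_chart_source E x₀)
  have hdir : dirDeriv (fun y ↦ g.inner y (constField x₀ a y) (constField x₀ b y)) x₀ (K x₀) =
      fderiv ℝ (chartMetric g x₀) (φ x₀) (chartField K x₀ (φ x₀)) a b := by
    have e : (fun y ↦ g.inner y (constField x₀ a y) (constField x₀ b y)) =ᶠ[𝓝 x₀]
        (fun u ↦ chartMetric g x₀ u a b) ∘ φ := by
      filter_upwards [extChartAt_source_mem_nhds (I := 𝓘(ℝ, E)) x₀] with y hy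
      exact (chartMetric_extChartAt g hy a b).symm
    have h1 := (HasMFDerivAt.comp x₀ hd'.hasMFDerivAt hφ.hasMFDerivAt).congr_of_eventuallyEq e
    rw [dirDeriv, h1.mfderiv]
    have h2 : mfderiv 𝓘(ℝ, E) 𝓘(ℝ, E) φ x₀ (K x₀) = chartField K x₀ (φ x₀) := by
      have h3 : chartField K x₀ (φ x₀) =
        (mfderiv 𝓘(ℝ, E) 𝓘(ℝ, E) φ.symm (φ x₀)).inverse (K (φ.symm (φ x₀))) := rfl
      have g1 := mfderivWithin_extChartAt_symm_comp_mfderiv_extChartAt' (I := 𝓘(ℝ, E)) hx₀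
      have g2 := mfderiv_extChartAt_comp_mfderivWithin_extChartAt_symm' (I := 𝓘(ℝ, E)) hx₀
      simp only [modelWithCornersSelf_coe, range_id, mfderivWithin_univ] at g1 g2
      have g3 : ∀ y, y = x₀ → (mfderiv 𝓘(ℝ, E) 𝓘(ℝ, E) φ x₀ : E →L[ℝ] E) (K y) =
          mfderiv 𝓘(ℝ, E) 𝓘(ℝ, E) φ x₀ (K x₀) := by rintro _ rfl; rfl
      refine ((h3.trans ?_).trans (g3 _ (φ.left_inv hx₀))).symm
      exact congrArg (fun A : E →L[ℝ] E ↦ A (K (φ.symm (φ x₀)) : E))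
        (ContinuousLinearMap.inverse_eq (f := (mfderiv 𝓘(ℝ, E) 𝓘(ℝ, E) φ.symm (φ x₀) : E →L[ℝ] E))
          (g := (mfderiv 𝓘(ℝ, E) 𝓘(ℝ, E) φ x₀ : E →L[ℝ] E)) g1 g2)
    change fderiv ℝ (chartMetric g x₀) (φ x₀) (mfderiv 𝓘(ℝ, E) 𝓘(ℝ, E) φ x₀ (K x₀)) a b = _
    rw [h2]
  rw [hdir] at h
  simp only [map_neg, neg_apply] at h
  linarith

variable [T2Space M] (hc : IsCompleteField K)

/-- In the chart at x the moved vector solves the variational equation. The product rule at time 0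
then yields exactly the left side of the coordinate Killing equation. -/
theorem hasDerivAt_inner_flow_zero (hK : IsKilling g K) (x : M) (v : TangentSpace 𝓘(ℝ, E) x) :
    HasDerivAt (fun t ↦ g.inner (flow hc t x) (mfderiv 𝓘(ℝ, E) 𝓘(ℝ, E) (flow hc t) x v)
      (mfderiv 𝓘(ℝ, E) 𝓘(ℝ, E) (flow hc t) x v)) 0 0 := by
  obtain ⟨Φ, W, ε, V, hε, hV, hx₀, hVt, h0, h, hΦ⟩ := exists_flow_eq_extChartAt_symm hc hK.1 x
  set φ := extChartAt 𝓘(ℝ, E) x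
  set a : E := mfderiv 𝓘(ℝ, E) 𝓘(ℝ, E) φ x v
  have hx : x ∈ φ.source := mem_extChartAt_source x
  have hφ : MDifferentiableAt 𝓘(ℝ, E) 𝓘(ℝ, E) φ x :=
    mdifferentiableAt_extChartAt (mem_chart_source E x)
  have h00 : (0 : ℝ) ∈ Ioo (-ε) ε := ⟨by linarith, hε⟩
  have e : (fun t ↦ g.inner (flow hc t x) (mfderiv 𝓘(ℝ, E) 𝓘(ℝ, E) (flow hc t) x v)
      (mfderiv 𝓘(ℝ, E) 𝓘(ℝ, E) (flow hc t) x v)) =ᶠ[𝓝 0]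
      fun t ↦ chartMetric g x (Φ t (φ x)) (W t (φ x) a) (W t (φ x) a) := by
    filter_upwards [Ioo_mem_nhds h00.1 h00.2] with t ht
    obtain ⟨h1, h2, -, h4, -⟩ := h t ht _ hx₀
    rw [φ.left_inv hx] at h2
    have e1 : flow hc t =ᶠ[𝓝 x] φ.symm ∘ (Φ t ∘ φ) := by
      filter_upwards [extChartAt_source_mem_nhds (I := 𝓘(ℝ, E)) x,
        (continuousAt_extChartAt (I := 𝓘(ℝ, E)) x).eventually (hV.mem_nhds hx₀)] with y hy hyV
      have := (h t ht _ hyV).2.1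
      rwa [φ.left_inv hy] at this
    have h5 := HasMFDerivAt.comp x h4.hasMFDerivAt hφ.hasMFDerivAt
    have h6 := HasMFDerivAt.comp x (mdifferentiableAt_extChartAt_symm (x₀ := x) h1).hasMFDerivAt h5
    have h7 : mfderiv 𝓘(ℝ, E) 𝓘(ℝ, E) (flow hc t) x v =
        mfderiv 𝓘(ℝ, E) 𝓘(ℝ, E) φ.symm (Φ t (φ x)) (W t (φ x) a) := by
      rw [(h6.congr_of_eventuallyEq e1).mfderiv]
      rfl
    rw [h7, h2]
    rfl
  have hd : DifferentiableAt ℝ (chartMetric g x) (φ x) :=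
    ((contDiffOn_chartMetric g x).contDiffAt (extChartAt_target_mem_nhds x)).differentiableAt
      (by simp)
  obtain ⟨-, -, h3, -, h5⟩ := h 0 h00 _ hx₀
  rw [(h0 _ hx₀).1] at h3 h5
  rw [(h0 _ hx₀).2] at h5
  have hg : HasDerivAt (fun t ↦ chartMetric g x (Φ t (φ x)))
      (fderiv ℝ (chartMetric g x) (φ x) (chartField K x (φ x))) 0 := by
    have hd' : HasFDerivAt (chartMetric g x) (fderiv ℝ (chartMetric g x) (φ x)) (Φ 0 (φ x)) := by
      rw [(h0 _ hx₀).1]; exact hd.hasFDerivAt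
    exact HasFDerivAt.comp_hasDerivAt (l := chartMetric g x) (f := fun t ↦ Φ t (φ x)) 0 hd' h3
  have hw := h5.clm_apply (hasDerivAt_const (0 : ℝ) a)
  have key := (hg.clm_apply hw).clm_apply hw
  refine (key.congr_of_eventuallyEq e).congr_deriv ?_
  have := fderiv_chartMetric_killing g hK x a a
  simp only [(h0 _ hx₀).1, (h0 _ hx₀).2, map_zero, add_zero, ContinuousLinearMap.comp_id,
    add_apply, ContinuousLinearMap.coe_id', id_eq]
  linarith

/-- The group law reduces the derivative at any time s to the derivative at time 0 at the point
reached at time s. -/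
theorem inner_flow_self (hK : IsKilling g K) (t : ℝ) (x : M) (v : TangentSpace 𝓘(ℝ, E) x) :
    g.inner (flow hc t x) (mfderiv 𝓘(ℝ, E) 𝓘(ℝ, E) (flow hc t) x v)
      (mfderiv 𝓘(ℝ, E) 𝓘(ℝ, E) (flow hc t) x v) = g.inner x v v := by
  set h : ℝ → ℝ := fun t ↦ g.inner (flow hc t x) (mfderiv 𝓘(ℝ, E) 𝓘(ℝ, E) (flow hc t) x v)
      (mfderiv 𝓘(ℝ, E) 𝓘(ℝ, E) (flow hc t) x v) with hh
  have hd : ∀ s, HasDerivAt h 0 s := by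
    intro s
    have h1 := hasDerivAt_inner_flow_zero g hc hK (flow hc s x)
      (mfderiv 𝓘(ℝ, E) 𝓘(ℝ, E) (flow hc s) x v)
    have h2 : HasDerivAt (fun t ↦ h (t + s)) 0 0 := by
      refine h1.congr_of_eventuallyEq (Eventually.of_forall fun t ↦ ?_)
      simp only [hh]
      rw [mfderiv_flow_add hc hK.1, flow_add hc hK.1]
    have h3 : HasDerivAt (fun t ↦ t - s) 1 s := (hasDerivAt_id s).sub_const s
    have h2' : HasDerivAt (fun t ↦ h (t + s)) 0 (s - s) := by rwa [sub_self]
    have h4 := HasDerivAt.comp (h₂ := fun t ↦ h (t + s)) (h := fun t ↦ t - s) s h2' h3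
    simpa [Function.comp_def] using h4
  have hconst := is_const_of_deriv_eq_zero (fun s ↦ (hd s).differentiableAt)
    (fun s ↦ (hd s).deriv) t 0
  have e0 : ∀ f : M → M, f = id → g.inner (f x) (mfderiv 𝓘(ℝ, E) 𝓘(ℝ, E) f x v)
      (mfderiv 𝓘(ℝ, E) 𝓘(ℝ, E) f x v) = g.inner x v v := by
    rintro _ rfl
    rw [mfderiv_id]
    rfl
  exact hconst.trans (e0 _ (funext fun y ↦ flow_zero hc y))

/-- The flow of a Killing field consists of isometries. -/
theorem inner_flow (hK : IsKilling g K) (t : ℝ) (x : M) (v w : TangentSpace 𝓘(ℝ, E) x) :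
    g.inner (flow hc t x) (mfderiv 𝓘(ℝ, E) 𝓘(ℝ, E) (flow hc t) x v)
      (mfderiv 𝓘(ℝ, E) 𝓘(ℝ, E) (flow hc t) x w) = g.inner x v w := by
  -- Polarization.
  have h1 := inner_flow_self g hc hK t x (v + w)
  have h2 := inner_flow_self g hc hK t x v
  have h3 := inner_flow_self g hc hK t x w
  have h4 := g.symm x v w
  have h5 := g.symm _ (mfderiv 𝓘(ℝ, E) 𝓘(ℝ, E) (flow hc t) x v)
    (mfderiv 𝓘(ℝ, E) 𝓘(ℝ, E) (flow hc t) x w)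
  simp only [map_add, add_apply] at h1
  linarith

end Isometry

/-! ### Velocities of curves and chain rules -/

section Velocity

variable {E : Type*} [NormedAddCommGroup E] [NormedSpace ℝ E]
  {M : Type*} [TopologicalSpace M] [ChartedSpace E M]

/-- The curve `γ` has velocity `v` at `s`, within the set `A` of parameters. -/
def HasVelocityWithinAt (γ : ℝ → M) (v : E) (A : Set ℝ) (s : ℝ) : Prop :=
  HasMFDerivWithinAt 𝓘(ℝ, ℝ) 𝓘(ℝ, E) γ A s
    (ContinuousLinearMap.toSpanSingleton ℝ v : ℝ →L[ℝ] E)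

/-- The derivative of a map at a point, as a linear map between the model spaces. -/
def modelDeriv (f : M → M) (x : M) : E →L[ℝ] E := mfderiv 𝓘(ℝ, E) 𝓘(ℝ, E) f x

/-- The derivative of a real function at a point, as a linear form on the model space. -/
def modelDiff (φ : M → ℝ) (x : M) : E →L[ℝ] ℝ := mfderiv 𝓘(ℝ, E) 𝓘(ℝ, ℝ) φ x

/-- The velocity of a curve within a set of parameters, as a vector of the model space. -/
def velocityWithin (γ : ℝ → M) (A : Set ℝ) (s : ℝ) : E :=
  mfderivWithin 𝓘(ℝ, ℝ) 𝓘(ℝ, E) γ A s (1 : ℝ)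

/-- The value of a vector field, as a vector of the model space. -/
def modelVec (K : VField E M) (x : M) : E := K x

variable {γ : ℝ → M} {v w : E} {A B : Set ℝ} {s : ℝ}

theorem HasVelocityWithinAt.unique (h : HasVelocityWithinAt γ v A s)
    (h' : HasVelocityWithinAt γ w A s) (hA : UniqueDiffWithinAt ℝ A s) : v = w := by
  have h1 := UniqueMDiffWithinAt.eq (uniqueMDiffWithinAt_iff_uniqueDiffWithinAt.2 hA) h h'
  have h2 := DFunLike.congr_fun (F := ℝ →L[ℝ] E) h1 (1 : ℝ)
  have h3 : (1 : ℝ) • v = (1 : ℝ) • w := h2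
  simpa using h3

theorem hasVelocityWithinAt_velocityWithin
    (h : MDifferentiableWithinAt 𝓘(ℝ, ℝ) 𝓘(ℝ, E) γ A s) :
    HasVelocityWithinAt γ (velocityWithin γ A s : E) A s := by
  have h1 := h.hasMFDerivWithinAt
  have e : (mfderivWithin 𝓘(ℝ, ℝ) 𝓘(ℝ, E) γ A s : ℝ →L[ℝ] E) =
      ContinuousLinearMap.toSpanSingleton ℝ (velocityWithin γ A s : E) := by
    refine ContinuousLinearMap.ext_ring ?_
    exact (one_smul ℝ (velocityWithin γ A s : E)).symm
  exact h1.congr_mfderiv e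

theorem HasVelocityWithinAt.velocityWithin_eq (h : HasVelocityWithinAt γ v A s)
    (hA : UniqueDiffWithinAt ℝ A s) : velocityWithin γ A s = v :=
  (hasVelocityWithinAt_velocityWithin h.mdifferentiableWithinAt).unique h hA

theorem HasVelocityWithinAt.mono (h : HasVelocityWithinAt γ v B s) (hAB : A ⊆ B) :
    HasVelocityWithinAt γ v A s :=
  HasMFDerivWithinAt.mono h hAB

theorem HasVelocityWithinAt.congr_of_eventuallyEq {γ' : ℝ → M} (h : HasVelocityWithinAt γ v A s)
    (he : γ' =ᶠ[𝓝[A] s] γ) (hs : γ' s = γ s) : HasVelocityWithinAt γ' v A s :=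
  HasMFDerivWithinAt.congr_of_eventuallyEq h he hs

theorem hasVelocityWithinAt_const (x : M) : HasVelocityWithinAt (fun _ ↦ x) (0 : E) A s := by
  have h := (hasMFDerivAt_const (I := 𝓘(ℝ, ℝ)) (I' := 𝓘(ℝ, E)) x s).hasMFDerivWithinAt (s := A)
  have e : (0 : ℝ →L[ℝ] E) = ContinuousLinearMap.toSpanSingleton ℝ (0 : E) := by ext; simp
  exact h.congr_mfderiv e

/-- Reparametrization of a curve. -/
theorem HasVelocityWithinAt.scomp {θ : ℝ → ℝ} {θ' : ℝ} (h : HasVelocityWithinAt γ v B (θ s))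
    (hθ : HasDerivWithinAt θ θ' A s) (hAB : MapsTo θ A B) :
    HasVelocityWithinAt (γ ∘ θ) (θ' • v) A s := by
  have h1 := HasMFDerivWithinAt.comp s h hθ.hasFDerivWithinAt.hasMFDerivWithinAt hAB
  have e : (ContinuousLinearMap.toSpanSingleton ℝ v : ℝ →L[ℝ] E).comp
      (ContinuousLinearMap.toSpanSingleton ℝ θ') =
      (ContinuousLinearMap.toSpanSingleton ℝ (θ' • v) : ℝ →L[ℝ] E) := by
    ext; simp
  exact h1.congr_mfderiv e

/-- The image of a curve under a map. -/
theorem HasVelocityWithinAt.map {f : M → M} (h : HasVelocityWithinAt γ v A s)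
    (hf : MDifferentiableAt 𝓘(ℝ, E) 𝓘(ℝ, E) f (γ s)) :
    HasVelocityWithinAt (f ∘ γ) (modelDeriv f (γ s) v) A s := by
  have h1 := hf.hasMFDerivAt.comp_hasMFDerivWithinAt s h
  have e : (modelDeriv f (γ s) : E →L[ℝ] E).comp (ContinuousLinearMap.toSpanSingleton ℝ v) =
      ContinuousLinearMap.toSpanSingleton ℝ (modelDeriv f (γ s) v) := by
    ext; simp
  exact h1.congr_mfderiv e

/-- A real function along a curve. -/
theorem HasVelocityWithinAt.hasDerivWithinAt {φ : M → ℝ} (h : HasVelocityWithinAt γ v A s)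
    (hf : MDifferentiableAt 𝓘(ℝ, E) 𝓘(ℝ, ℝ) φ (γ s)) :
    HasDerivWithinAt (φ ∘ γ) (modelDiff φ (γ s) v) A s := by
  have h1 := hf.hasMFDerivAt.comp_hasMFDerivWithinAt s h
  have e : (modelDiff φ (γ s) : E →L[ℝ] ℝ).comp (ContinuousLinearMap.toSpanSingleton ℝ v) =
      ContinuousLinearMap.toSpanSingleton ℝ (modelDiff φ (γ s) v) := by
    ext; simp
  have h2 := hasMFDerivWithinAt_iff_hasFDerivWithinAt.1 (h1.congr_mfderiv e)
  have h3 : HasFDerivWithinAt (φ ∘ γ) (ContinuousLinearMap.toSpanSingleton ℝ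
    (modelDiff φ (γ s) v) : ℝ →L[ℝ] ℝ) A s := h2
  exact h3

variable [IsManifold 𝓘(ℝ, E) ∞ M] [T2Space M] [CompleteSpace E] {K : VField E M}
  (hc : IsCompleteField K)

/-- The velocity of a curve moved by the flow. -/
theorem HasVelocityWithinAt.flow (hK : SmoothVFieldOn K univ) {τ : ℝ → ℝ} {τ' : ℝ}
    (h : HasVelocityWithinAt γ v A s) (hτ : HasDerivWithinAt τ τ' A s) :
    HasVelocityWithinAt (fun s ↦ flow hc (τ s) (γ s))
      (modelDeriv (StationarySpacetime.flow hc (τ s)) (γ s) (v + τ' • modelVec K (γ s))) A s := by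
  have h1 := HasMFDerivWithinAt.prodMk (hτ.hasFDerivWithinAt.hasMFDerivWithinAt) h
  have hd : MDifferentiableAt (𝓘(ℝ, ℝ).prod 𝓘(ℝ, E)) 𝓘(ℝ, E)
      (fun p : ℝ × M ↦ StationarySpacetime.flow hc p.1 p.2) (τ s, γ s) :=
    (contMDiff_flow hc hK).mdifferentiable (by simp) _
  have h2 := hd.hasMFDerivAt.comp_hasMFDerivWithinAt s h1
  refine h2.congr_mfderiv ?_
  refine ContinuousLinearMap.ext_ring (M₁ := E) ?_
  have h3 := mfderiv_prod_eq_add_comp hd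
  have h4 : (mfderiv 𝓘(ℝ, ℝ) 𝓘(ℝ, E) (fun t ↦ StationarySpacetime.flow hc t (γ s)) (τ s)
      : ℝ →L[ℝ] E) = (1 : ℝ →L[ℝ] ℝ).smulRight
        (modelVec K (StationarySpacetime.flow hc (τ s) (γ s))) :=
    HasMFDerivAt.mfderiv (isMIntegralCurve_flow hc (γ s) (τ s))
  have h5 := DFunLike.congr_fun (F := (ℝ × E) →L[ℝ] E) h3 (τ', v)
  have h6 := mfderiv_flow_field hc hK (τ s) (γ s)
  have h7 : (mfderiv (𝓘(ℝ, ℝ).prod 𝓘(ℝ, E)) 𝓘(ℝ, E)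
      (fun p : ℝ × M ↦ StationarySpacetime.flow hc p.1 p.2) (τ s, γ s) : (ℝ × E) →L[ℝ] E)
        (τ', v) = ((1 : ℝ →L[ℝ] ℝ).smulRight
          (modelVec K (StationarySpacetime.flow hc (τ s) (γ s)))) τ' +
            modelDeriv (StationarySpacetime.flow hc (τ s)) (γ s) v :=
    h5.trans (congrArg (fun y : E ↦ y + modelDeriv (StationarySpacetime.flow hc (τ s)) (γ s) v)
      (DFunLike.congr_fun (F := ℝ →L[ℝ] E) h4 τ'))
  have h8 : modelDeriv (StationarySpacetime.flow hc (τ s)) (γ s) (modelVec K (γ s)) =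
    modelVec K (StationarySpacetime.flow hc (τ s) (γ s)) := h6
  have h9 : ((1 : ℝ →L[ℝ] ℝ).smulRight (modelVec K (StationarySpacetime.flow hc (τ s) (γ s)))) τ' +
      modelDeriv (StationarySpacetime.flow hc (τ s)) (γ s) v =
      (1 : ℝ) • modelDeriv (StationarySpacetime.flow hc (τ s)) (γ s) (v + τ' • modelVec K (γ s)) := by
    rw [map_add, map_smul, h8, one_smul, add_comm]
    rfl
  refine Eq.trans ?_ h9
  refine Eq.trans ?_ h7
  change (mfderiv (𝓘(ℝ, ℝ).prod 𝓘(ℝ, E)) 𝓘(ℝ, E)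
      (fun p : ℝ × M ↦ StationarySpacetime.flow hc p.1 p.2) (τ s, γ s) : (ℝ × E) →L[ℝ] E)
        ((1 : ℝ) • τ', (1 : ℝ) • v) = _
  rw [one_smul, one_smul]

end Velocity

set_option linter.unusedSectionVars false

/-! ### Time function and projection onto the Cauchy hypersurface -/

section TimeFunction

variable {E : Type*} [NormedAddCommGroup E] [NormedSpace ℝ E]
  {M : Type*} [TopologicalSpace M] [ChartedSpace E M] [IsManifold 𝓘(ℝ, E) ∞ M]

/-- A spacetime with a complete timelike Killing field `K` and a spacelike Cauchy hypersurface
`S`. -/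
structure IsStationary (g : LorentzMetric E M) (K : VField E M) (S : Set M) : Prop where
  timelike : IsTimelikeField g K
  killing : IsKilling g K
  complete : IsCompleteField K
  spacelike : IsSpacelikeHypersurface g S
  cauchy : IsCauchyHypersurface g S

variable [T2Space M] [FiniteDimensional ℝ E] [CompleteSpace E]
  {g : LorentzMetric E M} {K : VField E M} {S : Set M} (h : IsStationary g K S)

include h

theorem IsStationary.smooth : SmoothVFieldOn K univ := h.killing.1

theorem IsStationary.modelInner_flow (t : ℝ) (x : M) (v w : E) :
    modelInner g (flow h.complete t x) (modelDeriv (flow h.complete t) x v)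
      (modelDeriv (flow h.complete t) x w) = modelInner g x v w :=
  inner_flow g h.complete h.killing t x v w

theorem IsStationary.modelDeriv_flow_modelVec (t : ℝ) (x : M) :
    modelDeriv (flow h.complete t) x (modelVec K x) = modelVec K (flow h.complete t x) :=
  mfderiv_flow_field h.complete h.smooth t x

theorem IsStationary.modelInner_modelVec_neg (x : M) :
    modelInner g x (modelVec K x) (modelVec K x) < 0 := h.timelike x

theorem IsStationary.modelVec_ne_zero (x : M) : (modelVec K x : E) ≠ 0 := by
  intro h0
  have := h.modelInner_modelVec_neg x
  simp [h0] at this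

theorem IsStationary.modelDeriv_flow_injective (t : ℝ) (x : M) :
    Function.Injective (modelDeriv (flow h.complete t) x : E →L[ℝ] E) := by
  rw [injective_iff_map_eq_zero]
  intro v hv
  have h1 : ∀ f : M → M, f = id → modelDeriv f x v = v := by
    rintro _ rfl
    exact DFunLike.congr_fun (F := E →L[ℝ] E) (mfderiv_id (I := 𝓘(ℝ, E)) (x := x)) v
  have h2 : modelDeriv (flow h.complete (-t + t)) x v =
      modelDeriv (flow h.complete (-t)) (flow h.complete t x)
        (modelDeriv (flow h.complete t) x v) := mfderiv_flow_add h.complete h.smooth (-t) t x v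
  rw [hv, map_zero, h1] at h2
  · exact h2
  · funext y; rw [neg_add_cancel, flow_zero]; rfl

theorem IsStationary.hasVelocityWithinAt_flow (x : M) (A : Set ℝ) (s : ℝ) :
    HasVelocityWithinAt (fun t ↦ flow h.complete t x) (modelVec K (flow h.complete s x) : E) A s := by
  have h1 := (isMIntegralCurve_flow h.complete x s).hasMFDerivWithinAt (s := A)
  refine h1.congr_mfderiv ?_
  refine ContinuousLinearMap.ext_ring (M₁ := E) ?_
  rfl

theorem IsStationary.continuous_flow :
    Continuous (fun p : ℝ × M ↦ flow h.complete p.1 p.2) :=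
  (contMDiff_flow h.complete h.smooth).continuous

/-- An orbit of the Killing field has no limit point at either end. -/
theorem IsStationary.not_tendsto_flow {l : Filter ℝ} [l.NeBot]
    (hl : ∀ s : ℝ, Tendsto (fun t ↦ s + t) l l) (x y : M) :
    ¬ Tendsto (fun t ↦ flow h.complete t x) l (𝓝 y) := by
  intro hy
  -- A limit at an end of an orbit is fixed by the flow, so `K` vanishes there, which a timelike
  -- field does not.
  have hfix : ∀ s, flow h.complete s y = y := by
    intro s
    have hcont : Continuous (flow h.complete s) := (contMDiff_flow_const h.complete h.smooth s).continuous
    have h1 := (hcont.tendsto y).comp hy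
    have h2 := hy.comp (hl s)
    refine tendsto_nhds_unique h1 (h2.congr fun t ↦ ?_)
    simp [flow_add h.complete h.smooth]
  have h1 := h.hasVelocityWithinAt_flow y univ 0
  have h2 : (fun t ↦ flow h.complete t y) = fun _ ↦ y := funext hfix
  rw [h2] at h1
  have h3 := h1.unique (hasVelocityWithinAt_const y) uniqueDiffWithinAt_univ
  exact h.modelVec_ne_zero _ h3

/-- The orbits are themselves inextendible timelike curves, so the Cauchy property applies to them.
-/
theorem IsStationary.existsUnique_flow_mem (x : M) : ∃! s : ℝ, flow h.complete s x ∈ S := by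
  refine h.cauchy _ ⟨?_, fun s ↦ ?_, ?_, ?_⟩
  · exact (contMDiff_flow h.complete h.smooth).comp (contMDiff_id.prodMk contMDiff_const)
  · have h1 : mfderiv 𝓘(ℝ, ℝ) 𝓘(ℝ, E) (fun t ↦ flow h.complete t x) s (1 : ℝ) =
        K (flow h.complete s x) := by
      have := (h.hasVelocityWithinAt_flow x univ s).velocityWithin_eq uniqueDiffWithinAt_univ
      rw [velocityWithin, mfderivWithin_univ] at this
      exact this
    rw [h1]
    exact h.timelike _
  · rintro ⟨y, hy⟩
    exact h.not_tendsto_flow (fun s ↦ tendsto_atTop_add_const_left _ s tendsto_id) x y hy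
  · rintro ⟨y, hy⟩
    exact h.not_tendsto_flow (fun s ↦ tendsto_atBot_add_const_left _ s tendsto_id) x y hy

omit h in
/-- The time function of the splitting: minus the time at which the orbit of `x` crosses `S`. -/
def IsStationary.time (h : IsStationary g K S) (x : M) : ℝ :=
  -(h.existsUnique_flow_mem x).choose

theorem IsStationary.flow_neg_time_mem (x : M) : flow h.complete (-h.time x) x ∈ S := by
  rw [IsStationary.time, neg_neg]
  exact (h.existsUnique_flow_mem x).choose_spec.1

theorem IsStationary.time_eq {x : M} {t : ℝ} (ht : flow h.complete t x ∈ S) : h.time x = -t := by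
  rw [IsStationary.time, ← (h.existsUnique_flow_mem x).choose_spec.2 t ht]

theorem IsStationary.time_flow (t : ℝ) (x : M) : h.time (flow h.complete t x) = h.time x + t := by
  have h1 : flow h.complete (-h.time x - t) (flow h.complete t x) ∈ S := by
    rw [← flow_add h.complete h.smooth, sub_add_cancel]
    exact h.flow_neg_time_mem x
  rw [h.time_eq h1]; ring

theorem IsStationary.time_eq_zero_iff {x : M} : h.time x = 0 ↔ x ∈ S := by
  constructor
  · intro h0
    have := h.flow_neg_time_mem x
    rwa [h0, neg_zero, flow_zero] at this
  · intro hx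
    rw [h.time_eq (t := 0) (by rwa [flow_zero]), neg_zero]

/-- `K` is transverse to `S`: were it tangent, it would be spacelike. -/
theorem IsStationary.exists_local_defining_function {y : M} (hy : y ∈ S) :
    ∃ (U : Set M) (f : M → ℝ), IsOpen U ∧ y ∈ U ∧ ContMDiffOn 𝓘(ℝ, E) 𝓘(ℝ, ℝ) 1 f U ∧
      (∀ z ∈ U, z ∈ S ↔ f z = 0) ∧ modelDiff f y (modelVec K y : E) ≠ 0 ∧
      ∀ v : E, modelDiff f y v = 0 → v ≠ 0 → 0 < modelInner g y v v := by
  obtain ⟨U, f, hU, hyU, hf, hS, -, hpos⟩ := h.spacelike y hy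
  refine ⟨U, f, hU, hyU, hf.of_le one_le_infty, hS, fun h0 ↦ ?_, hpos⟩
  have h1 := h.timelike y
  have h2 : K y ≠ 0 := by
    intro h3
    rw [h3] at h1
    simp at h1
  have := hpos (K y) h0 h2
  linarith

/-- Implicit function theorem for f(flow_t x) = 0, where f defines `S` locally. By uniqueness of the
crossing time, the implicit solution is the crossing time itself, and not merely a local branch. -/
theorem IsStationary.contMDiff_time : ContMDiff 𝓘(ℝ, E) 𝓘(ℝ, ℝ) 1 h.time := by
  intro x₀
  set φ := extChartAt 𝓘(ℝ, E) x₀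
  set s₀ := -h.time x₀ with hs₀
  obtain ⟨U, f, hU, hyU, hf, hS, hfK, -⟩ := h.exists_local_defining_function (h.flow_neg_time_mem x₀)
  have hφ : φ.symm (φ x₀) = x₀ := φ.left_inv (mem_extChartAt_source x₀)
  have hfat : ContMDiffAt 𝓘(ℝ, E) 𝓘(ℝ, ℝ) 1 f (flow h.complete s₀ x₀) :=
    hf.contMDiffAt (hU.mem_nhds hyU)
  set H : E × ℝ → M := fun p ↦ flow h.complete p.2 (φ.symm p.1) with hH
  have hHc : ContMDiffAt 𝓘(ℝ, E × ℝ) 𝓘(ℝ, E) 1 H (φ x₀, s₀) := by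
    have h1 : ContMDiffAt 𝓘(ℝ, E) 𝓘(ℝ, E) 1 φ.symm (φ x₀) :=
      (contMDiffOn_extChartAt_symm x₀).contMDiffAt (extChartAt_target_mem_nhds x₀)
    have h2 : ContMDiffAt 𝓘(ℝ, E × ℝ) 𝓘(ℝ, E) 1 (fun p : E × ℝ ↦ φ.symm p.1) (φ x₀, s₀) :=
      ContMDiffAt.comp (g := φ.symm) (f := fun p : E × ℝ ↦ p.1) (φ x₀, s₀) h1
        contDiff_fst.contMDiff.contMDiffAt
    have h3 : ContMDiffAt 𝓘(ℝ, E × ℝ) (𝓘(ℝ, ℝ).prod 𝓘(ℝ, E)) 1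
        (fun p : E × ℝ ↦ (p.2, φ.symm p.1)) (φ x₀, s₀) :=
      contDiff_snd.contMDiff.contMDiffAt.prodMk h2
    exact (contMDiff_flow h.complete h.smooth).contMDiffAt.comp _ h3
  have hH0 : H (φ x₀, s₀) = flow h.complete s₀ x₀ := by simp only [hH, hφ]
  have cdf : ContDiffAt ℝ 1 (f ∘ H) (φ x₀, s₀) := by
    rw [← contMDiffAt_iff_contDiffAt]
    exact ContMDiffAt.comp _ (by rw [hH0]; exact hfat) hHc
  -- The partial derivative in t is df(K), which is nonzero by transversality.
  have hinv : (fderiv ℝ (f ∘ H) (φ x₀, s₀) ∘L .inr ℝ E ℝ).IsInvertible := by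
    set c := modelDiff f (flow h.complete s₀ x₀) (modelVec K (flow h.complete s₀ x₀)) with hcdef
    have h1 : HasDerivAt (fun t ↦ f (flow h.complete t x₀)) c s₀ := by
      have := (h.hasVelocityWithinAt_flow x₀ univ s₀).hasDerivWithinAt
        (hfat.mdifferentiableAt (by simp))
      rwa [hasDerivWithinAt_univ] at this
    have h2 : HasFDerivAt (fun t : ℝ ↦ (φ x₀, t)) (.inr ℝ E ℝ) s₀ := by
      exact hasFDerivAt_prodMk_right _ _
    have h3 := HasFDerivAt.comp (g := f ∘ H) s₀
      (cdf.differentiableAt (by simp)).hasFDerivAt h2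
    have e : (f ∘ H) ∘ (fun t : ℝ ↦ (φ x₀, t)) = fun t ↦ f (flow h.complete t x₀) := by
      funext t; simp only [hH, Function.comp_apply, hφ]
    rw [e] at h3
    have h4 := h3.unique h1.hasFDerivAt
    refine ⟨ContinuousLinearEquiv.unitsEquivAut ℝ (Units.mk0 c hfK), ?_⟩
    rw [h4]
    ext
    simp
  set ψ := cdf.implicitFunction (by simp) hinv with hψ
  have hψ0 : ψ (φ x₀) = s₀ := cdf.implicitFunction_apply_self (by simp) hinv
  have hψc : ContDiffAt ℝ 1 ψ (φ x₀) := cdf.contDiffAt_implicitFunction (by simp) hinv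
  have hψe : ∀ᶠ u in 𝓝 (φ x₀), f (H (u, ψ u)) = 0 := by
    have h1 := cdf.eventually_apply_implicitFunction (by simp) hinv
    have h2 : (f ∘ H) (φ x₀, s₀) = 0 := by
      rw [Function.comp_apply, hH0, ← hS _ hyU]
      exact h.flow_neg_time_mem x₀
    rw [h2] at h1
    exact h1
  have hψU : ∀ᶠ u in 𝓝 (φ x₀), H (u, ψ u) ∈ U := by
    have h1 : ContinuousAt (fun u ↦ (u, ψ u)) (φ x₀) := continuousAt_id.prodMk hψc.continuousAt
    have h2 : ContinuousAt H (φ x₀, ψ (φ x₀)) := by rw [hψ0]; exact hHc.continuousAt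
    have h3 : ContinuousAt (fun u ↦ H (u, ψ u)) (φ x₀) :=
      ContinuousAt.comp (f := fun u ↦ (u, ψ u)) h2 h1
    refine h3.eventually (hU.mem_nhds ?_)
    change H (φ x₀, ψ (φ x₀)) ∈ U
    rw [hψ0, hH0]
    exact hyU
  have hev : h.time =ᶠ[𝓝 x₀] fun x ↦ -ψ (φ x) := by
    filter_upwards [(continuousAt_extChartAt (I := 𝓘(ℝ, E)) x₀).eventually (hψe.and hψU),
      extChartAt_source_mem_nhds (I := 𝓘(ℝ, E)) x₀] with x hx hxs
    have h1 : H (φ x, ψ (φ x)) ∈ S := (hS _ hx.2).2 hx.1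
    simp only [hH, φ.left_inv hxs] at h1
    exact h.time_eq h1
  refine ContMDiffAt.congr_of_eventuallyEq ?_ hev
  exact ContMDiffAt.comp (g := fun u ↦ -ψ u) (f := φ) x₀ hψc.neg.contMDiffAt contMDiffAt_extChartAt

theorem IsStationary.mdifferentiableAt_time (x : M) :
    MDifferentiableAt 𝓘(ℝ, E) 𝓘(ℝ, ℝ) h.time x :=
  h.contMDiff_time.mdifferentiable (by simp) x

theorem IsStationary.modelDiff_time_modelVec (x : M) :
    modelDiff h.time x (modelVec K x : E) = 1 := by
  have h1 := h.hasVelocityWithinAt_flow x univ 0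
  have h2 := h1.hasDerivWithinAt (h.mdifferentiableAt_time _)
  rw [hasDerivWithinAt_univ, flow_zero] at h2
  have e : (h.time ∘ fun t ↦ flow h.complete t x) = fun t ↦ h.time x + t :=
    funext fun t ↦ h.time_flow t x
  rw [e] at h2
  exact h2.unique ((hasDerivAt_id 0).const_add (h.time x))

theorem IsStationary.modelDiff_time_flow (t : ℝ) (x : M) (v : E) :
    modelDiff h.time (flow h.complete t x) (modelDeriv (flow h.complete t) x v) =
      modelDiff h.time x v := by
  have e : h.time ∘ flow h.complete t = fun x ↦ h.time x + t := funext fun x ↦ h.time_flow t x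
  have h1 := HasMFDerivAt.comp x (h.mdifferentiableAt_time (flow h.complete t x)).hasMFDerivAt
    (mdifferentiableAt_flow h.complete h.smooth t x).hasMFDerivAt
  rw [e] at h1
  have h2 := (h.mdifferentiableAt_time x).hasMFDerivAt.add (hasMFDerivAt_const t x)
  have h3 := hasMFDerivAt_unique h1 h2
  have h4 := DFunLike.congr_fun (F := E →L[ℝ] ℝ) h3 v
  exact h4.trans (add_zero (modelDiff h.time x v))

omit h in
/-- The projection onto `S` along the orbits of the Killing field. -/
def IsStationary.proj (h : IsStationary g K S) (x : M) : M := flow h.complete (-h.time x) x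

theorem IsStationary.proj_mem (x : M) : h.proj x ∈ S := h.flow_neg_time_mem x

theorem IsStationary.proj_of_mem {x : M} (hx : x ∈ S) : h.proj x = x := by
  rw [IsStationary.proj, h.time_eq_zero_iff.2 hx, neg_zero, flow_zero]

theorem IsStationary.flow_time_proj (x : M) : flow h.complete (h.time x) (h.proj x) = x :=
  flow_flow_neg h.complete h.smooth _ _

theorem IsStationary.proj_flow (t : ℝ) (x : M) : h.proj (flow h.complete t x) = h.proj x := by
  rw [IsStationary.proj, h.time_flow, ← flow_add h.complete h.smooth, IsStationary.proj]
  congr 1; ring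

theorem IsStationary.contMDiff_proj : ContMDiff 𝓘(ℝ, E) 𝓘(ℝ, E) 1 h.proj :=
  (contMDiff_flow h.complete h.smooth).comp (h.contMDiff_time.neg.prodMk contMDiff_id)

omit h in
theorem exists_hasVelocityWithinAt (x : M) (v : E) :
    ∃ γ : ℝ → M, γ 0 = x ∧ HasVelocityWithinAt γ v univ 0 := by
  set φ := extChartAt 𝓘(ℝ, E) x
  have hx : x ∈ φ.source := mem_extChartAt_source x
  set w : E := mfderiv 𝓘(ℝ, E) 𝓘(ℝ, E) φ x v with hw
  have h1 : HasDerivAt (fun s : ℝ ↦ φ x + s • w) w 0 := by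
    simpa using ((hasDerivAt_id (0 : ℝ)).smul_const w).const_add (φ x)
  have h2 : φ x + (0 : ℝ) • w = φ x := by simp
  have h3 := hasMFDerivAt_extChartAt_symm_comp (x₀ := x) h1
    (by rw [h2]; exact mem_extChartAt_target x)
  have g1 := mfderivWithin_extChartAt_symm_comp_mfderiv_extChartAt' (I := 𝓘(ℝ, E)) hx
  simp only [modelWithCornersSelf_coe, range_id, mfderivWithin_univ] at g1
  have h4 : (mfderiv 𝓘(ℝ, E) 𝓘(ℝ, E) φ.symm (φ x + (0 : ℝ) • w) : E →L[ℝ] E) w = v := by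
    have h5 : ∀ u : E, u = φ x → (mfderiv 𝓘(ℝ, E) 𝓘(ℝ, E) φ.symm u : E →L[ℝ] E) w = v := by
      rintro _ rfl
      exact DFunLike.congr_fun (F := E →L[ℝ] E) g1 v
    exact h5 _ h2
  refine ⟨fun s ↦ φ.symm (φ x + s • w), by simp only [h2]; exact φ.left_inv hx, ?_⟩
  refine (h3.hasMFDerivWithinAt (s := univ)).congr_mfderiv ?_
  refine ContinuousLinearMap.ext_ring (M₁ := E) ?_
  refine Eq.trans (b := (1 : ℝ) • v) ?_ rfl
  exact congrArg (fun y : E ↦ (1 : ℝ) • y) h4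

omit h in
/-- The component of a tangent vector in the kernel of the differential of the time function. -/
def IsStationary.horiz (h : IsStationary g K S) (x : M) (v : E) : E :=
  v - modelDiff h.time x v • modelVec K x

/-- The projection moves each point by time -T; the contribution of the varying time cancels the
component of the velocity along `K`. -/
theorem IsStationary.hasVelocityWithinAt_proj {γ : ℝ → M} {v : E} {A : Set ℝ} {s : ℝ}
    (hγ : HasVelocityWithinAt γ v A s) :
    HasVelocityWithinAt (h.proj ∘ γ)
      (modelDeriv (flow h.complete (-h.time (γ s))) (γ s) (h.horiz (γ s) v)) A s := by
  have h1 := hγ.flow h.complete h.smooth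
    (hγ.hasDerivWithinAt (h.mdifferentiableAt_time (γ s))).neg
  rw [neg_smul, ← sub_eq_add_neg] at h1
  exact h1

theorem IsStationary.modelDiff_time_horiz (x : M) (v : E) :
    modelDiff h.time x (h.horiz x v) = 0 := by
  rw [IsStationary.horiz, map_sub, map_smul, h.modelDiff_time_modelVec]
  simp

/-- The metric is positive definite on the kernel of the differential of the time function. -/
theorem IsStationary.modelInner_pos {x : M} {v : E} (hv : modelDiff h.time x v = 0)
    (hv0 : v ≠ 0) : 0 < modelInner g x v v := by
  -- At a point of `S`, project onto `S` a curve with velocity w. As w is horizontal the velocity is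
  -- unchanged, so df(w) = 0 for a local defining function f of `S`, and spacelikeness applies.
  -- Other points are carried to `S` by the flow, which preserves the metric and dT.
  have key : ∀ y ∈ S, ∀ w : E, modelDiff h.time y w = 0 → w ≠ 0 → 0 < modelInner g y w w := by
    intro y hy w hw hw0
    obtain ⟨U, f, hU, hyU, hf, hS, -, hpos⟩ := h.exists_local_defining_function hy
    refine hpos w ?_ hw0
    obtain ⟨γ, rfl, hγ⟩ := exists_hasVelocityWithinAt y w
    have h1 := h.hasVelocityWithinAt_proj hγ
    have h2 : modelDeriv (flow h.complete (-h.time (γ 0))) (γ 0) (h.horiz (γ 0) w) = w := by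
      have h3 : ∀ F : M → M, F = id → modelDeriv F (γ 0) w = w := by
        rintro _ rfl
        exact DFunLike.congr_fun (F := E →L[ℝ] E) (mfderiv_id (I := 𝓘(ℝ, E)) (x := γ 0)) w
      rw [IsStationary.horiz, hw, zero_smul, sub_zero, h.time_eq_zero_iff.2 hy, neg_zero]
      exact h3 _ (funext fun x ↦ flow_zero _ x)
    rw [h2] at h1
    have hp : (h.proj ∘ γ) 0 = γ 0 := h.proj_of_mem hy
    have h4 := h1.hasDerivWithinAt (φ := f) (by
      rw [hp]; exact (hf.contMDiffAt (hU.mem_nhds hyU)).mdifferentiableAt (by simp))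
    rw [hp, hasDerivWithinAt_univ] at h4
    have h5 : f ∘ (h.proj ∘ γ) =ᶠ[𝓝 0] fun _ ↦ 0 := by
      have hc : ContinuousAt (h.proj ∘ γ) 0 := by
        rw [← continuousWithinAt_univ]; exact h1.continuousWithinAt
      have hU' : U ∈ 𝓝 ((h.proj ∘ γ) 0) := by rw [hp]; exact hU.mem_nhds hyU
      filter_upwards [hc.eventually hU'] with s hs
      exact (hS _ hs).1 (h.proj_mem _)
    exact (h4.congr_of_eventuallyEq h5.symm).unique (hasDerivAt_const _ _)
  rw [← h.modelInner_flow (-h.time x)]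
  refine key _ (h.flow_neg_time_mem x) _ ?_ ?_
  · rw [h.modelDiff_time_flow, hv]
  · intro h0
    exact hv0 (h.modelDeriv_flow_injective _ x (h0.trans (map_zero _).symm))

end TimeFunction

/-! ### Continuous homogeneous functions on the tangent bundle -/

section TangentFunctions

variable {E : Type*} [NormedAddCommGroup E] [NormedSpace ℝ E]
  {M : Type*} [TopologicalSpace M] [ChartedSpace E M]

theorem continuous_tangentBundle_mk :
    Continuous fun p : E × E ↦ (⟨p.1, p.2⟩ : TangentBundle 𝓘(ℝ, E) E) :=
  (tangentBundleModelSpaceHomeomorph 𝓘(ℝ, E)).symm.continuous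

theorem continuous_tangentBundle_snd :
    Continuous fun p : TangentBundle 𝓘(ℝ, E) E ↦ (p.2 : E) :=
  continuous_snd.comp (tangentBundleModelSpaceHomeomorph 𝓘(ℝ, E)).continuous

variable [IsManifold 𝓘(ℝ, E) ∞ M]

/-- A function on the tangent bundle is continuous. -/
def ContinuousOnTangent (Q : M → E → ℝ) : Prop :=
  Continuous fun p : TangentBundle 𝓘(ℝ, E) M ↦ Q p.1 p.2

theorem continuousOn_velocityWithin {γ : ℝ → M} {A : Set ℝ}
    (hγ : ContMDiffOn 𝓘(ℝ, ℝ) 𝓘(ℝ, E) 1 γ A) (hA : UniqueDiffOn ℝ A) :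
    ContinuousOn (fun s ↦ (⟨γ s, velocityWithin (E := E) γ A s⟩ : TangentBundle 𝓘(ℝ, E) M)) A := by
  have h1 := hγ.continuousOn_tangentMapWithin le_rfl hA.uniqueMDiffOn
  have h2 : Continuous fun s : ℝ ↦ (⟨s, (1 : ℝ)⟩ : TangentBundle 𝓘(ℝ, ℝ) ℝ) :=
    continuous_tangentBundle_mk.comp (continuous_id.prodMk continuous_const)
  exact h1.comp h2.continuousOn fun s hs ↦ hs

theorem ContinuousOnTangent.comp_velocityWithin {Q : M → E → ℝ} (hQ : ContinuousOnTangent Q)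
    {γ : ℝ → M} {A : Set ℝ} (hγ : ContMDiffOn 𝓘(ℝ, ℝ) 𝓘(ℝ, E) 1 γ A) (hA : UniqueDiffOn ℝ A) :
    ContinuousOn (fun s ↦ Q (γ s) (velocityWithin γ A s)) A :=
  Continuous.comp_continuousOn hQ (continuousOn_velocityWithin hγ hA)

theorem continuousOn_chartInv (x₀ : M) :
    ContinuousOn (fun p : E × E ↦ (⟨(extChartAt 𝓘(ℝ, E) x₀).symm p.1, chartInv x₀ p.1 p.2⟩ :
      TangentBundle 𝓘(ℝ, E) M)) ((extChartAt 𝓘(ℝ, E) x₀).target ×ˢ univ) := by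
  have ho := isOpen_extChartAt_target (I := 𝓘(ℝ, E)) x₀
  have h1 := (contMDiffOn_extChartAt_symm (I := 𝓘(ℝ, E)) (n := 1) x₀).continuousOn_tangentMapWithin
    le_rfl ho.uniqueMDiffOn
  have h2 := h1.comp (continuous_tangentBundle_mk (E := E)).continuousOn
    (s := (extChartAt 𝓘(ℝ, E) x₀).target ×ˢ univ) fun p hp ↦ hp.1
  refine h2.congr fun p hp ↦ ?_
  simp only [Function.comp_apply, tangentMapWithin]
  rw [mfderivWithin_of_isOpen ho hp.1]
  rfl

theorem exists_chartInv_eq {x₀ y : M} (hy : y ∈ (extChartAt 𝓘(ℝ, E) x₀).source) (v : E) :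
    ∃ w : E, chartInv x₀ (extChartAt 𝓘(ℝ, E) x₀ y) w = v := by
  have h := mfderivWithin_extChartAt_symm_comp_mfderiv_extChartAt' (I := 𝓘(ℝ, E)) hy
  simp only [modelWithCornersSelf_coe, range_id, mfderivWithin_univ] at h
  exact ⟨(mfderiv 𝓘(ℝ, E) 𝓘(ℝ, E) (extChartAt 𝓘(ℝ, E) x₀) y : E →L[ℝ] E) v,
    DFunLike.congr_fun (F := E →L[ℝ] E) h v⟩

theorem chartInv_injective {x₀ y : M} (hy : y ∈ (extChartAt 𝓘(ℝ, E) x₀).source) :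
    Function.Injective (chartInv x₀ (extChartAt 𝓘(ℝ, E) x₀ y)) := by
  have h := mfderiv_extChartAt_comp_mfderivWithin_extChartAt_symm' (I := 𝓘(ℝ, E)) hy
  simp only [modelWithCornersSelf_coe, range_id, mfderivWithin_univ] at h
  intro v w hvw
  have h1 := DFunLike.congr_fun (F := E →L[ℝ] E) h
  have h2 : ∀ u : E, (mfderiv 𝓘(ℝ, E) 𝓘(ℝ, E) (extChartAt 𝓘(ℝ, E) x₀) y : E →L[ℝ] E)
    (chartInv x₀ (extChartAt 𝓘(ℝ, E) x₀ y) u) = u := h1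
  rw [← h2 v, ← h2 w, hvw]

theorem continuousOnTangent_modelDiff {φ : M → ℝ} (hφ : ContMDiff 𝓘(ℝ, E) 𝓘(ℝ, ℝ) 1 φ) :
    ContinuousOnTangent (fun x (v : E) ↦ modelDiff φ x v) :=
  continuous_tangentBundle_snd.comp (hφ.continuous_tangentMap le_rfl)

theorem continuousOnTangent_comp_proj {f : M → ℝ} (hf : Continuous f) :
    ContinuousOnTangent (E := E) (fun x _ ↦ f x) :=
  hf.comp (FiberBundle.continuous_proj E (TangentSpace 𝓘(ℝ, E) (M := M)))

variable (g : LorentzMetric E M)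

theorem continuousOnTangent_modelInner_self :
    ContinuousOnTangent (fun x v ↦ modelInner g x v v) := by
  have h1 : ContMDiffOn 𝓘(ℝ, E).tangent 𝓘(ℝ, E).tangent ∞
    (fun p : TangentBundle 𝓘(ℝ, E) M ↦ (⟨p.1, p.2⟩ : TangentBundle 𝓘(ℝ, E) M)) univ :=
    contMDiffOn_id
  exact continuousOn_univ.1 (g.contMDiffOn_inner le_rfl h1 h1).continuousOn

theorem continuousOnTangent_modelInner_modelVec {K : VField E M} (hK : SmoothVFieldOn K univ) :
    ContinuousOnTangent (fun x v ↦ modelInner g x v (modelVec K x)) := by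
  have h1 : ContMDiffOn 𝓘(ℝ, E).tangent 𝓘(ℝ, E).tangent ∞
    (fun p : TangentBundle 𝓘(ℝ, E) M ↦ (⟨p.1, p.2⟩ : TangentBundle 𝓘(ℝ, E) M)) univ :=
    contMDiffOn_id
  have h2 : ContMDiffOn 𝓘(ℝ, E).tangent 𝓘(ℝ, E).tangent ∞
    (fun p : TangentBundle 𝓘(ℝ, E) M ↦ (⟨p.1, K p.1⟩ : TangentBundle 𝓘(ℝ, E) M)) univ :=
    hK.comp (Bundle.contMDiff_proj (TangentSpace 𝓘(ℝ, E) (M := M))).contMDiffOn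
      fun _ _ ↦ mem_univ _
  exact continuousOn_univ.1 (g.contMDiffOn_inner le_rfl h1 h2).continuousOn

theorem continuous_modelInner_modelVec {K : VField E M} (hK : SmoothVFieldOn K univ) :
    Continuous fun x ↦ modelInner g x (modelVec K x) (modelVec K x) :=
  continuousOn_univ.1 (g.contMDiffOn_inner le_rfl hK hK).continuousOn

variable [FiniteDimensional ℝ E]

/-- Over a compact set a continuous homogeneous function on the tangent bundle is controlled by
finitely many members of any family of such functions which are nonnegative and do not vanish
simultaneously off the zero section. -/
theorem exists_le_mul_sum_of_homogeneous {ι : Type*} {Q₁ : M → E → ℝ} {Q : ι → M → E → ℝ}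
    (h₁ : ContinuousOnTangent Q₁) (h₂ : ∀ i, ContinuousOnTangent (Q i))
    (hh₁ : ∀ x v (t : ℝ), 0 ≤ t → Q₁ x (t • v) = t * Q₁ x v)
    (hh₂ : ∀ i x v (t : ℝ), 0 ≤ t → Q i x (t • v) = t * Q i x v)
    (hnn : ∀ i x v, 0 ≤ Q i x v) (hpos : ∀ x v, v ≠ 0 → ∃ i, 0 < Q i x v)
    {N : Set M} (hN : IsCompact N) :
    ∃ F : Finset ι, ∃ C > 0, ∀ x ∈ N, ∀ v, Q₁ x v ≤ C * ∑ i ∈ F, Q i x v := by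
  classical
  have hmono : ∀ {F F' : Finset ι} {C C' : ℝ} {x v}, F ⊆ F' → C ≤ C' → 0 < C →
      Q₁ x v ≤ C * ∑ i ∈ F, Q i x v → Q₁ x v ≤ C' * ∑ i ∈ F', Q i x v := fun hF hC h0 h ↦
    h.trans (mul_le_mul hC (Finset.sum_le_sum_of_subset_of_nonneg hF fun i _ _ ↦ hnn i _ _)
      (Finset.sum_nonneg fun i _ ↦ hnn i _ _) (h0.le.trans hC))
  refine hN.induction_on
    (p := fun N ↦ ∃ F : Finset ι, ∃ C > 0, ∀ x ∈ N, ∀ v, Q₁ x v ≤ C * ∑ i ∈ F, Q i x v)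
    ⟨∅, 1, one_pos, by simp⟩
    (fun s t hst ⟨F, C, hC, h⟩ ↦ ⟨F, C, hC, fun x hx ↦ h x (hst hx)⟩) ?_ ?_
  · rintro s t ⟨F, C, hC, h⟩ ⟨F', C', hC', h'⟩
    refine ⟨F ∪ F', max C C', lt_max_of_lt_left hC, fun x hx v ↦ ?_⟩
    rcases hx with hx | hx
    · exact hmono Finset.subset_union_left (le_max_left _ _) hC (h x hx v)
    · exact hmono Finset.subset_union_right (le_max_right _ _) hC' (h' x hx v)
  · intro x₀ _
    set φ := extChartAt 𝓘(ℝ, E) x₀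
    have hx₀ : φ x₀ ∈ φ.target := mem_extChartAt_target x₀
    have hopen : IsOpen (φ.target ×ˢ (univ : Set E)) :=
      (isOpen_extChartAt_target (I := 𝓘(ℝ, E)) x₀).prod isOpen_univ
    have hΨ := continuousOn_chartInv (E := E) x₀
    -- By homogeneity unit vectors of the chart suffice. Their sphere is compact, so a second
    -- covering argument, now in the fibre direction, gives a bound uniform over a neighbourhood of
    -- the base point.
    have key : ∃ F : Finset ι, ∃ C > 0, ∀ᶠ y in 𝓝 (φ x₀), ∀ w ∈ Metric.sphere (0 : E) 1,
        Q₁ (φ.symm y) (chartInv x₀ y w) ≤ C * ∑ i ∈ F, Q i (φ.symm y) (chartInv x₀ y w) := by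
      refine (isCompact_sphere (0 : E) 1).induction_on (p := fun B ↦ ∃ F : Finset ι, ∃ C > 0,
        ∀ᶠ y in 𝓝 (φ x₀), ∀ w ∈ B,
          Q₁ (φ.symm y) (chartInv x₀ y w) ≤ C * ∑ i ∈ F, Q i (φ.symm y) (chartInv x₀ y w))
        ⟨∅, 1, one_pos, by simp⟩ ?_ ?_ ?_
      · rintro s t hst ⟨F, C, hC, h⟩
        exact ⟨F, C, hC, h.mono fun y hy w hw ↦ hy w (hst hw)⟩
      · rintro s t ⟨F, C, hC, h⟩ ⟨F', C', hC', h'⟩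
        refine ⟨F ∪ F', max C C', lt_max_of_lt_left hC, ?_⟩
        filter_upwards [h, h'] with y h h' w hw
        rcases hw with hw | hw
        · exact hmono Finset.subset_union_left (le_max_left _ _) hC (h w hw)
        · exact hmono Finset.subset_union_right (le_max_right _ _) hC' (h' w hw)
      · intro w hw
        have hw0 : w ≠ 0 := by
          rintro rfl
          simp at hw
        obtain ⟨i, hp⟩ := hpos (φ.symm (φ x₀)) (chartInv x₀ (φ x₀) w) fun h0 ↦
          hw0 (chartInv_injective (mem_extChartAt_source x₀) (h0.trans (map_zero _).symm))
        have hmem : φ.target ×ˢ (univ : Set E) ∈ 𝓝 (φ x₀, w) := hopen.mem_nhds ⟨hx₀, mem_univ _⟩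
        have c1 : ContinuousAt (fun p : E × E ↦ Q₁ (φ.symm p.1) (chartInv x₀ p.1 p.2)) (φ x₀, w) :=
          (Continuous.comp_continuousOn h₁ hΨ).continuousAt hmem
        have c2 : ContinuousAt (fun p : E × E ↦ Q i (φ.symm p.1) (chartInv x₀ p.1 p.2))
            (φ x₀, w) :=
          (Continuous.comp_continuousOn (h₂ i) hΨ).continuousAt hmem
        -- Chosen so that the inequality is strict at (φ x₀, w), whence it persists nearby by
        -- continuity.
        set C := (|Q₁ (φ.symm (φ x₀)) (chartInv x₀ (φ x₀) w)| + 1) /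
          Q i (φ.symm (φ x₀)) (chartInv x₀ (φ x₀) w) with hCdef
        have hC : 0 < C := by positivity
        have hlt : Q₁ (φ.symm (φ x₀)) (chartInv x₀ (φ x₀) w) <
            C * Q i (φ.symm (φ x₀)) (chartInv x₀ (φ x₀) w) := by
          rw [hCdef, div_mul_cancel₀ _ hp.ne']
          linarith [le_abs_self (Q₁ (φ.symm (φ x₀)) (chartInv x₀ (φ x₀) w))]
        have hev := c1.eventually_lt (continuousAt_const.mul c2) hlt
        rw [nhds_prod_eq] at hev
        obtain ⟨pa, hpa, pb, hpb, hab⟩ := eventually_prod_iff.1 hev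
        refine ⟨{w | pb w}, mem_nhdsWithin_of_mem_nhds hpb, {i}, C, hC, ?_⟩
        filter_upwards [hpa] with y hy w hw
        rw [Finset.sum_singleton]
        exact (hab hy hw).le
    obtain ⟨F, C, hC, hev⟩ := key
    refine ⟨φ.source ∩ φ ⁻¹' {y | ∀ w ∈ Metric.sphere (0 : E) 1,
        Q₁ (φ.symm y) (chartInv x₀ y w) ≤ C * ∑ i ∈ F, Q i (φ.symm y) (chartInv x₀ y w)},
      mem_nhdsWithin_of_mem_nhds (inter_mem (extChartAt_source_mem_nhds x₀)
        (continuousAt_extChartAt x₀ hev)), F, C, hC, ?_⟩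
    rintro x ⟨hx, hx'⟩ v
    obtain ⟨w, rfl⟩ := exists_chartInv_eq hx v
    rcases eq_or_ne w 0 with rfl | hw
    · have e1 := hh₁ x 0 0 le_rfl
      rw [smul_zero, zero_mul] at e1
      rw [map_zero, e1]
      exact mul_nonneg hC.le (Finset.sum_nonneg fun i _ ↦ hnn i _ _)
    · have hn : 0 < ‖w‖ := norm_pos_iff.2 hw
      have h1 := hx' (‖w‖⁻¹ • w) (by simp [norm_smul, hn.ne'])
      rw [φ.left_inv hx] at h1
      have h2 : chartInv x₀ (φ x) w = ‖w‖ • chartInv x₀ (φ x) (‖w‖⁻¹ • w) := by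
        rw [map_smul, smul_smul, mul_inv_cancel₀ hn.ne', one_smul]
      have h3 : ∑ i ∈ F, Q i x (‖w‖ • chartInv x₀ (φ x) (‖w‖⁻¹ • w)) =
          ‖w‖ * ∑ i ∈ F, Q i x (chartInv x₀ (φ x) (‖w‖⁻¹ • w)) := by
        rw [Finset.mul_sum]
        exact Finset.sum_congr rfl fun i _ ↦ hh₂ _ _ _ _ hn.le
      rw [h2, hh₁ _ _ _ hn.le, h3, mul_left_comm]
      exact mul_le_mul_of_nonneg_left h1 hn.le

theorem exists_le_mul_of_homogeneous {Q₁ Q₂ : M → E → ℝ} (h₁ : ContinuousOnTangent Q₁)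
    (h₂ : ContinuousOnTangent Q₂) (hh₁ : ∀ x v (t : ℝ), 0 ≤ t → Q₁ x (t • v) = t * Q₁ x v)
    (hh₂ : ∀ x v (t : ℝ), 0 ≤ t → Q₂ x (t • v) = t * Q₂ x v) (hpos : ∀ x v, v ≠ 0 → 0 < Q₂ x v)
    {N : Set M} (hN : IsCompact N) : ∃ C > 0, ∀ x ∈ N, ∀ v, Q₁ x v ≤ C * Q₂ x v := by
  have hnn : ∀ x v, 0 ≤ Q₂ x v := by
    intro x v
    rcases eq_or_ne v 0 with rfl | hv
    · have := hh₂ x 0 0 le_rfl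
      rw [smul_zero, zero_mul] at this
      exact this.ge
    · exact (hpos x v hv).le
  obtain ⟨F, C, hC, h⟩ := exists_le_mul_sum_of_homogeneous (ι := Unit) (Q := fun _ ↦ Q₂) h₁
    (fun _ ↦ h₂) hh₁ (fun _ ↦ hh₂) (fun _ ↦ hnn) (fun x v hv ↦ ⟨(), hpos x v hv⟩) hN
  refine ⟨C, hC, fun x hx v ↦ (h x hx v).trans (mul_le_mul_of_nonneg_left ?_ hC.le)⟩
  exact (Finset.sum_le_sum_of_subset_of_nonneg (Finset.subset_univ F) fun _ _ _ ↦ hnn x v).trans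
    (by simp)

end TangentFunctions

/-! ### Hopf–Rinow for asymmetric length structures -/

section HopfRinow

/-- An abstract (possibly asymmetric) length structure: `R x y r` means that `y` can be reached from
`x` by a path of length less than `r`. -/
structure IsLengthRelation {X : Type*} [TopologicalSpace X] (R : X → X → ℝ → Prop) : Prop where
  mono {x y : X} {r r' : ℝ} : R x y r → r ≤ r' → R x y r'
  trans {x y z : X} {r r' : ℝ} : R x y r → R y z r' → R x z (r + r')
  split {x y : X} {a b : ℝ} : 0 < a → 0 < b → R x y (a + b) → ∃ z, R x z a ∧ R z y b
  exists_compact (x : X) : ∃ ε > 0, ∃ N, IsCompact N ∧ ∀ y, R x y ε → y ∈ N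
  eventually (x : X) {η : ℝ} : 0 < η → ∀ᶠ y in 𝓝 x, R x y η ∧ R y x η

variable {X : Type*} [TopologicalSpace X] [T2Space X] {R : X → X → ℝ → Prop}

/-- If all points within r of x had relatively compact balls of radius r/2, consider the supremum ρ
of the radii up to r for which the ball about x is relatively compact. Covering the closure of a
slightly smaller ball by finitely many such neighbourhoods pushes the radius past ρ, unless r itself
is already reached. -/
theorem IsLengthRelation.exists_not_compact_half (hR : IsLengthRelation R) {x : X} {r : ℝ}
    (hr : 0 < r) (hx : ¬ ∃ N, IsCompact N ∧ ∀ y, R x y r → y ∈ N) :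
    ∃ y, R x y r ∧ ¬ ∃ N, IsCompact N ∧ ∀ z, R y z (r / 2) → z ∈ N := by
  by_contra! hgood
  set A : Set ℝ := {t | t ≤ r ∧ ∃ N, IsCompact N ∧ ∀ y, R x y t → y ∈ N} with hA
  obtain ⟨ε, hε, N₀, hN₀, hN₀'⟩ := hR.exists_compact x
  have hmemA : min ε r ∈ A :=
    ⟨min_le_right _ _, N₀, hN₀, fun y hy ↦ hN₀' y (hR.mono hy (min_le_left _ _))⟩
  have hbdd : BddAbove A := ⟨r, fun t ht ↦ ht.1⟩
  set ρ := sSup A with hρdef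
  have hρ : 0 < ρ := (lt_min hε hr).trans_le (le_csSup hbdd hmemA)
  have hρr : ρ ≤ r := csSup_le ⟨_, hmemA⟩ fun t ht ↦ ht.1
  -- The bound r/8 gives δ + 2δ ≤ r/2, so balls of radius 2δ about points near y lie in the ball of
  -- radius r/2 about y; ρ/2 keeps ρ - δ positive.
  set δ := min (r / 8) (ρ / 2) with hδdef
  have hδ : 0 < δ := lt_min (by linarith) (by linarith)
  have hδ1 : δ ≤ r / 8 := min_le_left _ _
  have hδ2 : δ ≤ ρ / 2 := min_le_right _ _
  obtain ⟨t, ⟨htr, N, hN, hNt⟩, hρt⟩ := exists_lt_of_lt_csSup ⟨_, hmemA⟩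
    (show ρ - δ < sSup A by rw [← hρdef]; linarith)
  set B : Set X := {y | R x y (ρ - δ)} with hB
  have hBN : B ⊆ N := fun y hy ↦ hNt y (hR.mono hy hρt.le)
  have hcl : IsCompact (closure B) := hN.closure_of_subset hBN
  have hcov : ∃ N', IsCompact N' ∧ ∀ z ∈ closure B, ∀ w, R z w (2 * δ) → w ∈ N' := by
    have hall : ∀ y ∈ closure B, y ∈ closure B := fun _ h ↦ h
    refine hcl.induction_on (p := fun D ↦ ∃ N', IsCompact N' ∧ ∀ z ∈ D, ∀ w, R z w (2 * δ) → w ∈ N')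
      ⟨∅, isCompact_empty, by simp⟩ (fun s t hst ⟨N', h1, h2⟩ ↦ ⟨N', h1, fun z hz ↦ h2 z (hst hz)⟩)
      ?_ ?_
    · rintro s t ⟨N₁, h1, h1'⟩ ⟨N₂, h2, h2'⟩
      refine ⟨N₁ ∪ N₂, h1.union h2, fun z hz w hw ↦ ?_⟩
      rcases hz with hz | hz
      · exact Or.inl (h1' z hz w hw)
      · exact Or.inr (h2' z hz w hw)
    · intro y hy
      -- A point of the closure is reached from x with an extra cost δ, so it is still within r of x
      -- and `hgood` applies to it.
      obtain ⟨z, hz, hzB⟩ := (mem_closure_iff_frequently.1 hy).and_eventually (hR.eventually y hδ)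
        |>.exists
      have h1 : R x y r := hR.mono (hR.trans hz hzB.2) (by linarith)
      obtain ⟨N', hN', hN''⟩ := hgood y h1
      refine ⟨_, mem_nhdsWithin_of_mem_nhds (hR.eventually y hδ), N', hN', fun z hz w hw ↦ ?_⟩
      exact hN'' w (hR.mono (hR.trans hz.1 hw) (by linarith))
  obtain ⟨N', hN', hN''⟩ := hcov
  have hbig : ∀ y, R x y (ρ + δ) → y ∈ N' := by
    intro w hw
    obtain ⟨z, hz, hzw⟩ := hR.split (a := ρ - δ) (b := 2 * δ) (by linarith) (by linarith)
      (hR.mono hw (by linarith))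
    exact hN'' z (subset_closure hz) w hzw
  have hmem : min r (ρ + δ) ∈ A :=
    ⟨min_le_left _ _, N', hN', fun y hy ↦ hbig y (hR.mono hy (min_le_right _ _))⟩
  have h1 : min r (ρ + δ) ≤ ρ := le_csSup hbdd hmem
  have h2 : min r (ρ + δ) = r := by
    rcases min_choice r (ρ + δ) with h | h
    · exact h
    · rw [h] at h1; linarith
  rw [h2] at hmem
  exact hx hmem.2

/-- The abstract Hopf–Rinow theorem: if paths of finite length have limits, then balls are
relatively compact. -/
theorem IsLengthRelation.exists_isCompact (hR : IsLengthRelation R)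
    (hcomp : ∀ (y : ℕ → X) (r : ℕ → ℝ), Summable r → (∀ n, R (y n) (y (n + 1)) (r n)) →
      ∃ x, ∀ η > 0, ∀ᶠ n in atTop, R x (y n) η) (x : X) (r : ℝ) :
    ∃ N, IsCompact N ∧ ∀ y, R x y r → y ∈ N := by
  wlog hr : 0 < r with hw
  · obtain ⟨N, hN, h⟩ := hw hR hcomp x 1 one_pos
    exact ⟨N, hN, fun y hy ↦ h y (hR.mono hy (by linarith))⟩
  by_contra hx
  -- Bad points whose bad radii halve form a chain of summable steps. Near its limit the bad balls
  -- would lie in a small relatively compact ball. Only the direction from the limit to the chain is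
  -- needed.
  let P : ℕ → X → Prop := fun n y ↦ ¬ ∃ N, IsCompact N ∧ ∀ z, R y z (r / 2 ^ n) → z ∈ N
  have hstep : ∀ n (y : {y // P n y}), ∃ z : {z // P (n + 1) z}, R y.1 z.1 (r / 2 ^ n) := by
    rintro n ⟨y, hy⟩
    obtain ⟨z, hz, hz'⟩ := hR.exists_not_compact_half (by positivity) hy
    have e : r / 2 ^ n / 2 = r / 2 ^ (n + 1) := by rw [pow_succ]; field_simp
    rw [e] at hz'
    exact ⟨⟨z, hz'⟩, hz⟩
  choose f hf using hstep
  let u : (n : ℕ) → {y // P n y} := fun n ↦ Nat.rec ⟨x, by simpa [P] using hx⟩ (fun n y ↦ f n y) n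
  have hu : ∀ n, R (u n).1 (u (n + 1)).1 (r / 2 ^ n) := fun n ↦ hf n (u n)
  have hsum : Summable fun n : ℕ ↦ r / 2 ^ n := by
    simpa [div_eq_mul_inv] using (summable_geometric_two.mul_left r)
  obtain ⟨x', hx'⟩ := hcomp (fun n ↦ (u n).1) _ hsum hu
  obtain ⟨ε, hε, N, hN, hN'⟩ := hR.exists_compact x'
  have h0 := hsum.tendsto_atTop_zero.eventually (gt_mem_nhds (half_pos hε))
  obtain ⟨n, hn, hn'⟩ := ((hx' (ε / 2) (half_pos hε)).and h0).exists
  exact (u n).2 ⟨N, hN, fun z hz ↦ hN' z (hR.mono (hR.trans hn hz) (by linarith))⟩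

end HopfRinow

/-! ### Lengths and concatenation of curves in the hypersurface -/

section Reach

variable {E : Type*} [NormedAddCommGroup E] [NormedSpace ℝ E]
  {M : Type*} [TopologicalSpace M] [ChartedSpace E M] [IsManifold 𝓘(ℝ, E) ∞ M]
  [T2Space M] [FiniteDimensional ℝ E] [CompleteSpace E]
  {g : LorentzMetric E M} {K : VField E M} {S : Set M}

/-- A continuous length density on the tangent bundle which is positively homogeneous, and positive
on the nonzero horizontal vectors. -/
structure IsStationary.IsSpeed (h : IsStationary g K S) (L : M → E → ℝ) : Prop where
  continuous : ContinuousOnTangent L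
  smul (x : M) (v : E) (t : ℝ) : 0 ≤ t → L x (t • v) = t * L x v
  nonneg (x : M) (v : E) : 0 ≤ L x v
  pos (x : M) (v : E) : modelDiff h.time x v = 0 → v ≠ 0 → 0 < L x v

/-- `y` can be reached from `x` by a `C¹` curve in `S` of `L`-length less than `r` which is constant
near its end points. -/
def SReach (S : Set M) (L : M → E → ℝ) (x y : M) (r : ℝ) : Prop :=
  ∃ γ : ℝ → M, ContMDiff 𝓘(ℝ, ℝ) 𝓘(ℝ, E) 1 γ ∧ (∀ s, γ s ∈ S) ∧ (∀ s ≤ 1 / 3, γ s = x) ∧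
    (∀ s ≥ 2 / 3, γ s = y) ∧ ∫ s in (0 : ℝ)..1, L (γ s) (velocityWithin γ univ s) < r

theorem SReach.mono {L : M → E → ℝ} {x y : M} {r r' : ℝ} (hr : SReach S L x y r) (h : r ≤ r') :
    SReach S L x y r' := by
  obtain ⟨γ, h1, h2, h3, h4, h5⟩ := hr
  exact ⟨γ, h1, h2, h3, h4, h5.trans_le h⟩

theorem SReach.left_mem {L : M → E → ℝ} {x y : M} {r : ℝ} (hr : SReach S L x y r) : x ∈ S := by
  obtain ⟨γ, -, h2, h3, -⟩ := hr
  exact h3 0 (by norm_num) ▸ h2 0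

theorem SReach.right_mem {L : M → E → ℝ} {x y : M} {r : ℝ} (hr : SReach S L x y r) : y ∈ S := by
  obtain ⟨γ, -, h2, -, h3, -⟩ := hr
  exact h3 1 (by norm_num) ▸ h2 1

theorem hasVelocityWithinAt_of_contMDiffOn {γ : ℝ → M} {B : Set ℝ} {s : ℝ}
    (hγ : ContMDiffOn 𝓘(ℝ, ℝ) 𝓘(ℝ, E) 1 γ B) (hs : s ∈ B) :
    HasVelocityWithinAt γ (velocityWithin (E := E) γ B s) B s :=
  hasVelocityWithinAt_velocityWithin ((hγ s hs).mdifferentiableWithinAt (by simp))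

variable {h : IsStationary g K S} {L : M → E → ℝ}

theorem IsStationary.IsSpeed.zero (hL : h.IsSpeed L) (x : M) : L x 0 = 0 := by
  have := hL.smul x 0 0 le_rfl
  rwa [smul_zero, zero_mul] at this

/-- A `C¹` curve in `S` can be reparametrized so that it is constant near its end points. -/
theorem IsStationary.IsSpeed.sReach (hL : h.IsSpeed L) {γ : ℝ → M} {B : Set ℝ} {a b r : ℝ}
    (hB : UniqueDiffOn ℝ B) (hγ : ContMDiffOn 𝓘(ℝ, ℝ) 𝓘(ℝ, E) 1 γ B) (hab : a ≤ b)
    (hsub : Icc a b ⊆ B) (hS : ∀ s ∈ Icc a b, γ s ∈ S)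
    (hr : ∫ s in a..b, L (γ s) (velocityWithin γ B s) < r) : SReach S L (γ a) (γ b) r := by
  -- The argument 3s - 1 makes θ constant on s ≤ 1/3 and on s ≥ 2/3. As θ is nondecreasing, positive
  -- homogeneity of `L` suffices for the length to be unchanged.
  set θ : ℝ → ℝ := fun s ↦ a + (b - a) * Real.smoothTransition (3 * s - 1) with hθ
  have hθc : ContDiff ℝ 1 θ := by
    have h1 : ContDiff ℝ 1 Real.smoothTransition := Real.smoothTransition.contDiff (n := 1)
    exact contDiff_const.add (contDiff_const.mul
      (h1.comp ((contDiff_const.mul contDiff_id).sub contDiff_const)))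
  have hθm : Monotone θ := by
    intro s t hst
    have := Real.smoothTransition.monotone (show 3 * s - 1 ≤ 3 * t - 1 by linarith)
    have := mul_le_mul_of_nonneg_left this (sub_nonneg.2 hab)
    simp only [hθ]; linarith
  have hθd : ∀ s, HasDerivAt θ (deriv θ s) s := fun s ↦
    (hθc.differentiable (by simp) s).hasDerivAt
  have hθ' : ∀ s, 0 ≤ deriv θ s := fun s ↦ hθm.deriv_nonneg
  have hθ0 : ∀ s ≤ 1 / 3, θ s = a := fun s hs ↦ by
    simp only [hθ]; rw [Real.smoothTransition.zero_of_nonpos (by linarith)]; ring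
  have hθ1 : ∀ s ≥ 2 / 3, θ s = b := fun s hs ↦ by
    simp only [hθ]; rw [Real.smoothTransition.one_of_one_le (by linarith)]; ring
  have hmem : ∀ s, θ s ∈ Icc a b := fun s ↦ by
    have h0 := Real.smoothTransition.nonneg (3 * s - 1)
    have h1 := Real.smoothTransition.le_one (3 * s - 1)
    have h2 := mul_nonneg (sub_nonneg.2 hab) h0
    have h3 := mul_le_of_le_one_right (sub_nonneg.2 hab) h1
    constructor <;> simp only [hθ] <;> linarith
  have hc : ContMDiff 𝓘(ℝ, ℝ) 𝓘(ℝ, E) 1 (γ ∘ θ) := by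
    rw [← contMDiffOn_univ]
    exact hγ.comp hθc.contMDiff.contMDiffOn fun s _ ↦ hsub (hmem s)
  have hvel : ∀ s, velocityWithin (γ ∘ θ) univ s =
      deriv θ s • velocityWithin (E := E) γ B (θ s) := fun s ↦
    ((hasVelocityWithinAt_of_contMDiffOn hγ (hsub (hmem s))).scomp (hθd s).hasDerivWithinAt
      fun t _ ↦ hsub (hmem t)).velocityWithin_eq uniqueDiffWithinAt_univ
  refine ⟨γ ∘ θ, hc, fun s ↦ hS _ (hmem s), fun s hs ↦ congrArg γ (hθ0 s hs),
    fun s hs ↦ congrArg γ (hθ1 s hs), ?_⟩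
  have h1 : ∀ s, L ((γ ∘ θ) s) (velocityWithin (γ ∘ θ) univ s) =
      ((fun t ↦ L (γ t) (velocityWithin γ B t)) ∘ θ) s * deriv θ s := fun s ↦ by
    rw [hvel, hL.smul _ _ _ (hθ' s), mul_comm]; rfl
  simp only [h1]
  rw [intervalIntegral.integral_comp_mul_deriv'' hθc.continuous.continuousOn
    (fun s _ ↦ (hθd s).hasDerivWithinAt) (hθc.continuous_deriv (by simp)).continuousOn, hθ0 0 (by norm_num),
    hθ1 1 (by norm_num)]
  · exact hr
  · refine (hL.continuous.comp_velocityWithin hγ hB).mono ?_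
    rintro _ ⟨s, -, rfl⟩
    exact hsub (hmem s)

theorem IsStationary.IsSpeed.continuous_length (hL : h.IsSpeed L) {γ : ℝ → M}
    (hγ : ContMDiff 𝓘(ℝ, ℝ) 𝓘(ℝ, E) 1 γ) :
    Continuous fun s ↦ L (γ s) (velocityWithin γ univ s) :=
  continuousOn_univ.1 (hL.continuous.comp_velocityWithin hγ.contMDiffOn uniqueDiffOn_univ)

/-- The curve is cut where its length is divided in the ratio a : b. Since the total length is
strictly less than a + b, both pieces are strictly shorter than required. -/
theorem IsStationary.IsSpeed.split (hL : h.IsSpeed L) {x y : M} {a b : ℝ} (ha : 0 < a) (hb : 0 < b)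
    (hxy : SReach S L x y (a + b)) : ∃ z, SReach S L x z a ∧ SReach S L z y b := by
  obtain ⟨γ, hγ, hS, h0, h1, hlen⟩ := hxy
  have hcont := hL.continuous_length hγ
  set ℓ : ℝ → ℝ := fun s ↦ L (γ s) (velocityWithin γ univ s)
  have hint : ∀ s t, IntervalIntegrable ℓ volume s t := fun s t ↦ hcont.intervalIntegrable s t
  set I := ∫ s in (0 : ℝ)..1, ℓ s with hI
  have hI0 : 0 ≤ I := intervalIntegral.integral_nonneg zero_le_one fun s _ ↦ hL.nonneg _ _
  have hFc : ContinuousOn (fun t ↦ ∫ s in (0 : ℝ)..t, ℓ s) (Icc 0 1) :=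
    (intervalIntegral.continuous_primitive hint 0).continuousOn
  have hmem : I * (a / (a + b)) ∈ Icc (∫ s in (0 : ℝ)..0, ℓ s) (∫ s in (0 : ℝ)..1, ℓ s) := by
    rw [intervalIntegral.integral_same]
    refine ⟨by positivity, mul_le_of_le_one_right hI0 ?_⟩
    rw [div_le_one (by positivity)]; linarith
  obtain ⟨t, ht, htI⟩ := intermediate_value_Icc zero_le_one hFc hmem
  have hadd := intervalIntegral.integral_add_adjacent_intervals (hint 0 t) (hint t 1)
  simp only at htI
  have hab : I * (a / (a + b)) = I / (a + b) * a := by ring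
  have hab' : I = I / (a + b) * a + I / (a + b) * b := by field_simp
  have hlt : I / (a + b) < 1 := (div_lt_one (by positivity)).2 hlen
  have hx : γ 0 = x := h0 0 (by norm_num)
  have hy : γ 1 = y := h1 1 (by norm_num)
  refine ⟨γ t, ?_, ?_⟩
  · rw [← hx]
    refine hL.sReach uniqueDiffOn_univ hγ.contMDiffOn ht.1 (subset_univ _) (fun s _ ↦ hS s) ?_
    change ∫ s in (0 : ℝ)..t, ℓ s < a
    rw [htI, hab]
    nlinarith
  · rw [← hy]
    refine hL.sReach uniqueDiffOn_univ hγ.contMDiffOn ht.2 (subset_univ _) (fun s _ ↦ hS s) ?_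
    change ∫ s in t..(1 : ℝ), ℓ s < b
    have : ∫ s in t..(1 : ℝ), ℓ s = I / (a + b) * b := by linarith
    rw [this]
    nlinarith

/-- The concatenation of infinitely many curves. -/
def concat (γ : ℕ → ℝ → M) (s : ℝ) : M := γ ⌊s⌋₊ (s - ⌊s⌋₊)

section Concat

variable {γ : ℕ → ℝ → M} {y : ℕ → M} (h0 : ∀ n, ∀ s ≤ 1 / 3, γ n s = y n)
  (h1 : ∀ n, ∀ s ≥ 2 / 3, γ n s = y (n + 1))

include h0 h1

/-- Consecutive curves are constant and equal near the junctions, so each formula remains valid up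
to 1/3 beyond its unit interval. This overlap makes the concatenation C¹. For n = 0 there is no
lower restriction, since `⌊s⌋₊` is 0 for negative s. -/
theorem concat_eq (n : ℕ) {s : ℝ} (hs : n = 0 ∨ n - 1 / 3 < s) (hs' : s < n + 4 / 3) :
    concat γ s = γ n (s - n) := by
  rcases lt_or_ge s n with hlt | hge
  · rcases Nat.eq_zero_or_pos n with rfl | hn
    · have : ⌊s⌋₊ = 0 := Nat.floor_of_nonpos (by exact_mod_cast hlt.le)
      rw [concat, this]
    · have hs2 : (n : ℝ) - 1 / 3 < s := hs.resolve_left hn.ne'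
      obtain ⟨m, rfl⟩ : ∃ m, n = m + 1 := ⟨n - 1, by omega⟩
      push_cast at hs2 hlt ⊢
      have : ⌊s⌋₊ = m := by
        rw [Nat.floor_eq_iff (by linarith [m.cast_nonneg (α := ℝ)])]
        exact ⟨by linarith, hlt⟩
      rw [concat, this, h1 m _ (by linarith), h0 (m + 1) _ (by linarith)]
  · rcases lt_or_ge s (n + 1) with hlt | hge'
    · have : ⌊s⌋₊ = n := by
        rw [Nat.floor_eq_iff (by linarith [n.cast_nonneg (α := ℝ)])]
        exact ⟨hge, hlt⟩
      rw [concat, this]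
    · have : ⌊s⌋₊ = n + 1 := by
        rw [Nat.floor_eq_iff (by linarith [n.cast_nonneg (α := ℝ)])]
        push_cast
        exact ⟨hge', by linarith⟩
      rw [concat, this, h0 (n + 1) _ (by push_cast; linarith), h1 n _ (by linarith)]

theorem concat_nat (n : ℕ) : concat γ n = y n := by
  rw [concat_eq h0 h1 n (Or.inr (by linarith)) (by linarith), sub_self, h0 n 0 (by norm_num)]

theorem concat_eventuallyEq (n : ℕ) {s : ℝ} (hs : n = 0 ∨ n - 1 / 3 < s) (hs' : s < n + 4 / 3) :
    concat γ =ᶠ[𝓝 s] fun t ↦ γ n (t - n) := by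
  rcases hs with hs | hs
  · filter_upwards [Iio_mem_nhds hs'] with t ht using concat_eq h0 h1 n (Or.inl hs) ht
  · filter_upwards [Iio_mem_nhds hs', Ioi_mem_nhds hs] with t ht ht'
      using concat_eq h0 h1 n (Or.inr ht') ht

theorem contMDiff_concat (hγ : ∀ n, ContMDiff 𝓘(ℝ, ℝ) 𝓘(ℝ, E) 1 (γ n)) :
    ContMDiff 𝓘(ℝ, ℝ) 𝓘(ℝ, E) 1 (concat γ) := by
  intro s
  have h2 : ⌊s⌋₊ = 0 ∨ (⌊s⌋₊ : ℝ) - 1 / 3 < s := by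
    rcases lt_or_ge s 0 with hs | hs
    · exact Or.inl (Nat.floor_of_nonpos hs.le)
    · exact Or.inr (by linarith [Nat.floor_le hs])
  refine ContMDiffAt.congr_of_eventuallyEq ?_
    (concat_eventuallyEq h0 h1 ⌊s⌋₊ h2 (by linarith [Nat.lt_floor_add_one s]))
  exact (hγ _).contMDiffAt.comp s (contDiff_id.sub contDiff_const).contMDiff.contMDiffAt

theorem velocityWithin_concat (hγ : ∀ n, ContMDiff 𝓘(ℝ, ℝ) 𝓘(ℝ, E) 1 (γ n)) (n : ℕ) {s : ℝ}
    (hs : s ∈ Icc (n : ℝ) (n + 1)) :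
    velocityWithin (E := E) (concat γ) univ s = velocityWithin (γ n) univ (s - n) := by
  have h2 := hasVelocityWithinAt_of_contMDiffOn (E := E) (hγ n).contMDiffOn (mem_univ (s - n))
  have h3 := h2.scomp (A := univ) (θ := fun t ↦ t - n)
    ((hasDerivAt_id s).sub_const (n : ℝ)).hasDerivWithinAt (fun _ _ ↦ mem_univ _)
  rw [one_smul] at h3
  have hev := concat_eventuallyEq h0 h1 n (s := s) (Or.inr (by linarith [hs.1]))
    (by linarith [hs.2])
  have h4 := h3.congr_of_eventuallyEq (γ' := concat γ) (by rw [nhdsWithin_univ]; exact hev)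
    hev.eq_of_nhds
  exact h4.velocityWithin_eq uniqueDiffWithinAt_univ

theorem IsStationary.IsSpeed.integral_concat (hL : h.IsSpeed L)
    (hγ : ∀ n, ContMDiff 𝓘(ℝ, ℝ) 𝓘(ℝ, E) 1 (γ n)) (n : ℕ) :
    ∫ s in (0 : ℝ)..n, L (concat γ s) (velocityWithin (concat γ) univ s) =
      ∑ k ∈ Finset.range n, ∫ s in (0 : ℝ)..1, L (γ k s) (velocityWithin (γ k) univ s) := by
  have hcont := hL.continuous_length (contMDiff_concat h0 h1 hγ)
  have h2 := intervalIntegral.sum_integral_adjacent_intervals (μ := volume)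
    (f := fun s ↦ L (concat γ s) (velocityWithin (concat γ) univ s)) (a := fun k : ℕ ↦ (k : ℝ))
    (n := n) (fun k _ ↦ hcont.intervalIntegrable _ _)
  rw [Nat.cast_zero] at h2
  rw [← h2]
  refine Finset.sum_congr rfl fun k _ ↦ ?_
  have h3 := intervalIntegral.integral_comp_sub_right (a := (k : ℝ)) (b := ((k + 1 : ℕ) : ℝ))
    (fun s ↦ L (γ k s) (velocityWithin (γ k) univ s)) (k : ℝ)
  rw [sub_self, Nat.cast_add, Nat.cast_one, add_sub_cancel_left] at h3
  rw [← h3, Nat.cast_add, Nat.cast_one]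
  refine intervalIntegral.integral_congr fun s hs ↦ ?_
  rw [uIcc_of_le (by linarith)] at hs
  rw [velocityWithin_concat h0 h1 hγ k hs, concat_eq h0 h1 k (Or.inr (by linarith [hs.1]))
    (by linarith [hs.2])]

end Concat

theorem IsStationary.IsSpeed.trans (hL : h.IsSpeed L) {x y z : M} {r r' : ℝ}
    (hxy : SReach S L x y r) (hyz : SReach S L y z r') : SReach S L x z (r + r') := by
  obtain ⟨γ₁, hγ₁, hS₁, a₁, b₁, hl₁⟩ := hxy
  obtain ⟨γ₂, hγ₂, hS₂, a₂, b₂, hl₂⟩ := hyz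
  have hz : z ∈ S := b₂ 1 (by norm_num) ▸ hS₂ 1
  -- The two curves are continued by constant ones, so that the infinite concatenation can be used
  -- and cut at time 2.
  set γ : ℕ → ℝ → M := fun n ↦ match n with
    | 0 => γ₁
    | 1 => γ₂
    | _ => fun _ ↦ z
  set u : ℕ → M := fun n ↦ match n with
    | 0 => x
    | 1 => y
    | _ => z
  have h0 : ∀ n, ∀ s ≤ 1 / 3, γ n s = u n := by
    intro n
    match n with
    | 0 => exact a₁
    | 1 => exact a₂
    | n + 2 => exact fun _ _ ↦ rfl
  have h1 : ∀ n, ∀ s ≥ 2 / 3, γ n s = u (n + 1) := by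
    intro n
    match n with
    | 0 => exact b₁
    | 1 => exact b₂
    | n + 2 => exact fun _ _ ↦ rfl
  have hγ : ∀ n, ContMDiff 𝓘(ℝ, ℝ) 𝓘(ℝ, E) 1 (γ n) := by
    intro n
    match n with
    | 0 => exact hγ₁
    | 1 => exact hγ₂
    | n + 2 => exact contMDiff_const
  have hS : ∀ n s, γ n s ∈ S := by
    intro n
    match n with
    | 0 => exact hS₁
    | 1 => exact hS₂
    | n + 2 => exact fun _ ↦ hz
  have hint := hL.integral_concat h0 h1 hγ 2
  rw [Finset.sum_range_succ, Finset.sum_range_one] at hint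
  have e0 := concat_nat h0 h1 0
  have e2 := concat_nat h0 h1 2
  have := hL.sReach (γ := concat γ) (a := ((0 : ℕ) : ℝ)) (b := ((2 : ℕ) : ℝ)) (r := r + r')
    uniqueDiffOn_univ (contMDiff_concat h0 h1 hγ).contMDiffOn (by norm_num) (subset_univ _)
    (fun s _ ↦ hS _ _) (by rw [Nat.cast_zero, hint]; exact add_lt_add hl₁ hl₂)
  rwa [e0, e2] at this

end Reach

/-! ### Speeds on the hypersurface define length structures -/

section LengthRelation

variable {E : Type*} [NormedAddCommGroup E] [NormedSpace ℝ E]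
  {M : Type*} [TopologicalSpace M] [ChartedSpace E M] [IsManifold 𝓘(ℝ, E) ∞ M]
  [T2Space M] [FiniteDimensional ℝ E] [CompleteSpace E]
  {g : LorentzMetric E M} {K : VField E M} {S : Set M} {h : IsStationary g K S} {L : M → E → ℝ}

theorem IsStationary.isClosed (h : IsStationary g K S) : IsClosed S := by
  have : S = h.time ⁻¹' {0} := Set.ext fun x ↦ h.time_eq_zero_iff.symm
  rw [this]
  exact isClosed_singleton.preimage h.contMDiff_time.continuous

theorem IsStationary.modelDiff_time_velocity (h : IsStationary g K S) {γ : ℝ → M} {v : E} {A : Set ℝ} {s : ℝ}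
    (hγ : HasVelocityWithinAt γ v A s) (hs : s ∈ A) (hA : UniqueDiffWithinAt ℝ A s)
    (hS : ∀ t ∈ A, γ t ∈ S) : modelDiff h.time (γ s) v = 0 := by
  have h1 := hγ.hasDerivWithinAt (h.mdifferentiableAt_time _)
  have h2 : HasDerivWithinAt (h.time ∘ γ) 0 A s :=
    (hasDerivWithinAt_const s A (0 : ℝ)).congr (fun t ht ↦ h.time_eq_zero_iff.2 (hS t ht))
      (h.time_eq_zero_iff.2 (hS s hs))
  exact hA.eq_deriv _ h1 h2

/-- Over a compact set, a speed controls every continuous homogeneous function on the horizontal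
vectors. -/
theorem IsStationary.IsSpeed.exists_le_mul (hL : h.IsSpeed L) {Q : M → E → ℝ}
    (hQ : ContinuousOnTangent Q) (hh : ∀ x v (t : ℝ), 0 ≤ t → Q x (t • v) = t * Q x v)
    {N : Set M} (hN : IsCompact N) :
    ∃ C > 0, ∀ x ∈ N, ∀ v, modelDiff h.time x v = 0 → Q x v ≤ C * L x v := by
  have hT : ContinuousOnTangent fun x (v : E) ↦ |modelDiff h.time x v| :=
    Continuous.abs (continuousOnTangent_modelDiff h.contMDiff_time)
  -- A speed is positive only on nonzero horizontal vectors; the added |dT| makes the density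
  -- positive on all nonzero vectors and vanishes on the horizontal ones.
  obtain ⟨C, hC, hCN⟩ := exists_le_mul_of_homogeneous (Q₁ := Q)
    (Q₂ := fun x v ↦ L x v + |modelDiff h.time x v|) hQ
    (Continuous.add hL.continuous hT) hh (fun x v t ht ↦ by
      rw [hL.smul x v t ht, map_smul, smul_eq_mul, abs_mul, abs_of_nonneg ht]; ring)
    (fun x v hv ↦ by
      rcases eq_or_ne (modelDiff h.time x v) 0 with h0 | h0
      · have := hL.pos x v h0 hv
        positivity
      · have := hL.nonneg x v
        have := abs_pos.2 h0
        positivity) hN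
  refine ⟨C, hC, fun x hx v hv ↦ ?_⟩
  have := hCN x hx v
  rwa [hv, abs_zero, add_zero] at this

/-- A bump function f at x satisfies |df| ≤ C L on horizontal vectors, everywhere because df = 0 off
its compact support. A curve from x of length less than 1/C cannot lower f from 1 to 0, so it ends
in the support. -/
theorem IsStationary.IsSpeed.exists_isCompact_of_sReach (hL : h.IsSpeed L) (x : M) :
    ∃ ε > 0, ∃ N, IsCompact N ∧ ∀ y, SReach S L x y ε → y ∈ N := by
  obtain ⟨f⟩ : Nonempty (SmoothBumpFunction 𝓘(ℝ, E) x) := inferInstance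
  have hf : ContMDiff 𝓘(ℝ, E) 𝓘(ℝ, ℝ) 1 f := f.contMDiff.of_le one_le_infty
  have hQ : ContinuousOnTangent fun x (v : E) ↦ |modelDiff f x v| :=
    Continuous.abs (continuousOnTangent_modelDiff hf)
  obtain ⟨C, hC, hCN⟩ := hL.exists_le_mul hQ (fun x v t ht ↦ by
    rw [map_smul, smul_eq_mul, abs_mul, abs_of_nonneg ht]) f.hasCompactSupport
  have hall : ∀ y v, modelDiff h.time y v = 0 → |modelDiff f y v| ≤ C * L y v := by
    intro y v hv
    by_cases hy : y ∈ tsupport f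
    · exact hCN y hy v hv
    · have h0 : (f : M → ℝ) =ᶠ[𝓝 y] fun _ ↦ (0 : ℝ) := notMem_tsupport_iff_eventuallyEq.1 hy
      have h1 : modelDiff f y = (0 : E →L[ℝ] ℝ) := by
        have := h0.mfderiv_eq (I := 𝓘(ℝ, E)) (I' := 𝓘(ℝ, ℝ))
        rw [modelDiff, this, mfderiv_const]
        rfl
      rw [h1]
      simpa using mul_nonneg hC.le (hL.nonneg y v)
  refine ⟨1 / C, by positivity, tsupport f, f.hasCompactSupport, ?_⟩
  rintro y ⟨γ, hγ, hS, h0, h1, hlen⟩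
  have hv : ∀ s, HasVelocityWithinAt γ (velocityWithin (E := E) γ univ s) univ s := fun s ↦
    hasVelocityWithinAt_of_contMDiffOn hγ.contMDiffOn (mem_univ s)
  have hd : ∀ s, HasDerivAt (f ∘ γ) (modelDiff f (γ s) (velocityWithin (E := E) γ univ s)) s := by
    intro s
    have := (hv s).hasDerivWithinAt (hf.mdifferentiable (by simp) (γ s))
    rwa [hasDerivWithinAt_univ] at this
  have hc1 : Continuous fun s ↦ modelDiff f (γ s) (velocityWithin (E := E) γ univ s) :=
    continuousOn_univ.1 ((continuousOnTangent_modelDiff hf).comp_velocityWithin hγ.contMDiffOn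
      uniqueDiffOn_univ)
  have hc2 := hL.continuous_length hγ
  have hint := intervalIntegral.integral_eq_sub_of_hasDerivAt (a := 0) (b := 1)
    (fun s _ ↦ hd s) (hc1.intervalIntegrable _ _)
  have hle : ∫ s in (0 : ℝ)..1, -(C * L (γ s) (velocityWithin γ univ s)) ≤
      ∫ s in (0 : ℝ)..1, modelDiff f (γ s) (velocityWithin (E := E) γ univ s) := by
    refine intervalIntegral.integral_mono_on zero_le_one ?_ (hc1.intervalIntegrable _ _) ?_
    · exact (continuous_const.mul hc2).neg.intervalIntegrable _ _
    · intro s _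
      have := hall (γ s) (velocityWithin γ univ s) (h.modelDiff_time_velocity (hv s) (mem_univ s)
        uniqueDiffWithinAt_univ fun t _ ↦ hS t)
      exact neg_le_of_abs_le this
  rw [hint, intervalIntegral.integral_neg, intervalIntegral.integral_const_mul] at hle
  have hx : γ 0 = x := h0 0 (by norm_num)
  have hy : γ 1 = y := h1 1 (by norm_num)
  simp only [Function.comp_apply, hx, hy, f.eq_one] at hle
  have hlt : C * ∫ s in (0 : ℝ)..1, L (γ s) (velocityWithin γ univ s) < 1 := by
    have := mul_lt_mul_of_pos_left hlen hC
    rwa [mul_one_div_cancel hC.ne'] at this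
  refine subset_tsupport _ ?_
  rw [Function.mem_support]
  linarith

/-- Chart segments, projected onto `S`, join nearby points in either direction. Their length is
small because `L` composed with the differential of the projection is continuous and vanishes on the
zero vector. -/
theorem IsStationary.IsSpeed.eventually_sReach (hL : h.IsSpeed L) {x : M} (hx : x ∈ S) {η : ℝ}
    (hη : 0 < η) : ∀ᶠ y in 𝓝 x, y ∈ S → SReach S L x y η ∧ SReach S L y x η := by
  set φ := extChartAt 𝓘(ℝ, E) x
  have hφx : φ x ∈ φ.target := mem_extChartAt_target x
  have hto : IsOpen φ.target := isOpen_extChartAt_target (I := 𝓘(ℝ, E)) x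
  set F : E × E → ℝ := fun p ↦ L (h.proj (φ.symm p.1))
    (modelDeriv h.proj (φ.symm p.1) (chartInv x p.1 p.2)) with hF
  have hFc : ContinuousOn F (φ.target ×ˢ univ) := by
    have h1 := (h.contMDiff_proj.continuous_tangentMap le_rfl).comp_continuousOn
      (continuousOn_chartInv (E := E) x)
    exact Continuous.comp_continuousOn hL.continuous h1
  have hF0 : F (φ x, 0) = 0 := by
    simp only [hF, map_zero]
    exact hL.zero _
  have hev : ∀ᶠ p in 𝓝 (φ x, (0 : E)), F p < η / 2 ∧ p.1 ∈ φ.target := by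
    have hmem : φ.target ×ˢ (univ : Set E) ∈ 𝓝 (φ x, (0 : E)) :=
      (hto.prod isOpen_univ).mem_nhds ⟨hφx, mem_univ _⟩
    have h1 := (hFc.continuousAt hmem).eventually (gt_mem_nhds (show F (φ x, 0) < η / 2 by
      rw [hF0]; linarith))
    filter_upwards [h1, hmem] with p hp hp' using ⟨hp, hp'.1⟩
  obtain ⟨δ, hδ, hball⟩ := Metric.eventually_nhds_iff_ball.1 hev
  have key : ∀ u₁ ∈ Metric.ball (φ x) (δ / 2), ∀ u₂ ∈ Metric.ball (φ x) (δ / 2),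
      SReach S L (h.proj (φ.symm u₁)) (h.proj (φ.symm u₂)) η := by
    intro u₁ hu₁ u₂ hu₂
    set w := u₂ - u₁ with hw
    have hwn : ‖w‖ < δ := by
      rw [hw, ← dist_eq_norm]
      rw [Metric.mem_ball] at hu₁ hu₂
      linarith [dist_triangle_right u₂ u₁ (φ x)]
    set c : ℝ → E := fun s ↦ u₁ + s • w with hc
    have hcball : ∀ s ∈ Icc (0 : ℝ) 1, (c s, w) ∈ Metric.ball (φ x, (0 : E)) δ := by
      intro s hs
      have h1 : c s ∈ Metric.ball (φ x) (δ / 2) :=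
        (convex_ball (φ x) (δ / 2)).add_smul_sub_mem hu₁ hu₂ hs
      rw [Metric.mem_ball, Prod.dist_eq, max_lt_iff]
      exact ⟨(Metric.mem_ball.1 h1).trans (by linarith), by simpa using hwn⟩
    have hct : ∀ s ∈ Icc (0 : ℝ) 1, c s ∈ φ.target := fun s hs ↦ (hball _ (hcball s hs)).2
    have hcd : ∀ s, HasDerivAt c w s := fun s ↦ by
      have := ((hasDerivAt_id s).smul_const w).const_add u₁
      rw [one_smul] at this
      exact this
    have hcc : ContDiff ℝ 1 c := contDiff_const.add (contDiff_id.smul contDiff_const)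
    set γ : ℝ → M := fun s ↦ h.proj (φ.symm (c s)) with hγdef
    have hγ : ContMDiffOn 𝓘(ℝ, ℝ) 𝓘(ℝ, E) 1 γ (Icc 0 1) :=
      h.contMDiff_proj.comp_contMDiffOn ((contMDiffOn_extChartAt_symm x).comp
        hcc.contMDiff.contMDiffOn hct)
    have hvel : ∀ s ∈ Icc (0 : ℝ) 1, velocityWithin γ (Icc 0 1) s =
        modelDeriv h.proj (φ.symm (c s)) (chartInv x (c s) w) := by
      intro s hs
      have h1 : HasVelocityWithinAt (fun s ↦ φ.symm (c s)) (chartInv x (c s) w) (Icc 0 1) s := by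
        have h2 := (hasMFDerivAt_extChartAt_symm_comp (hcd s) (hct s hs)).hasMFDerivWithinAt
          (s := Icc 0 1)
        refine h2.congr_mfderiv (ContinuousLinearMap.ext_ring (M₁ := E) ?_)
        rfl
      exact (h1.map (h.contMDiff_proj.mdifferentiable (by simp) _)).velocityWithin_eq
        (uniqueDiffOn_Icc zero_lt_one s hs)
    have h0 : γ 0 = h.proj (φ.symm u₁) := by simp [hγdef, hc]
    have h1 : γ 1 = h.proj (φ.symm u₂) := by simp [hγdef, hc, hw]
    rw [← h0, ← h1]
    refine hL.sReach (uniqueDiffOn_Icc zero_lt_one) hγ zero_le_one subset_rfl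
      (fun s _ ↦ h.proj_mem _) ?_
    have hle : ∫ s in (0 : ℝ)..1, L (γ s) (velocityWithin γ (Icc 0 1) s) ≤
        ∫ s in (0 : ℝ)..1, η / 2 := by
      refine intervalIntegral.integral_mono_on zero_le_one ?_ (by simp) fun s hs ↦ ?_
      · have h2 := hL.continuous.comp_velocityWithin hγ (uniqueDiffOn_Icc zero_lt_one)
        rw [← uIcc_of_le zero_le_one] at h2 ⊢
        exact h2.intervalIntegrable
      · rw [hvel s hs]
        exact (hball _ (hcball s hs)).1.le
    refine hle.trans_lt ?_
    simp
    linarith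
  have hcx : ContinuousAt φ x := continuousAt_extChartAt x
  filter_upwards [hcx (Metric.ball_mem_nhds (φ x) (half_pos hδ)),
    extChartAt_source_mem_nhds (I := 𝓘(ℝ, E)) x] with y hy hys hyS
  have e1 : h.proj (φ.symm (φ x)) = x := by
    rw [φ.left_inv (mem_extChartAt_source x), h.proj_of_mem hx]
  have e2 : h.proj (φ.symm (φ y)) = y := by
    rw [φ.left_inv hys, h.proj_of_mem hyS]
  have hxb := Metric.mem_ball_self (x := φ x) (half_pos hδ)
  have k1 := key _ hxb _ hy
  have k2 := key _ hy _ hxb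
  rw [e1, e2] at k1 k2
  exact ⟨k1, k2⟩

theorem IsStationary.IsSpeed.isLengthRelation (hL : h.IsSpeed L) :
    IsLengthRelation fun x y : S ↦ SReach S L x.1 y.1 where
  mono h1 h2 := h1.mono h2
  trans h1 h2 := hL.trans h1 h2
  split ha hb hxy := by
    obtain ⟨z, h1, h2⟩ := hL.split ha hb hxy
    exact ⟨⟨z, h1.right_mem⟩, h1, h2⟩
  exists_compact x := by
    obtain ⟨ε, hε, N, hN, h1⟩ := hL.exists_isCompact_of_sReach x.1
    exact ⟨ε, hε, _, h.isClosed.isClosedEmbedding_subtypeVal.isCompact_preimage hN,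
      fun y hy ↦ h1 y.1 hy⟩
  eventually x η hη := by
    have := continuous_subtype_val.continuousAt.eventually (hL.eventually_sReach x.2 hη)
    exact this.mono fun y hy ↦ hy y.2

theorem IsStationary.IsSpeed.exists_isCompact (hL : h.IsSpeed L)
    (hcomp : ∀ (y : ℕ → M) (r : ℕ → ℝ), Summable r → (∀ n, SReach S L (y n) (y (n + 1)) (r n)) →
      ∃ x ∈ S, ∀ η > 0, ∀ᶠ n in atTop, SReach S L x (y n) η) {x : M} (hx : x ∈ S) (r : ℝ) :
    ∃ N, IsCompact N ∧ ∀ y, SReach S L x y r → y ∈ N := by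
  obtain ⟨N, hN, h1⟩ := hL.isLengthRelation.exists_isCompact (fun y r hr hy ↦ by
    obtain ⟨x, hx, h2⟩ := hcomp (fun n ↦ (y n).1) r hr hy
    exact ⟨⟨x, hx⟩, h2⟩) ⟨x, hx⟩ r
  exact ⟨Subtype.val '' N, hN.image continuous_subtype_val, fun y hy ↦
    ⟨⟨y, hy.right_mem⟩, h1 _ hy, rfl⟩⟩

end LengthRelation

/-! ### The Riemannian speed and the cone speeds; limits from the Cauchy property -/

section Speeds

variable {E : Type*} [NormedAddCommGroup E] [NormedSpace ℝ E]
  {M : Type*} [TopologicalSpace M] [ChartedSpace E M] [IsManifold 𝓘(ℝ, E) ∞ M]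

/-- The norm of a spacelike vector. -/
def spaceSpeed (g : LorentzMetric E M) (x : M) (v : E) : ℝ := Real.sqrt (modelInner g x v v)

/-- The positive function `-⟨K, K⟩`. -/
def lapse (g : LorentzMetric E M) (K : VField E M) (x : M) : ℝ :=
  -modelInner g x (modelVec K x) (modelVec K x)

/-- The least `t` for which `v + ε t K` is causal, where `v` is a spacelike vector and
`ε = ± 1`. -/
def coneSpeed (g : LorentzMetric E M) (K : VField E M) (ε : ℝ) (x : M) (v : E) : ℝ :=
  (ε * modelInner g x v (modelVec K x) + Real.sqrt (modelInner g x v (modelVec K x) ^ 2 +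
    lapse g K x * max (modelInner g x v v) 0)) / lapse g K x

theorem hasDerivAt_neg_exp_neg (s : ℝ) :
    HasDerivAt (fun s ↦ -Real.exp (-s)) (Real.exp (-s)) s := by
  have := ((hasDerivAt_neg s).exp).fun_neg
  rwa [mul_neg_one, neg_neg] at this

variable [T2Space M] [FiniteDimensional ℝ E] [CompleteSpace E]
  {g : LorentzMetric E M} {K : VField E M} {S : Set M} (h : IsStationary g K S)

/-- A speed that is invariant under `v ↦ -v` induces a symmetric relation. -/
theorem SReach.symm {S : Set M} {L : M → E → ℝ}
    (heven : ∀ x v, L x (-v) = L x v) {x y : M} {r : ℝ} (hxy : SReach S L x y r) :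
    SReach S L y x r := by
  obtain ⟨γ, hγ, hS, h0, h1, hlen⟩ := hxy
  have hθ : ContDiff ℝ 1 fun s : ℝ ↦ 1 - s := contDiff_const.sub contDiff_id
  refine ⟨fun s ↦ γ (1 - s), hγ.comp hθ.contMDiff, fun s ↦ hS _, fun s hs ↦ h1 _ (by linarith),
    fun s hs ↦ h0 _ (by linarith), ?_⟩
  have hvel : ∀ s, velocityWithin (fun s ↦ γ (1 - s)) univ s =
      -velocityWithin (E := E) γ univ (1 - s) := by
    intro s
    have h2 := (hasVelocityWithinAt_of_contMDiffOn hγ.contMDiffOn (mem_univ (1 - s))).scomp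
      (A := univ) (((hasDerivAt_id s).const_sub 1).hasDerivWithinAt) fun _ _ ↦ mem_univ _
    rw [neg_one_smul] at h2
    exact h2.velocityWithin_eq uniqueDiffWithinAt_univ
  simp only [hvel, heven]
  rw [intervalIntegral.integral_comp_sub_left (fun s ↦ L (γ s) (velocityWithin γ univ s)) 1]
  simpa using hlen

include h

theorem IsStationary.lapse_pos (x : M) : 0 < lapse g K x := by
  have := h.modelInner_modelVec_neg x
  rw [lapse]; linarith

theorem IsStationary.continuous_lapse : Continuous (lapse g K) :=
  (continuous_modelInner_modelVec g h.smooth).neg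

/-- On vectors with negative square `Real.sqrt` takes the value 0, which keeps the density
continuous, homogeneous and nonnegative on the whole tangent bundle. Positivity is claimed only for
horizontal vectors. -/
theorem IsStationary.isSpeed_spaceSpeed : h.IsSpeed (spaceSpeed g) where
  continuous := Real.continuous_sqrt.comp (continuousOnTangent_modelInner_self g)
  smul x v t ht := by
    rw [spaceSpeed, map_smul, map_smul, smul_apply, smul_eq_mul, smul_eq_mul, ← mul_assoc,
      Real.sqrt_mul (mul_self_nonneg t), Real.sqrt_mul_self ht, spaceSpeed]
  nonneg x v := Real.sqrt_nonneg _
  pos x v hv hv0 := Real.sqrt_pos.2 (h.modelInner_pos hv hv0)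

/-- Nonnegativity and positivity rest on the square root dominating |⟨v, K⟩|; truncating ⟨v, v⟩ at 0
in the definition ensures this also for vectors that are not horizontal. -/
theorem IsStationary.isSpeed_coneSpeed {ε : ℝ} (hε : ε ^ 2 = 1) :
    h.IsSpeed (coneSpeed g K ε) where
  continuous := by
    have hc := continuousOnTangent_modelInner_modelVec g h.smooth
    have he := continuousOnTangent_modelInner_self g
    have hβ := continuousOnTangent_comp_proj (E := E) h.continuous_lapse
    exact Continuous.div (((continuous_const (y := ε)).mul hc).add
      (Real.continuous_sqrt.comp ((hc.pow 2).add (Continuous.mul hβ (he.max continuous_const)))))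
      hβ fun p ↦ (h.lapse_pos p.1).ne'
  smul x v t ht := by
    have e1 : modelInner g x (t • v) (modelVec K x) = t * modelInner g x v (modelVec K x) := by
      rw [map_smul, smul_apply, smul_eq_mul]
    have e2 : max (modelInner g x (t • v) (t • v)) 0 = t ^ 2 * max (modelInner g x v v) 0 := by
      rw [map_smul, map_smul, smul_apply, smul_eq_mul, smul_eq_mul, ← mul_assoc, ← pow_two,
        mul_max_of_nonneg _ _ (sq_nonneg t), mul_zero]
    have e3 : (t * modelInner g x v (modelVec K x)) ^ 2 +
        lapse g K x * (t ^ 2 * max (modelInner g x v v) 0) =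
        t ^ 2 * (modelInner g x v (modelVec K x) ^ 2 +
          lapse g K x * max (modelInner g x v v) 0) := by ring
    rw [coneSpeed, e1, e2, e3, Real.sqrt_mul (sq_nonneg t), Real.sqrt_sq ht, coneSpeed]
    ring
  nonneg x v := by
    have hβ := h.lapse_pos x
    refine div_nonneg ?_ hβ.le
    have h1 : |ε * modelInner g x v (modelVec K x)| ≤ Real.sqrt (modelInner g x v (modelVec K x) ^ 2
        + lapse g K x * max (modelInner g x v v) 0) := by
      refine Real.abs_le_sqrt ?_
      rw [mul_pow, hε, one_mul]
      have := mul_nonneg hβ.le (le_max_right (modelInner g x v v) 0)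
      linarith
    linarith [neg_le_of_abs_le h1]
  pos x v hv hv0 := by
    have hβ := h.lapse_pos x
    refine div_pos ?_ hβ
    have hpos := h.modelInner_pos hv hv0
    have h1 : |ε * modelInner g x v (modelVec K x)| < Real.sqrt (modelInner g x v (modelVec K x) ^ 2
        + lapse g K x * max (modelInner g x v v) 0) := by
      refine Real.lt_sqrt_of_sq_lt ?_
      rw [sq_abs, mul_pow, hε, one_mul, max_eq_left hpos.le]
      have := mul_pos hβ hpos
      linarith
    linarith [neg_lt_of_abs_lt h1]

theorem IsStationary.modelInner_nonneg {x : M} {v : E} (hv : modelDiff h.time x v = 0) :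
    0 ≤ modelInner g x v v := by
  rcases eq_or_ne v 0 with rfl | hv0
  · simp
  · exact (h.modelInner_pos hv hv0).le

/-- If `t` exceeds the cone speed of the horizontal vector `v` then `v + ε t K` is timelike. -/
theorem IsStationary.modelInner_neg_of_coneSpeed_lt {ε : ℝ} (hε : ε ^ 2 = 1) {x : M} {v : E}
    (hv : modelDiff h.time x v = 0) {t : ℝ} (ht : coneSpeed g K ε x v < t) :
    modelInner g x (v + (ε * t) • modelVec K x) (v + (ε * t) • modelVec K x) < 0 := by
  have hβ := h.lapse_pos x
  have he := h.modelInner_nonneg hv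
  set c := modelInner g x v (modelVec K x) with hc
  have hsymm : modelInner g x (modelVec K x) v = c := g.symm x _ _
  have hβ' : modelInner g x (modelVec K x) (modelVec K x) = -lapse g K x := by rw [lapse, neg_neg]
  set e := modelInner g x v v
  set β := lapse g K x
  have h1 : modelInner g x (v + (ε * t) • modelVec K x) (v + (ε * t) • modelVec K x) =
      e + 2 * ε * t * c - t ^ 2 * β := by
    simp only [map_add, map_smul, add_apply, smul_apply, smul_eq_mul, hsymm, hβ', ← hc]
    linear_combination (-t ^ 2 * β) * hε
  rw [coneSpeed, div_lt_iff₀ hβ, max_eq_left he] at ht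
  have h2 : Real.sqrt (c ^ 2 + β * e) < t * β - ε * c := by linarith
  have h3 := (Real.sqrt_lt' ((Real.sqrt_nonneg _).trans_lt h2)).1 h2
  have h4 : β * (e + 2 * ε * t * c - t ^ 2 * β) < 0 := by nlinarith
  rw [h1]
  exact neg_of_mul_neg_right h4 hβ.le

/-- Curves of finite cone length have limits: this is where the Cauchy property of `S` is used. -/
theorem IsStationary.exists_limit_coneSpeed {ε : ℝ} (hε : ε ^ 2 = 1) (y : ℕ → M) (r : ℕ → ℝ)
    (hr : Summable r) (hy : ∀ n, SReach S (coneSpeed g K ε) (y n) (y (n + 1)) (r n)) :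
    ∃ x ∈ S, ∀ η > 0, ∀ᶠ n in atTop, SReach S (coneSpeed g K ε) x (y n) η := by
  have hL := h.isSpeed_coneSpeed hε
  choose γ hγ hγS h0 h1 hlen using hy
  have hΓ := contMDiff_concat h0 h1 hγ
  set Γ := concat γ with hΓdef
  have hΓS : ∀ s, Γ s ∈ S := fun s ↦ hγS _ _
  set f : ℝ → ℝ := fun s ↦ coneSpeed g K ε (Γ s) (velocityWithin Γ univ s) with hf
  have hfc : Continuous f := hL.continuous_length hΓ
  have hf0 : ∀ s, 0 ≤ f s := fun s ↦ hL.nonneg _ _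
  have hr0 : ∀ n, 0 ≤ r n := fun n ↦
    (intervalIntegral.integral_nonneg zero_le_one fun s _ ↦ hL.nonneg _ _).trans (hlen n).le
  set R := ∑' n, r n with hR
  have hbound : ∀ s, 0 ≤ s → ∫ t in (0 : ℝ)..s, f t ≤ R := by
    intro s hs
    calc ∫ t in (0 : ℝ)..s, f t ≤ ∫ t in (0 : ℝ)..⌈s⌉₊, f t :=
          intervalIntegral.integral_mono_interval le_rfl hs (Nat.le_ceil s)
            (Eventually.of_forall hf0) (hfc.intervalIntegrable _ _)
      _ = ∑ k ∈ Finset.range ⌈s⌉₊, ∫ s in (0 : ℝ)..1,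
          coneSpeed g K ε (γ k s) (velocityWithin (γ k) univ s) :=
          hL.integral_concat h0 h1 hγ _
      _ ≤ ∑ k ∈ Finset.range ⌈s⌉₊, r k := Finset.sum_le_sum fun k _ ↦ (hlen k).le
      _ ≤ R := hr.sum_le_tsum _ fun k _ ↦ hr0 k
  have hR0 : 0 ≤ R := tsum_nonneg hr0
  -- Time profile of the lift. Its derivative exceeds the cone speed by exp(-s), so the lift is
  -- timelike. Subtracting the total bound R keeps it negative, so the lift never meets `S`. It
  -- tends to -∞ at the past end, which excludes a limit there.
  set τ : ℝ → ℝ := fun s ↦ (∫ t in (0 : ℝ)..s, f t) + -Real.exp (-s) - R with hτ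
  have hτd : ∀ s, HasDerivAt τ (f s + Real.exp (-s)) s := fun s ↦
    ((hfc.integral_hasStrictDerivAt 0 s).hasDerivAt.add (hasDerivAt_neg_exp_neg s)).sub_const R
  have hτneg : ∀ s, τ s < 0 := by
    intro s
    have he := Real.exp_pos (-s)
    rcases le_total 0 s with hs | hs
    · have := hbound s hs
      simp only [hτ]; linarith
    · have : ∫ t in (0 : ℝ)..s, f t ≤ 0 := by
        rw [intervalIntegral.integral_symm]
        have := intervalIntegral.integral_nonneg (μ := volume) hs fun t _ ↦ hf0 t
        linarith
      simp only [hτ]; linarith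
  have hτbot : Tendsto τ atBot atBot := by
    have h2 : Tendsto (fun s : ℝ ↦ -Real.exp (-s)) atBot atBot :=
      tendsto_neg_atTop_atBot.comp (Real.tendsto_exp_atTop.comp tendsto_neg_atBot_atTop)
    refine tendsto_atBot_mono' _ ?_ h2
    filter_upwards [eventually_le_atBot 0] with s hs
    have : ∫ t in (0 : ℝ)..s, f t ≤ 0 := by
      rw [intervalIntegral.integral_symm]
      have := intervalIntegral.integral_nonneg (μ := volume) hs fun t _ ↦ hf0 t
      linarith
    simp only [hτ]; linarith
  have hτc : ContDiff ℝ 1 τ := by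
    rw [contDiff_one_iff_deriv]
    refine ⟨fun s ↦ (hτd s).differentiableAt, ?_⟩
    have : deriv τ = fun s ↦ f s + Real.exp (-s) := funext fun s ↦ (hτd s).deriv
    rw [this]
    exact hfc.add (Real.continuous_exp.comp continuous_neg)
  set w : ℝ → M := fun s ↦ flow h.complete (ε * τ s) (Γ s) with hw
  have hTw : ∀ s, h.time (w s) = ε * τ s := fun s ↦ by
    rw [hw, h.time_flow, h.time_eq_zero_iff.2 (hΓS s), zero_add]
  have hwc : ContMDiff 𝓘(ℝ, ℝ) 𝓘(ℝ, E) 1 w :=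
    (contMDiff_flow h.complete h.smooth).comp
      ((contDiff_const.mul hτc).contMDiff.prodMk hΓ)
  have hε0 : ε ≠ 0 := by rintro rfl; norm_num at hε
  -- Without a limit at +∞ the lift would be inextendible, and it would have to cross `S`.
  have hlim : ∃ z, Tendsto w atTop (𝓝 z) := by
    by_contra hno
    have hinext : IsInextendibleTimelike g w := by
      refine ⟨hwc, fun s ↦ ?_, hno, ?_⟩
      · have hv := hasVelocityWithinAt_of_contMDiffOn hΓ.contMDiffOn (mem_univ s)
        have hv' := hv.flow h.complete h.smooth ((hτd s).const_mul ε).hasDerivWithinAt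
        have e1 := hv'.velocityWithin_eq uniqueDiffWithinAt_univ
        have e2 : velocityWithin (E := E) w univ s =
            mfderiv 𝓘(ℝ, ℝ) 𝓘(ℝ, E) w s (1 : ℝ) := by
          rw [velocityWithin, mfderivWithin_univ]
        have e3 := e2.symm.trans e1
        have h2 := h.modelInner_neg_of_coneSpeed_lt hε (h.modelDiff_time_velocity hv (mem_univ s)
          uniqueDiffWithinAt_univ fun t _ ↦ hΓS t)
          (show coneSpeed g K ε (Γ s) (velocityWithin Γ univ s) < f s + Real.exp (-s) by
            have := Real.exp_pos (-s)
            simp only [hf]; linarith)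
        rw [← h.modelInner_flow (ε * τ s), ← e3] at h2
        exact h2
      · rintro ⟨z, hz⟩
        have h2 := (h.contMDiff_time.continuous.tendsto z).comp hz
        have h3 : Tendsto (fun s ↦ ε * (h.time ∘ w) s) atBot (𝓝 (ε * h.time z)) :=
          h2.const_mul ε
        have h4 : (fun s ↦ ε * (h.time ∘ w) s) = τ := by
          funext s
          rw [Function.comp_apply, hTw, ← mul_assoc, ← pow_two, hε, one_mul]
        rw [h4] at h3
        exact not_tendsto_nhds_of_tendsto_atBot hτbot _ h3
    obtain ⟨s, hs, -⟩ := h.cauchy w hinext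
    have h2 := h.time_eq_zero_iff.2 hs
    rw [hTw] at h2
    rcases mul_eq_zero.1 h2 with h3 | h3
    · exact hε0 h3
    · exact (hτneg s).ne h3
  obtain ⟨z, hz⟩ := hlim
  have h2 : Tendsto Γ atTop (𝓝 (h.proj z)) := by
    have h3 := (h.contMDiff_proj.continuous.tendsto z).comp hz
    refine h3.congr fun s ↦ ?_
    simp only [Function.comp_apply, hw]
    rw [h.proj_flow, h.proj_of_mem (hΓS s)]
  have h3 : Tendsto y atTop (𝓝 (h.proj z)) := by
    refine (h2.comp tendsto_natCast_atTop_atTop).congr fun n ↦ ?_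
    exact concat_nat h0 h1 n
  refine ⟨h.proj z, h.proj_mem z, fun η hη ↦ ?_⟩
  filter_upwards [h3.eventually (hL.eventually_sReach (h.proj_mem z) hη)] with n hn
  refine (hn ?_).1
  rw [← concat_nat h0 h1 n]
  exact hΓS _

end Speeds

/-! ### Relative compactness of balls in the hypersurface -/

section Completeness

variable {E : Type*} [NormedAddCommGroup E] [NormedSpace ℝ E]
  {M : Type*} [TopologicalSpace M] [ChartedSpace E M] [IsManifold 𝓘(ℝ, E) ∞ M]

theorem lintegral_ofReal_Icc {f : ℝ → ℝ} (hf : ContinuousOn f (Icc 0 1)) (h0 : ∀ s, 0 ≤ f s) :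
    ∫⁻ s in Icc (0 : ℝ) 1, ENNReal.ofReal (f s) = ENNReal.ofReal (∫ s in (0 : ℝ)..1, f s) := by
  rw [intervalIntegral.integral_of_le zero_le_one, ← integral_Icc_eq_integral_Ioc,
    ofReal_integral_eq_lintegral_ofReal (hf.integrableOn_Icc) (Eventually.of_forall h0)]

variable [T2Space M] [FiniteDimensional ℝ E] [CompleteSpace E]
  {g : LorentzMetric E M} {K : VField E M} {S : Set M} (h : IsStationary g K S)

include h

theorem IsStationary.inducedEDist_lt {x y : M} {r : ℝ} (hxy : SReach S (spaceSpeed g) x y r) :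
    inducedEDist g S x y < ENNReal.ofReal r := by
  obtain ⟨γ, hγ, hS, h0, h1, hlen⟩ := hxy
  have hx : γ 0 = x := h0 0 (by norm_num)
  have hy : γ 1 = y := h1 1 (by norm_num)
  have hvel : ∀ s ∈ Icc (0 : ℝ) 1, velocityWithin (E := E) γ univ s =
      velocityWithin γ (Icc 0 1) s := fun s hs ↦
    (((hasVelocityWithinAt_of_contMDiffOn hγ.contMDiffOn (mem_univ s)).mono
      (subset_univ _)).velocityWithin_eq (uniqueDiffOn_Icc zero_lt_one s hs)).symm
  refine lt_of_le_of_lt (iInf₂_le γ ⟨hγ.contMDiffOn, fun s _ ↦ hS s, hx, hy⟩) ?_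
  have e : ∫⁻ s in Icc (0 : ℝ) 1, ENNReal.ofReal (Real.sqrt (g.inner (γ s)
      (velocity (E := E) γ s) (velocity (E := E) γ s))) =
      ∫⁻ s in Icc (0 : ℝ) 1, ENNReal.ofReal (spaceSpeed g (γ s) (velocityWithin γ univ s)) := by
    refine setLIntegral_congr_fun measurableSet_Icc fun s hs ↦ ?_
    simp only [hvel s hs]
    rfl
  rw [e, lintegral_ofReal_Icc (h.isSpeed_spaceSpeed.continuous_length hγ).continuousOn
    fun s ↦ h.isSpeed_spaceSpeed.nonneg _ _]
  refine (ENNReal.ofReal_lt_ofReal_iff_of_nonneg ?_).2 hlen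
  exact intervalIntegral.integral_nonneg zero_le_one fun s _ ↦ h.isSpeed_spaceSpeed.nonneg _ _

theorem IsStationary.sReach_of_inducedEDist_lt {x y : M} {r : ℝ}
    (hxy : inducedEDist g S x y < ENNReal.ofReal r) : SReach S (spaceSpeed g) x y r := by
  rw [inducedEDist, iInf_lt_iff] at hxy
  obtain ⟨γ, hγ⟩ := hxy
  rw [iInf_lt_iff] at hγ
  obtain ⟨⟨hγ, hS, rfl, rfl⟩, hlt⟩ := hγ
  refine h.isSpeed_spaceSpeed.sReach (uniqueDiffOn_Icc zero_lt_one) hγ zero_le_one subset_rfl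
    (fun s hs ↦ hS hs) ?_
  have e := lintegral_ofReal_Icc (h.isSpeed_spaceSpeed.continuous.comp_velocityWithin hγ
    (uniqueDiffOn_Icc zero_lt_one)) fun s ↦ h.isSpeed_spaceSpeed.nonneg _ _
  have hlt' : ENNReal.ofReal (∫ s in (0 : ℝ)..1, spaceSpeed g (γ s)
      (velocityWithin γ (Icc 0 1) s)) < ENNReal.ofReal r := by
    rw [← e]; exact hlt
  exact (ENNReal.ofReal_lt_ofReal_iff_of_nonneg (intervalIntegral.integral_nonneg zero_le_one
    fun s _ ↦ h.isSpeed_spaceSpeed.nonneg _ _)).1 hlt'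

/-- A chain with summable steps is Cauchy for the induced distance. Evenness of the Riemannian speed
supplies the estimates in both directions. -/
theorem IsStationary.exists_limit_spaceSpeed (hS : IsCompleteHypersurface g S) (y : ℕ → M)
    (r : ℕ → ℝ) (hr : Summable r)
    (hy : ∀ n, SReach S (spaceSpeed g) (y n) (y (n + 1)) (r n)) :
    ∃ x ∈ S, ∀ η > 0, ∀ᶠ n in atTop, SReach S (spaceSpeed g) x (y n) η := by
  have hL := h.isSpeed_spaceSpeed
  have heven : ∀ (x : M) (v : E), spaceSpeed g x (-v) = spaceSpeed g x v := fun x v ↦ by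
    simp [spaceSpeed]
  have hyS : ∀ n, y n ∈ S := fun n ↦ (hy n).left_mem
  have hself : ∀ n, ∀ η > 0, SReach S (spaceSpeed g) (y n) (y n) η := fun n η hη ↦
    ((hL.eventually_sReach (hyS n) hη).self_of_nhds (hyS n)).1
  have hle : ∀ η > 0, ∀ m n, m ≤ n → SReach S (spaceSpeed g) (y m) (y n)
      (∑ k ∈ Finset.range n, r k - ∑ k ∈ Finset.range m, r k + η) := by
    intro η hη m n hmn
    induction n, hmn using Nat.le_induction with
    -- The slack η is needed because reachability is a strict inequality, which fails for radius 0.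
    | base => rw [sub_self, zero_add]; exact hself m η hη
    | succ n hmn ih =>
      refine (hL.trans ih (hy n)).mono (le_of_eq ?_)
      rw [Finset.sum_range_succ]; ring
  have hcauchy : CauchySeq fun n ↦ ∑ k ∈ Finset.range n, r k := hr.hasSum.tendsto_sum_nat.cauchySeq
  have hall : ∀ η > 0, ∃ N, ∀ m ≥ N, ∀ n ≥ N, SReach S (spaceSpeed g) (y m) (y n) η := by
    intro η hη
    obtain ⟨N, hN⟩ := Metric.cauchySeq_iff.1 hcauchy (η / 2) (half_pos hη)
    have h1 : ∀ m ≥ N, ∀ n ≥ N, m ≤ n → SReach S (spaceSpeed g) (y m) (y n) η := by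
      intro m hm n hn hmn
      refine (hle (η / 2) (half_pos hη) m n hmn).mono ?_
      have := hN n hn m hm
      rw [Real.dist_eq] at this
      linarith [le_abs_self (∑ k ∈ Finset.range n, r k - ∑ k ∈ Finset.range m, r k)]
    refine ⟨N, fun m hm n hn ↦ ?_⟩
    rcases le_total m n with hmn | hmn
    · exact h1 m hm n hn hmn
    · exact SReach.symm heven (h1 n hn m hm hmn)
  obtain ⟨x, hx, hlim⟩ := hS y hyS fun ε hε ↦ by
    obtain ⟨η, hη, hηε⟩ := ENNReal.lt_iff_exists_nnreal_btwn.1 hε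
    obtain ⟨N, hN⟩ := hall η (by exact_mod_cast hη)
    refine ⟨N, fun m hm n hn ↦ (h.inducedEDist_lt (hN m hm n hn)).trans_le ?_⟩
    rw [ENNReal.ofReal_coe_nnreal]
    exact hηε.le
  refine ⟨x, hx, fun η hη ↦ ?_⟩
  filter_upwards [hlim.eventually (gt_mem_nhds (ENNReal.ofReal_pos.2 hη))] with n hn
  exact SReach.symm heven (h.sReach_of_inducedEDist_lt hn)

theorem IsStationary.exists_isCompact_spaceSpeed (hS : IsCompleteHypersurface g S) {x : M}
    (hx : x ∈ S) (r : ℝ) : ∃ N, IsCompact N ∧ ∀ y, SReach S (spaceSpeed g) x y r → y ∈ N :=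
  h.isSpeed_spaceSpeed.exists_isCompact (h.exists_limit_spaceSpeed hS) hx r

theorem IsStationary.exists_isCompact_coneSpeed {ε : ℝ} (hε : ε ^ 2 = 1) {x : M}
    (hx : x ∈ S) (r : ℝ) : ∃ N, IsCompact N ∧ ∀ y, SReach S (coneSpeed g K ε) x y r → y ∈ N :=
  (h.isSpeed_coneSpeed hε).exists_isCompact (h.exists_limit_coneSpeed hε) hx r

end Completeness

/-! ### A priori bounds for curves of bounded action -/

section Estimates

variable {E : Type*} [NormedAddCommGroup E] [NormedSpace ℝ E]
  {M : Type*} [TopologicalSpace M] [ChartedSpace E M] [IsManifold 𝓘(ℝ, E) ∞ M]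

/-- The quadratic form of the auxiliary Riemannian metric. -/
def riemForm (g : LorentzMetric E M) (K : VField E M) (x : M) (v : E) : ℝ :=
  modelInner g x v v + 2 * modelInner g x v (modelVec K x) ^ 2 / lapse g K x

theorem riemInner_self (g : LorentzMetric E M) (K : VField E M) (x : M)
    (v : TangentSpace 𝓘(ℝ, E) x) : riemInner g K x v v = riemForm g K x v := by
  have e : g.inner x (K x) (K x) = -lapse g K x := (neg_neg _).symm
  rw [riemInner, e, div_neg, sub_neg_eq_add, ← pow_two]
  rfl

theorem integrableOn_interval {f : ℝ → ℝ} (hf : ContinuousOn f (Icc 0 1)) {a b : ℝ}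
    (ha : a ∈ Icc (0 : ℝ) 1) (hb : b ∈ Icc (0 : ℝ) 1) : IntervalIntegrable f volume a b :=
  ContinuousOn.intervalIntegrable (hf.mono (uIcc_subset_Icc ha hb))

variable [T2Space M] [FiniteDimensional ℝ E] [CompleteSpace E]
  {g : LorentzMetric E M} {K : VField E M} {S : Set M} (h : IsStationary g K S)

include h

/-- Being constant along orbits, the lapse on a curve is controlled by its values on the projected
curve, before any bound on the time coordinate is known. -/
theorem IsStationary.lapse_flow (t : ℝ) (x : M) :
    lapse g K (flow h.complete t x) = lapse g K x := by
  rw [lapse, ← h.modelDeriv_flow_modelVec, h.modelInner_flow, lapse]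

theorem IsStationary.modelInner_horiz_modelVec (x : M) (v : E) :
    modelInner g x (h.horiz x v) (modelVec K x) =
      modelInner g x v (modelVec K x) + lapse g K x * modelDiff h.time x v := by
  simp only [IsStationary.horiz, map_sub, map_smul, sub_apply, smul_apply, smul_eq_mul, lapse]
  ring

theorem IsStationary.modelInner_horiz_self (x : M) (v : E) :
    modelInner g x (h.horiz x v) (h.horiz x v) = modelInner g x v v -
      2 * modelDiff h.time x v * modelInner g x v (modelVec K x) -
      lapse g K x * modelDiff h.time x v ^ 2 := by
  have hs : modelInner g x (modelVec K x) v = modelInner g x v (modelVec K x) := g.symm x _ _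
  simp only [IsStationary.horiz, map_sub, map_smul, sub_apply, smul_apply, smul_eq_mul, lapse, hs]
  ring

/-- With P and b the square and the `K`-product of the horizontal part, and c = ⟨v, K⟩, one has β⟨v,
v⟩_R = βP + b² + c². If the horizontal part is 0, then b = 0 and c = -βa, which is nonzero unless v
= 0. -/
theorem IsStationary.riemForm_pos {x : M} {v : E} (hv : v ≠ 0) : 0 < riemForm g K x v := by
  have hβ := h.lapse_pos x
  have h1 := h.modelInner_horiz_self x v
  have h2 := h.modelInner_horiz_modelVec x v
  have hP := h.modelInner_nonneg (h.modelDiff_time_horiz x v)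
  set a := modelDiff h.time x v with ha
  set c := modelInner g x v (modelVec K x)
  set β := lapse g K x
  set b := modelInner g x (h.horiz x v) (modelVec K x)
  have h3 : β * riemForm g K x v =
      β * modelInner g x (h.horiz x v) (h.horiz x v) + b ^ 2 + c ^ 2 := by
    have : riemForm g K x v = modelInner g x v v + 2 * c ^ 2 / β := rfl
    rw [this, h1, h2]
    field_simp
    ring
  refine pos_of_mul_pos_right (a := β) ?_ hβ.le
  rw [h3]
  rcases eq_or_ne (h.horiz x v) 0 with h0 | h0
  · have hb : b = 0 := by simp only [b, h0, map_zero, zero_apply]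
    have ha0 : a ≠ 0 := by
      intro ha0
      rw [IsStationary.horiz, ← ha, ha0, zero_smul, sub_zero] at h0
      exact hv h0
    have hc : c ≠ 0 := by
      intro hc
      rw [hb, hc, zero_add] at h2
      exact mul_ne_zero hβ.ne' ha0 h2.symm
    have := mul_nonneg hβ.le hP
    positivity
  · have := mul_pos hβ (h.modelInner_pos (h.modelDiff_time_horiz x v) h0)
    positivity

theorem IsStationary.riemForm_nonneg (x : M) (v : E) : 0 ≤ riemForm g K x v := by
  rcases eq_or_ne v 0 with rfl | hv
  · simp [riemForm]
  · exact (h.riemForm_pos hv).le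

theorem IsStationary.continuousOnTangent_riemForm : ContinuousOnTangent (riemForm g K) := by
  have hc := continuousOnTangent_modelInner_modelVec g h.smooth
  have he := continuousOnTangent_modelInner_self g
  have hβ := continuousOnTangent_comp_proj (E := E) h.continuous_lapse
  exact Continuous.add he (Continuous.div ((continuous_const (y := (2 : ℝ))).mul (hc.pow 2)) hβ
    fun p ↦ (h.lapse_pos p.1).ne')

/-- For a horizontal part the radicand equals C² + βe, where C = ⟨v, K⟩ and e = ⟨v, v⟩. With m = -εC
> 0 the estimate is √(m² + βe) ≤ m + βe/(2m). The integral of the right side is controlled by the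
end points and the action when C is constant. -/
theorem IsStationary.coneSpeed_horiz_le {ε : ℝ} (hε : ε ^ 2 = 1) {x : M} {v : E}
    (hC : 0 < -ε * modelInner g x v (modelVec K x)) :
    coneSpeed g K ε x (h.horiz x v) ≤ ε * modelDiff h.time x v +
      modelInner g x v v / (2 * (-ε * modelInner g x v (modelVec K x))) := by
  have hβ := h.lapse_pos x
  have h1 := h.modelInner_horiz_self x v
  have h2 := h.modelInner_horiz_modelVec x v
  have hP := h.modelInner_nonneg (h.modelDiff_time_horiz x v)
  rw [coneSpeed, max_eq_left hP, div_le_iff₀ hβ, ← le_sub_iff_add_le', Real.sqrt_le_iff, h2]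
  set a := modelDiff h.time x v
  set C := modelInner g x v (modelVec K x)
  set β := lapse g K x
  set e := modelInner g x v v
  set P := modelInner g x (h.horiz x v) (h.horiz x v)
  set m := -ε * C with hm
  have hm2 : m ^ 2 = C ^ 2 := by rw [hm]; linear_combination C ^ 2 * hε
  have he : e = P + β * a ^ 2 + 2 * C * a := by linarith
  have e1 : (ε * a + e / (2 * m)) * β - ε * (C + β * a) = β * e / (2 * m) + m := by
    rw [hm]; ring
  rw [e1]
  constructor
  -- As e may be negative, the sign of the right side has to be checked before squaring; it follows
  -- from P ≥ 0.
  · have e2 : β * e / (2 * m) + m = (β * P + (β * a + C) ^ 2 + m ^ 2) / (2 * m) := by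
      rw [he]
      field_simp
      linear_combination hm2
    rw [e2]
    have := mul_nonneg hβ.le hP
    positivity
  · have e3 : (β * e / (2 * m) + m) ^ 2 = (β * e / (2 * m)) ^ 2 + β * e + m ^ 2 := by
      field_simp
      ring
    rw [e3, h1]
    nlinarith [sq_nonneg (β * e / (2 * m))]

omit h in
/-- Curves in `S` of bounded length starting at a fixed point stay in a compact set, and
`∫ |⟨γ', K⟩|` is bounded. -/
theorem IsStationary.IsSpeed.exists_bound {h : IsStationary g K S} {L : M → E → ℝ}
    (hL : h.IsSpeed L) {x : M} {r : ℝ}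
    (hcpt : ∃ N, IsCompact N ∧ ∀ y, SReach S L x y r → y ∈ N) :
    ∃ N, IsCompact N ∧ ∃ B, ∀ γ : ℝ → M, ContMDiffOn 𝓘(ℝ, ℝ) 𝓘(ℝ, E) 1 γ (Icc 0 1) →
      (∀ s ∈ Icc (0 : ℝ) 1, γ s ∈ S) → γ 0 = x →
      ∫ s in (0 : ℝ)..1, L (γ s) (velocityWithin γ (Icc 0 1) s) < r →
      (∀ s ∈ Icc (0 : ℝ) 1, γ s ∈ N) ∧
      ∫ s in (0 : ℝ)..1, |modelInner g (γ s) (velocityWithin γ (Icc 0 1) s) (modelVec K (γ s))| ≤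
        B := by
  obtain ⟨N, hN, hNr⟩ := hcpt
  have hQ : ContinuousOnTangent fun x v ↦ |modelInner g x v (modelVec K x)| :=
    Continuous.abs (continuousOnTangent_modelInner_modelVec g h.smooth)
  obtain ⟨C, hC, hCN⟩ := hL.exists_le_mul hQ (fun x v t ht ↦ by
    rw [map_smul, smul_apply, smul_eq_mul, abs_mul, abs_of_nonneg ht]) hN
  refine ⟨N, hN, C * r, fun γ hγ hS h0 hlen ↦ ?_⟩
  have hU := uniqueDiffOn_Icc (zero_lt_one (α := ℝ))
  have hLc := hL.continuous.comp_velocityWithin hγ hU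
  have hmem : ∀ s ∈ Icc (0 : ℝ) 1, γ s ∈ N := by
    intro s hs
    have h01 : (0 : ℝ) ∈ Icc (0 : ℝ) 1 := left_mem_Icc.2 zero_le_one
    have h11 : (1 : ℝ) ∈ Icc (0 : ℝ) 1 := right_mem_Icc.2 zero_le_one
    refine hNr _ ?_
    rw [← h0]
    refine hL.sReach hU hγ hs.1 (Icc_subset_Icc le_rfl hs.2)
      (fun t ht ↦ hS t ⟨ht.1, ht.2.trans hs.2⟩) (lt_of_le_of_lt ?_ hlen)
    exact intervalIntegral.integral_mono_interval le_rfl hs.1 hs.2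
      (Eventually.of_forall fun t ↦ hL.nonneg _ _) (integrableOn_interval hLc h01 h11)
  refine ⟨hmem, ?_⟩
  have h2 : ∫ s in (0 : ℝ)..1, |modelInner g (γ s) (velocityWithin γ (Icc 0 1) s)
      (modelVec K (γ s))| ≤ ∫ s in (0 : ℝ)..1, C * L (γ s) (velocityWithin γ (Icc 0 1) s) := by
    refine intervalIntegral.integral_mono_on zero_le_one
      (integrableOn_interval (hQ.comp_velocityWithin hγ hU) (by simp) (by simp))
      (integrableOn_interval (continuousOn_const.mul hLc) (by simp) (by simp)) fun s hs ↦ ?_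
    exact hCN _ (hmem s hs) _ (h.modelDiff_time_velocity (hasVelocityWithinAt_of_contMDiffOn hγ hs)
      hs (hU s hs) hS)
  rw [intervalIntegral.integral_const_mul] at h2
  exact h2.trans (mul_le_mul_of_nonneg_left hlen.le hC.le)

/-- The quantities attached to a curve in `C¹_K(p, q)`: its projection to `S`, and the relevant
integrals. -/
theorem IsStationary.exists_projection_bound (hS : IsCompleteHypersurface g S) (p q : M) (c : ℝ) :
    ∃ N, IsCompact N ∧ ∃ B, ∀ z ∈ C1K g K p q, action g z ≤ c →
      (∀ s ∈ Icc (0 : ℝ) 1, h.proj (z s) ∈ N) ∧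
      ∫ s in (0 : ℝ)..1, |modelInner g (z s) (h.horiz (z s) (velocityWithin z (Icc 0 1) s))
        (modelVec K (z s))| ≤ B := by
  set Δ := h.time q - h.time p with hΔ
  -- Common strict bound for the three lengths: the cone lengths are at most |Δ| + |c|, and the
  -- Riemannian length is at most 1/2 + c + |Δ|.
  set r := |c| + |Δ| + 1 with hr
  have hx := h.proj_mem p
  have hm1 : ((-1 : ℝ)) ^ 2 = 1 := by norm_num
  obtain ⟨N₁, hN₁, B₁, hb₁⟩ := h.isSpeed_spaceSpeed.exists_bound
    (h.exists_isCompact_spaceSpeed hS hx r)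
  obtain ⟨N₂, hN₂, B₂, hb₂⟩ := (h.isSpeed_coneSpeed (one_pow 2)).exists_bound
    (h.exists_isCompact_coneSpeed (one_pow 2) hx r)
  obtain ⟨N₃, hN₃, B₃, hb₃⟩ := (h.isSpeed_coneSpeed hm1).exists_bound
    (h.exists_isCompact_coneSpeed hm1 hx r)
  refine ⟨N₁ ∪ N₂ ∪ N₃, (hN₁.union hN₂).union hN₃, max (max B₁ B₂) B₃, ?_⟩
  rintro z ⟨hz, rfl, rfl, C, hC⟩ hact
  have hU := uniqueDiffOn_Icc (zero_lt_one (α := ℝ))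
  set v : ℝ → E := fun s ↦ velocityWithin z (Icc 0 1) s with hv
  have hC' : ∀ s ∈ Icc (0 : ℝ) 1, modelInner g (z s) (v s) (modelVec K (z s)) = C := hC
  have hvel : ∀ s ∈ Icc (0 : ℝ) 1, HasVelocityWithinAt z (v s) (Icc 0 1) s := fun s hs ↦
    hasVelocityWithinAt_of_contMDiffOn hz hs
  set γ : ℝ → M := h.proj ∘ z with hγdef
  have hγ : ContMDiffOn 𝓘(ℝ, ℝ) 𝓘(ℝ, E) 1 γ (Icc 0 1) := h.contMDiff_proj.comp_contMDiffOn hz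
  have hγS : ∀ s ∈ Icc (0 : ℝ) 1, γ s ∈ S := fun s _ ↦ h.proj_mem _
  have hγv : ∀ s ∈ Icc (0 : ℝ) 1, velocityWithin γ (Icc 0 1) s =
      modelDeriv (flow h.complete (-h.time (z s))) (z s) (h.horiz (z s) (v s)) := fun s hs ↦
    (h.hasVelocityWithinAt_proj (hvel s hs)).velocityWithin_eq (hU s hs)
  have hγe : ∀ s ∈ Icc (0 : ℝ) 1, modelInner g (γ s) (velocityWithin γ (Icc 0 1) s)
      (velocityWithin γ (Icc 0 1) s) =
      modelInner g (z s) (h.horiz (z s) (v s)) (h.horiz (z s) (v s)) := fun s hs ↦ by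
    rw [hγv s hs]
    exact h.modelInner_flow _ _ _ _
  have hγb : ∀ s ∈ Icc (0 : ℝ) 1, modelInner g (γ s) (velocityWithin γ (Icc 0 1) s)
      (modelVec K (γ s)) = modelInner g (z s) (h.horiz (z s) (v s)) (modelVec K (z s)) :=
    fun s hs ↦ by
    rw [hγv s hs]
    have : (modelVec K (γ s) : E) = modelDeriv (flow h.complete (-h.time (z s))) (z s)
      (modelVec K (z s)) := (h.modelDeriv_flow_modelVec _ _).symm
    rw [this]
    exact h.modelInner_flow _ _ _ _
  have hγβ : ∀ s, lapse g K (γ s) = lapse g K (z s) := fun s ↦ h.lapse_flow _ _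
  have hbint : ∫ s in (0 : ℝ)..1, |modelInner g (γ s) (velocityWithin γ (Icc 0 1) s)
      (modelVec K (γ s))| = ∫ s in (0 : ℝ)..1, |modelInner g (z s) (h.horiz (z s) (v s))
        (modelVec K (z s))| := by
    refine intervalIntegral.integral_congr fun s hs ↦ ?_
    rw [uIcc_of_le zero_le_one] at hs
    simp only [hγb s hs]
  have hec : ContinuousOn (fun s ↦ modelInner g (z s) (v s) (v s)) (Icc 0 1) :=
    (continuousOnTangent_modelInner_self g).comp_velocityWithin hz hU
  have hac : ContinuousOn (fun s ↦ modelDiff h.time (z s) (v s)) (Icc 0 1) :=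
    (continuousOnTangent_modelDiff h.contMDiff_time).comp_velocityWithin hz hU
  have hei := integrableOn_interval hec (left_mem_Icc.2 zero_le_one) (right_mem_Icc.2 zero_le_one)
  have hai := integrableOn_interval hac (left_mem_Icc.2 zero_le_one) (right_mem_Icc.2 zero_le_one)
  have hE : ∫ s in (0 : ℝ)..1, modelInner g (z s) (v s) (v s) ≤ 2 * c := by
    have : action g z = (1 / 2) * ∫ s in (0 : ℝ)..1, modelInner g (z s) (v s) (v s) := rfl
    linarith
  have hT : ∫ s in (0 : ℝ)..1, modelDiff h.time (z s) (v s) = Δ := by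
    refine intervalIntegral.integral_eq_sub_of_hasDerivAt_of_le zero_le_one
      (h.contMDiff_time.continuous.comp_continuousOn hz.continuousOn) (fun s hs ↦ ?_) hai
    exact ((hvel s (Ioo_subset_Icc_self hs)).hasDerivWithinAt
      (h.mdifferentiableAt_time _)).hasDerivAt (Icc_mem_nhds hs.1 hs.2)
  -- The case |C| ≥ 1, with ε opposite in sign to C. Dividing the action term by |C| ≥ 1 keeps it
  -- below |c|.
  have hcone : ∀ ε : ℝ, ε ^ 2 = 1 → 1 ≤ -ε * C →
      ∫ s in (0 : ℝ)..1, coneSpeed g K ε (γ s) (velocityWithin γ (Icc 0 1) s) < r := by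
    intro ε hε hm
    have h1 : ∀ s ∈ Icc (0 : ℝ) 1, coneSpeed g K ε (γ s) (velocityWithin γ (Icc 0 1) s) ≤
        ε * modelDiff h.time (z s) (v s) + modelInner g (z s) (v s) (v s) / (2 * (-ε * C)) := by
      intro s hs
      have h2 := h.coneSpeed_horiz_le hε (x := z s) (v := v s) (by rw [hC' s hs]; linarith)
      rw [hC' s hs] at h2
      refine le_trans (le_of_eq ?_) h2
      rw [coneSpeed, coneSpeed, hγe s hs, hγb s hs, hγβ]
    have h2 : ∫ s in (0 : ℝ)..1, coneSpeed g K ε (γ s) (velocityWithin γ (Icc 0 1) s) ≤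
        ∫ s in (0 : ℝ)..1, (ε * modelDiff h.time (z s) (v s) +
          modelInner g (z s) (v s) (v s) / (2 * (-ε * C))) :=
      intervalIntegral.integral_mono_on zero_le_one (integrableOn_interval
        ((h.isSpeed_coneSpeed hε).continuous.comp_velocityWithin hγ hU) (by simp) (by simp))
        ((hai.const_mul ε).add (hei.div_const _)) h1
    rw [intervalIntegral.integral_add (hai.const_mul ε) (hei.div_const _),
      intervalIntegral.integral_const_mul, intervalIntegral.integral_div, hT] at h2
    have h3 : ε * Δ ≤ |Δ| := by
      have : |ε| = 1 := by rw [← sq_eq_sq₀ (abs_nonneg ε) zero_le_one, sq_abs, hε, one_pow]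
      calc ε * Δ ≤ |ε * Δ| := le_abs_self _
        _ = |Δ| := by rw [abs_mul, this, one_mul]
    have h4 : (∫ s in (0 : ℝ)..1, modelInner g (z s) (v s) (v s)) / (2 * (-ε * C)) ≤ |c| := by
      rw [div_le_iff₀ (by linarith)]
      nlinarith [le_abs_self c, abs_nonneg c]
    linarith
  by_cases h1 : 1 ≤ C
  · obtain ⟨h2, h3⟩ := hb₃ γ hγ hγS rfl (hcone (-1) hm1 (by linarith))
    exact ⟨fun s hs ↦ Or.inr (h2 s hs), (hbint.ge.trans h3).trans (le_max_right _ _)⟩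
  by_cases h2 : C ≤ -1
  · obtain ⟨h2, h3⟩ := hb₂ γ hγ hγS rfl (hcone 1 (one_pow 2) (by linarith))
    exact ⟨fun s hs ↦ Or.inl (Or.inr (h2 s hs)), (hbint.ge.trans h3).trans
      ((le_max_right _ _).trans (le_max_left _ _))⟩
  push Not at h1 h2
  have hCΔ : -C * Δ ≤ |Δ| := by
    calc -C * Δ ≤ |(-C) * Δ| := le_abs_self _
      _ = |C| * |Δ| := by rw [abs_mul, abs_neg]
      _ ≤ 1 * |Δ| := mul_le_mul_of_nonneg_right (abs_le.2 ⟨h2.le, h1.le⟩) (abs_nonneg _)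
      _ = |Δ| := one_mul _
  have hlen : ∫ s in (0 : ℝ)..1, spaceSpeed g (γ s) (velocityWithin γ (Icc 0 1) s) < r := by
    -- Uses √P ≤ (1 + P)/2 and drops the term -βa² ≤ 0 of P.
    have h3 : ∀ s ∈ Icc (0 : ℝ) 1, spaceSpeed g (γ s) (velocityWithin γ (Icc 0 1) s) ≤
        1 / 2 + (1 / 2 * modelInner g (z s) (v s) (v s) -
          C * modelDiff h.time (z s) (v s)) := by
      intro s hs
      have h4 := h.modelInner_horiz_self (z s) (v s)
      have h5 := h.modelInner_nonneg (h.modelDiff_time_horiz (z s) (v s))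
      have h6 := h.lapse_pos (z s)
      rw [hC' s hs] at h4
      rw [spaceSpeed, hγe s hs]
      have h7 := Real.sq_sqrt h5
      nlinarith [sq_nonneg (Real.sqrt (modelInner g (z s) (h.horiz (z s) (v s))
        (h.horiz (z s) (v s))) - 1), mul_nonneg h6.le (sq_nonneg (modelDiff h.time (z s) (v s)))]
    have hi := (hei.const_mul (1 / 2)).sub (hai.const_mul C)
    have h4 : ∫ s in (0 : ℝ)..1, spaceSpeed g (γ s) (velocityWithin γ (Icc 0 1) s) ≤
        ∫ s in (0 : ℝ)..1, (1 / 2 + (1 / 2 * modelInner g (z s) (v s) (v s) -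
          C * modelDiff h.time (z s) (v s))) :=
      intervalIntegral.integral_mono_on zero_le_one (integrableOn_interval
        (h.isSpeed_spaceSpeed.continuous.comp_velocityWithin hγ hU) (by simp) (by simp))
        (intervalIntegrable_const.add hi) h3
    rw [intervalIntegral.integral_add intervalIntegrable_const hi,
      intervalIntegral.integral_sub (hei.const_mul (1 / 2)) (hai.const_mul C),
      intervalIntegral.integral_const_mul, intervalIntegral.integral_const_mul, hT,
      intervalIntegral.integral_const] at h4
    simp only [sub_zero, one_smul] at h4
    linarith [le_abs_self c]
  obtain ⟨h3, h4⟩ := hb₁ γ hγ hγS rfl hlen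
  exact ⟨fun s hs ↦ Or.inl (Or.inl (h3 s hs)), (hbint.ge.trans h4).trans
    ((le_max_left _ _).trans (le_max_left _ _))⟩

/-- The curves in `C¹_K(p, q)` of bounded action stay in a compact set and have bounded energy with
respect to the auxiliary Riemannian metric. -/
theorem IsStationary.exists_energy_bound (hS : IsCompleteHypersurface g S) (p q : M) (c : ℝ) :
    ∃ N, IsCompact N ∧ ∃ B, ∀ z ∈ C1K g K p q, action g z ≤ c →
      (∀ s ∈ Icc (0 : ℝ) 1, z s ∈ N) ∧
      ∫ s in (0 : ℝ)..1, riemForm g K (z s) (velocityWithin z (Icc 0 1) s) ≤ B := by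
  obtain ⟨N, hN, B, hb⟩ := h.exists_projection_bound hS p q c
  set Δ := h.time q - h.time p with hΔ
  obtain ⟨β₀, hβ₀, hβ₀N⟩ : ∃ β₀ > 0, ∀ x ∈ N, β₀ ≤ lapse g K x := by
    rcases N.eq_empty_or_nonempty with rfl | hne
    · exact ⟨1, one_pos, by simp⟩
    · obtain ⟨x, -, hx⟩ := hN.exists_isMinOn hne h.continuous_lapse.continuousOn
      exact ⟨_, h.lapse_pos x, fun y hy ↦ hx hy⟩
  obtain ⟨β₁, hβ₁N⟩ : ∃ β₁, ∀ x ∈ N, lapse g K x ≤ β₁ := by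
    obtain ⟨β₁, hβ₁⟩ := hN.bddAbove_image h.continuous_lapse.continuousOn
    exact ⟨β₁, fun x hx ↦ hβ₁ (mem_image_of_mem _ hx)⟩
  -- `Cs` will bound |C| and `ρ` will bound |T| along the curves; the compact set is the part swept
  -- out from `N` by the flow during times in [-ρ, ρ].
  set Cs := β₁ * (B / β₀ + |Δ|) with hCs
  set ρ := |h.time p| + (B + Cs) / β₀ with hρ
  refine ⟨(fun a : ℝ × M ↦ flow h.complete a.1 a.2) '' (Icc (-ρ) ρ ×ˢ N),
    (isCompact_Icc.prod hN).image h.continuous_flow, 2 * c + 2 * Cs ^ 2 / β₀, ?_⟩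
  intro z hz' hact
  obtain ⟨hzN, hzB⟩ := hb z hz' hact
  obtain ⟨hz, rfl, rfl, C, hC⟩ := hz'
  have hU := uniqueDiffOn_Icc (zero_lt_one (α := ℝ))
  have h01 : (0 : ℝ) ∈ Icc (0 : ℝ) 1 := left_mem_Icc.2 zero_le_one
  have h11 : (1 : ℝ) ∈ Icc (0 : ℝ) 1 := right_mem_Icc.2 zero_le_one
  set v : ℝ → E := fun s ↦ velocityWithin z (Icc 0 1) s with hv
  have hC' : ∀ s ∈ Icc (0 : ℝ) 1, modelInner g (z s) (v s) (modelVec K (z s)) = C := hC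
  have hvel : ∀ s ∈ Icc (0 : ℝ) 1, HasVelocityWithinAt z (v s) (Icc 0 1) s := fun s hs ↦
    hasVelocityWithinAt_of_contMDiffOn hz hs
  set a : ℝ → ℝ := fun s ↦ modelDiff h.time (z s) (v s) with ha
  set b : ℝ → ℝ := fun s ↦ modelInner g (z s) (h.horiz (z s) (v s)) (modelVec K (z s)) with hbdef
  set β : ℝ → ℝ := fun s ↦ lapse g K (z s) with hβdef
  have hβpos : ∀ s, 0 < β s := fun s ↦ h.lapse_pos _
  have hβproj : ∀ s, β s = lapse g K (h.proj (z s)) := fun s ↦ (h.lapse_flow _ _).symm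
  have hβ0 : ∀ s ∈ Icc (0 : ℝ) 1, β₀ ≤ β s := fun s hs ↦ by
    rw [hβproj]; exact hβ₀N _ (hzN s hs)
  have hβ1 : ∀ s ∈ Icc (0 : ℝ) 1, β s ≤ β₁ := fun s hs ↦ by
    rw [hβproj]; exact hβ₁N _ (hzN s hs)
  have hβ₁pos : 0 < β₁ := (hβpos 0).trans_le (hβ1 0 h01)
  have hrel : ∀ s ∈ Icc (0 : ℝ) 1, b s = C + β s * a s := fun s hs ↦ by
    have := h.modelInner_horiz_modelVec (z s) (v s)
    rw [hC' s hs] at this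
    exact this
  have hac : ContinuousOn a (Icc 0 1) :=
    (continuousOnTangent_modelDiff h.contMDiff_time).comp_velocityWithin hz hU
  have hβc : ContinuousOn β (Icc 0 1) := h.continuous_lapse.comp_continuousOn hz.continuousOn
  have hbc : ContinuousOn b (Icc 0 1) :=
    (continuousOn_const.add (hβc.mul hac)).congr hrel
  have hic : ContinuousOn (fun s ↦ (β s)⁻¹) (Icc 0 1) := hβc.inv₀ fun s _ ↦ (hβpos s).ne'
  have hai := integrableOn_interval hac h01 h11
  have hbi := integrableOn_interval hbc.abs h01 h11
  have hii := integrableOn_interval hic h01 h11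
  have hB0 : 0 ≤ B := (intervalIntegral.integral_nonneg zero_le_one fun s _ ↦ abs_nonneg _).trans hzB
  have hTd : ∀ s ∈ Icc (0 : ℝ) 1, ∫ t in (0 : ℝ)..s, a t = h.time (z s) - h.time (z 0) := by
    intro s hs
    refine intervalIntegral.integral_eq_sub_of_hasDerivAt_of_le hs.1
      ((h.contMDiff_time.continuous.comp_continuousOn hz.continuousOn).mono
        (Icc_subset_Icc le_rfl hs.2)) (fun t ht ↦ ?_) (integrableOn_interval hac h01 hs)
    have ht' : t ∈ Ioo (0 : ℝ) 1 := ⟨ht.1, ht.2.trans_le hs.2⟩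
    exact ((hvel t (Ioo_subset_Icc_self ht')).hasDerivWithinAt
      (h.mdifferentiableAt_time _)).hasDerivAt (Icc_mem_nhds ht'.1 ht'.2)
  have hinv : ∀ s ∈ Icc (0 : ℝ) 1, (β s)⁻¹ ≤ β₀⁻¹ := fun s hs ↦ inv_anti₀ hβ₀ (hβ0 s hs)
  have hCle : |C| ≤ Cs := by
    have h1 : |C| * β₁⁻¹ ≤ ∫ s in (0 : ℝ)..1, |C| * (β s)⁻¹ := by
      have : ∫ s in (0 : ℝ)..1, |C| * β₁⁻¹ ≤ ∫ s in (0 : ℝ)..1, |C| * (β s)⁻¹ :=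
        intervalIntegral.integral_mono_on zero_le_one intervalIntegrable_const
          (hii.const_mul _) fun s hs ↦ mul_le_mul_of_nonneg_left
            (inv_anti₀ (hβpos s) (hβ1 s hs)) (abs_nonneg _)
      simpa using this
    -- The relation b = C + βa divided by β and integrated; here the constancy of C and the fixed
    -- end times enter.
    have h2 : C * ∫ s in (0 : ℝ)..1, (β s)⁻¹ = (∫ s in (0 : ℝ)..1, b s * (β s)⁻¹) - Δ := by
      rw [← intervalIntegral.integral_const_mul, eq_sub_iff_add_eq, hΔ, ← hTd 1 h11,
        ← intervalIntegral.integral_add (hii.const_mul _) hai]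
      refine intervalIntegral.integral_congr fun s hs ↦ ?_
      rw [uIcc_of_le zero_le_one] at hs
      simp only [hrel s hs]
      have := (hβpos s).ne'
      field_simp
    have h3 : |∫ s in (0 : ℝ)..1, b s * (β s)⁻¹| ≤ B / β₀ := by
      calc |∫ s in (0 : ℝ)..1, b s * (β s)⁻¹| ≤ ∫ s in (0 : ℝ)..1, |b s * (β s)⁻¹| :=
            intervalIntegral.abs_integral_le_integral_abs zero_le_one
        _ ≤ ∫ s in (0 : ℝ)..1, |b s| * β₀⁻¹ := by
            refine intervalIntegral.integral_mono_on zero_le_one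
              (integrableOn_interval (hbc.mul hic).abs h01 h11) (hbi.mul_const _) fun s hs ↦ ?_
            rw [abs_mul, abs_of_pos (inv_pos.2 (hβpos s))]
            exact mul_le_mul_of_nonneg_left (hinv s hs) (abs_nonneg _)
        _ ≤ B / β₀ := by
            rw [intervalIntegral.integral_mul_const, div_eq_mul_inv]
            exact mul_le_mul_of_nonneg_right hzB (inv_pos.2 hβ₀).le
    have h4 : ∫ s in (0 : ℝ)..1, |C| * (β s)⁻¹ = |C * ∫ s in (0 : ℝ)..1, (β s)⁻¹| := by
      rw [intervalIntegral.integral_const_mul, abs_mul, abs_of_nonneg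
        (a := ∫ s in (0 : ℝ)..1, (β s)⁻¹)
        (intervalIntegral.integral_nonneg zero_le_one fun s _ ↦ (inv_pos.2 (hβpos s)).le)]
    rw [h4, h2] at h1
    have h5 : |C| * β₁⁻¹ ≤ B / β₀ + |Δ| := h1.trans ((abs_sub _ _).trans (by linarith))
    rw [← div_eq_mul_inv, div_le_iff₀ hβ₁pos] at h5
    rw [hCs]; linarith
  have hCs0 : 0 ≤ Cs := (abs_nonneg C).trans hCle
  constructor
  · intro s hs
    refine ⟨(h.time (z s), h.proj (z s)), ⟨?_, hzN s hs⟩, h.flow_time_proj _⟩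
    have h1 : |h.time (z s) - h.time (z 0)| ≤ (B + Cs) / β₀ := by
      rw [← hTd s hs]
      calc |∫ t in (0 : ℝ)..s, a t| ≤ ∫ t in (0 : ℝ)..s, |a t| :=
            intervalIntegral.abs_integral_le_integral_abs hs.1
        _ ≤ ∫ t in (0 : ℝ)..1, |a t| :=
            intervalIntegral.integral_mono_interval le_rfl hs.1 hs.2
              (Eventually.of_forall fun t ↦ abs_nonneg _) (integrableOn_interval hac.abs h01 h11)
        _ ≤ ∫ t in (0 : ℝ)..1, (|b t| + Cs) * β₀⁻¹ := by
            refine intervalIntegral.integral_mono_on zero_le_one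
              (integrableOn_interval hac.abs h01 h11)
              ((hbi.add intervalIntegrable_const).mul_const _) fun t ht ↦ ?_
            have h2 : a t = (b t - C) * (β t)⁻¹ := by
              rw [hrel t ht]
              have := (hβpos t).ne'
              field_simp
              ring
            rw [h2, abs_mul, abs_of_pos (inv_pos.2 (hβpos t))]
            refine mul_le_mul ((abs_sub _ _).trans (by linarith)) (hinv t ht)
              (inv_pos.2 (hβpos t)).le (by positivity)
        _ ≤ (B + Cs) / β₀ := by
            rw [intervalIntegral.integral_mul_const, div_eq_mul_inv,
              intervalIntegral.integral_add hbi intervalIntegrable_const]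
            refine mul_le_mul_of_nonneg_right ?_ (inv_pos.2 hβ₀).le
            simpa using hzB
    have h2 := abs_sub_abs_le_abs_sub (h.time (z s)) (h.time (z 0))
    exact abs_le.1 (by rw [hρ]; linarith)
  · have hec : ContinuousOn (fun s ↦ modelInner g (z s) (v s) (v s)) (Icc 0 1) :=
      (continuousOnTangent_modelInner_self g).comp_velocityWithin hz hU
    have hei := integrableOn_interval hec h01 h11
    have hE : ∫ s in (0 : ℝ)..1, modelInner g (z s) (v s) (v s) ≤ 2 * c := by
      have : action g z = (1 / 2) * ∫ s in (0 : ℝ)..1, modelInner g (z s) (v s) (v s) := rfl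
      linarith
    have h1 : ∫ s in (0 : ℝ)..1, riemForm g K (z s) (v s) ≤
        ∫ s in (0 : ℝ)..1, (modelInner g (z s) (v s) (v s) + 2 * Cs ^ 2 / β₀) := by
      refine intervalIntegral.integral_mono_on zero_le_one (integrableOn_interval
        (h.continuousOnTangent_riemForm.comp_velocityWithin hz hU) h01 h11)
        (hei.add intervalIntegrable_const) fun s hs ↦ ?_
      rw [riemForm, hC' s hs]
      have h2 : C ^ 2 ≤ Cs ^ 2 := by
        rw [← sq_abs C]
        exact pow_le_pow_left₀ (abs_nonneg C) hCle 2
      have h3 : 2 * C ^ 2 / lapse g K (z s) ≤ 2 * Cs ^ 2 / β₀ :=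
        div_le_div₀ (by positivity) (by linarith) hβ₀ (hβ0 s hs)
      linarith
    rw [intervalIntegral.integral_add hei intervalIntegrable_const] at h1
    simp only [intervalIntegral.integral_const, sub_zero, one_smul] at h1
    linarith

end Estimates

/-! ### Weak compactness in L² and primitives -/

section WeakLimits

/-- Bounded sequences in a separable Hilbert space have weakly convergent subsequences. -/
theorem exists_subseq_tendsto_inner {H : Type*} [NormedAddCommGroup H] [InnerProductSpace ℝ H]
    [CompleteSpace H] [TopologicalSpace.SeparableSpace H] {f : ℕ → H} {R : ℝ}
    (hf : ∀ n, ‖f n‖ ≤ R) :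
    ∃ x : H, ∃ σ : ℕ → ℕ, StrictMono σ ∧
      ∀ y, Tendsto (fun n ↦ inner ℝ (f (σ n)) y) atTop (𝓝 (inner ℝ x y)) := by
  let D : ℕ → WeakDual ℝ H := fun n ↦ StrongDual.toWeakDual (InnerProductSpace.toDual ℝ H (f n))
  have hD : ∀ n, D n ∈ WeakDual.toStrongDual ⁻¹' Metric.closedBall (0 : StrongDual ℝ H) R := by
    intro n
    rw [mem_preimage, mem_closedBall_zero_iff]
    exact ((InnerProductSpace.toDual ℝ H).norm_map (f n)).trans_le (hf n)
  obtain ⟨a, -, σ, hσ, hlim⟩ := WeakDual.isSeqCompact_closedBall ℝ H 0 R hD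
  refine ⟨(InnerProductSpace.toDual ℝ H).symm (WeakDual.toStrongDual a), σ, hσ, fun y ↦ ?_⟩
  rw [InnerProductSpace.toDual_symm_apply]
  exact ((WeakDual.eval_continuous y).tendsto a).comp hlim

theorem memLp_two_Icc_of_continuousOn {f : ℝ → ℝ} (hf : ContinuousOn f (Icc 0 1)) :
    MemLp f 2 (volume.restrict (Icc (0 : ℝ) 1)) := by
  obtain ⟨C, hC⟩ := isCompact_Icc.exists_bound_of_continuousOn hf
  exact MemLp.of_bound (hf.aestronglyMeasurable measurableSet_Icc) C
    ((ae_restrict_iff' measurableSet_Icc).2 (Eventually.of_forall hC))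

theorem intervalIntegral_eq_integral_Icc (f : ℝ → ℝ) :
    ∫ s in (0 : ℝ)..1, f s = ∫ s in Icc (0 : ℝ) 1, f s := by
  rw [intervalIntegral.integral_of_le zero_le_one, integral_Icc_eq_integral_Ioc]

theorem intervalIntegrable_of_memLp {f : ℝ → ℝ} (hf : MemLp f 2 (volume.restrict (Icc (0 : ℝ) 1))) :
    IntervalIntegrable f volume 0 1 := by
  rw [intervalIntegrable_iff_integrableOn_Icc_of_le zero_le_one]
  exact hf.integrable one_le_two

/-- `G` is a primitive of `W` on `[0, 1]`. -/
def IsPrimitive (G W : ℝ → ℝ) : Prop :=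
  ∀ s ∈ Icc (0 : ℝ) 1, ∫ t in (0 : ℝ)..s, W t = G s - G 0

theorem IsPrimitive.ae_hasDerivAt {G W : ℝ → ℝ} (hG : IsPrimitive G W)
    (hW : IntervalIntegrable W volume 0 1) :
    ∀ᵐ s ∂volume.restrict (Icc (0 : ℝ) 1), HasDerivAt G (W s) s := by
  have h0 : ∀ᵐ s : ℝ, s ≠ 0 := by simp [ae_iff, measure_singleton]
  have h1 : ∀ᵐ s : ℝ, s ≠ 1 := by simp [ae_iff, measure_singleton]
  rw [ae_restrict_iff' measurableSet_Icc]
  filter_upwards [hW.ae_hasDerivAt_integral, h0, h1] with s hs hs0 hs1 hmem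
  rw [uIcc_of_le zero_le_one] at hs
  have h2 := (hs hmem 0 (left_mem_Icc.2 zero_le_one)).const_add (G 0)
  refine h2.congr_of_eventuallyEq ?_
  filter_upwards [Icc_mem_nhds (lt_of_le_of_ne hmem.1 hs0.symm) (lt_of_le_of_ne hmem.2 hs1)]
    with t ht
  rw [hG t ht]
  ring

theorem IsPrimitive.absolutelyContinuousOnInterval {G W : ℝ → ℝ} (hG : IsPrimitive G W)
    (hW : IntervalIntegrable W volume 0 1) : AbsolutelyContinuousOnInterval G 0 1 := by
  have h1 := hW.absolutelyContinuousOnInterval_intervalIntegral left_mem_uIcc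
  rw [absolutelyContinuousOnInterval_iff] at h1 ⊢
  intro ε hε
  obtain ⟨δ, hδ, h2⟩ := h1 ε hε
  refine ⟨δ, hδ, fun e he hsum ↦ ?_⟩
  refine lt_of_eq_of_lt (Finset.sum_congr rfl fun i hi ↦ ?_) (h2 e he hsum)
  have h3 := he.1 i hi
  rw [uIcc_of_le zero_le_one] at h3
  rw [hG _ h3.1, hG _ h3.2, dist_sub_right]

/-- If functions with derivatives bounded in `L²` converge pointwise, their derivatives converge
weakly in `L²` to the derivative of the limit. -/
theorem exists_weak_limit_derivative {F w : ℕ → ℝ → ℝ} {G : ℝ → ℝ} {B : ℝ}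
    (hw : ∀ n, ContinuousOn (w n) (Icc 0 1)) (hF : ∀ n, IsPrimitive (F n) (w n))
    (hB : ∀ n, ∫ t in (0 : ℝ)..1, w n t ^ 2 ≤ B)
    (hlim : ∀ s ∈ Icc (0 : ℝ) 1, Tendsto (fun n ↦ F n s) atTop (𝓝 (G s))) :
    ∃ W, MemLp W 2 (volume.restrict (Icc (0 : ℝ) 1)) ∧ IsPrimitive G W ∧
      ∀ ψ, MemLp ψ 2 (volume.restrict (Icc (0 : ℝ) 1)) →
        Tendsto (fun n ↦ ∫ s in (0 : ℝ)..1, w n s * ψ s) atTop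
          (𝓝 (∫ s in (0 : ℝ)..1, W s * ψ s)) := by
  set μ : Measure ℝ := volume.restrict (Icc (0 : ℝ) 1) with hμ
  have : Fact ((2 : ℝ≥0∞) ≠ ⊤) := ⟨ENNReal.ofNat_ne_top⟩
  let f : ℕ → Lp ℝ 2 μ := fun n ↦ (memLp_two_Icc_of_continuousOn (hw n)).toLp (w n)
  have hf : ∀ n, f n =ᵐ[μ] w n := fun n ↦ MemLp.coeFn_toLp _
  have hinner : ∀ (x : Lp ℝ 2 μ) (W ψ : ℝ → ℝ) (hW : x =ᵐ[μ] W) (hψ : MemLp ψ 2 μ),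
      inner ℝ x (hψ.toLp ψ) = ∫ s in (0 : ℝ)..1, W s * ψ s := by
    intro x W ψ hW hψ
    rw [intervalIntegral_eq_integral_Icc, L2.inner_def]
    refine integral_congr_ae ?_
    filter_upwards [hW, hψ.coeFn_toLp] with s h1 h2
    rw [h1, h2]
    simp [mul_comm]
  have hnorm : ∀ n, ‖f n‖ ≤ Real.sqrt B := by
    intro n
    refine Real.le_sqrt_of_sq_le ?_
    rw [← real_inner_self_eq_norm_sq]
    refine le_trans (le_of_eq ?_) (hB n)
    rw [hinner (f n) (w n) (w n) (hf n) (memLp_two_Icc_of_continuousOn (hw n))]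
    simp only [pow_two]
  -- Testing weak convergence against the indicator of (0, s] shows that every subsequential weak
  -- limit has primitive G.
  have hprim : ∀ (x : Lp ℝ 2 μ) (τ : ℕ → ℕ), Tendsto τ atTop atTop →
      (∀ y, Tendsto (fun n ↦ inner ℝ (f (τ n)) y) atTop (𝓝 (inner ℝ x y))) →
      IsPrimitive G x := by
    intro x τ hτ hx s hs
    have hind : ∀ W : ℝ → ℝ, ∫ t in (0 : ℝ)..1, W t * (Ioc 0 s).indicator (fun _ ↦ (1 : ℝ)) t =
        ∫ t in (0 : ℝ)..s, W t := by
      intro W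
      have e : (fun t ↦ W t * (Ioc 0 s).indicator (fun _ ↦ (1 : ℝ)) t) =
          (Ioc 0 s).indicator W := by
        ext t
        by_cases ht : t ∈ Ioc 0 s <;> simp [ht]
      rw [e, intervalIntegral.integral_of_le zero_le_one, intervalIntegral.integral_of_le hs.1,
        setIntegral_indicator measurableSet_Ioc,
        inter_eq_self_of_subset_right (Ioc_subset_Ioc_right hs.2)]
    have hψ : MemLp ((Ioc 0 s).indicator fun _ ↦ (1 : ℝ)) 2 μ :=
      (memLp_const 1).indicator measurableSet_Ioc
    have h1 := hx (hψ.toLp _)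
    rw [hinner x x _ (ae_eq_refl _) hψ, hind] at h1
    refine tendsto_nhds_unique h1 (Tendsto.congr (fun n ↦ ?_)
      (((hlim s hs).comp hτ).sub ((hlim 0 (left_mem_Icc.2 zero_le_one)).comp hτ)))
    rw [hinner _ _ _ (hf _) hψ, hind]
    exact (hF _ s hs).symm
  have hint : ∀ x : Lp ℝ 2 μ, IntervalIntegrable x volume 0 1 := fun x ↦
    intervalIntegrable_of_memLp (Lp.memLp x)
  obtain ⟨x, σ, hσ, hx⟩ := exists_subseq_tendsto_inner hnorm
  have hxG := hprim x σ hσ.tendsto_atTop hx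
  refine ⟨x, Lp.memLp x, hxG, fun ψ hψ ↦ ?_⟩
  -- A limit with primitive G is determined almost everywhere as the derivative of G. All
  -- subsequential limits therefore agree, and the full sequence converges.
  refine tendsto_of_subseq_tendsto fun ns hns ↦ ?_
  obtain ⟨y, τ, hτ, hy⟩ := exists_subseq_tendsto_inner fun n ↦ hnorm (ns n)
  have hyG := hprim y (ns ∘ τ) (hns.comp hτ.tendsto_atTop) hy
  have hxy : y = x := by
    refine Lp.ext ?_
    filter_upwards [hxG.ae_hasDerivAt (hint x), hyG.ae_hasDerivAt (hint y)] with s h1 h2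
    exact h2.unique h1
  refine ⟨τ, ?_⟩
  have h1 := hy (hψ.toLp ψ)
  rw [hxy, hinner x x ψ (ae_eq_refl _) hψ] at h1
  exact h1.congr fun n ↦ hinner _ _ _ (hf _) hψ

/-- Cauchy–Schwarz: functions with derivative bounded in `L²` are uniformly Hölder. -/
theorem IsPrimitive.abs_sub_sq_le {F w : ℝ → ℝ} {B : ℝ} (hF : IsPrimitive F w)
    (hw : ContinuousOn w (Icc 0 1)) (hB : ∫ t in (0 : ℝ)..1, w t ^ 2 ≤ B) {s t : ℝ}
    (hs : s ∈ Icc (0 : ℝ) 1) (ht : t ∈ Icc (0 : ℝ) 1) (hst : s ≤ t) :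
    (F t - F s) ^ 2 ≤ B * (t - s) := by
  have h01 : (0 : ℝ) ∈ Icc (0 : ℝ) 1 := left_mem_Icc.2 zero_le_one
  have h11 : (1 : ℝ) ∈ Icc (0 : ℝ) 1 := right_mem_Icc.2 zero_le_one
  rcases hst.eq_or_lt with rfl | hlt
  · simp
  have hw2 : ContinuousOn (fun r ↦ w r ^ 2) (Icc 0 1) := hw.pow 2
  have h1 : F t - F s = ∫ r in s..t, w r := by
    rw [← intervalIntegral.integral_interval_sub_left (integrableOn_interval hw h01 ht)
      (integrableOn_interval hw h01 hs), hF t ht, hF s hs]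
    ring
  have h2 : ∫ r in s..t, w r ^ 2 ≤ B := le_trans
    (intervalIntegral.integral_mono_interval hs.1 hst ht.2
      (Eventually.of_forall fun r ↦ sq_nonneg _) (integrableOn_interval hw2 h01 h11)) hB
  -- The mean of w on [s, t]; expanding ∫ (w - m)² ≥ 0 gives the Cauchy–Schwarz inequality.
  set m := (F t - F s) / (t - s) with hm
  have hpos : 0 < t - s := sub_pos.2 hlt
  have h3 : 0 ≤ ∫ r in s..t, (w r - m) ^ 2 :=
    intervalIntegral.integral_nonneg hst fun r _ ↦ sq_nonneg _
  have h4 : ∫ r in s..t, (w r - m) ^ 2 =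
      (∫ r in s..t, w r ^ 2) - 2 * m * (F t - F s) + m ^ 2 * (t - s) := by
    have e : ∀ r, (w r - m) ^ 2 = w r ^ 2 - 2 * m * w r + m ^ 2 := fun r ↦ by ring
    simp only [e]
    rw [intervalIntegral.integral_add ((integrableOn_interval hw2 hs ht).sub
      ((integrableOn_interval hw hs ht).const_mul _)) intervalIntegrable_const,
      intervalIntegral.integral_sub (integrableOn_interval hw2 hs ht)
      ((integrableOn_interval hw hs ht).const_mul _), intervalIntegral.integral_const_mul, ← h1,
      intervalIntegral.integral_const, smul_eq_mul]
    ring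
  have h5 : F t - F s = m * (t - s) := by rw [hm]; field_simp
  rw [h5] at h4 ⊢
  nlinarith

end WeakLimits

/-! ### Arzelà–Ascoli in a metrizable space -/

section ArzelaAscoli

/-- Uniform convergence of continuous curves on a compact interval is convergence in the
compact-open topology, hence does not depend on the uniform structure. -/
theorem uniformlyConverges_of_tendsto {M : Type*} [TopologicalSpace M]
    {f : ℕ → C(Icc (0 : ℝ) 1, M)} {a : C(Icc (0 : ℝ) 1, M)} (hf : Tendsto f atTop (𝓝 a))
    {u : ℕ → ℝ → M} {z : ℝ → M} (hu : ∀ n (s : Icc (0 : ℝ) 1), u n s = f n s)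
    (hz : ∀ s : Icc (0 : ℝ) 1, z s = a s) : UniformlyConverges u z := by
  intro 𝒰 h𝒰
  subst h𝒰
  rw [ContinuousMap.tendsto_iff_tendstoUniformly] at hf
  rw [tendstoUniformlyOn_iff_tendstoUniformly_comp_coe]
  have e1 : (fun n ↦ u n ∘ ((↑) : Icc (0 : ℝ) 1 → ℝ)) = fun n ↦ ⇑(f n) := by
    funext n s
    exact hu n s
  have e2 : z ∘ ((↑) : Icc (0 : ℝ) 1 → ℝ) = a := by
    funext s
    exact hz s
  rw [e2]
  change TendstoUniformly (fun n ↦ u n ∘ ((↑) : Icc (0 : ℝ) 1 → ℝ)) _ _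
  rw [e1]
  exact hf

/-- Arzelà–Ascoli for curves in a compact subset of a metrizable space, where equicontinuity is
tested on a family of continuous functions separating points. -/
theorem exists_subseq_uniformlyConverges {M : Type*} [TopologicalSpace M]
    [TopologicalSpace.MetrizableSpace M] {N : Set M} (hN : IsCompact N) {u : ℕ → ℝ → M}
    (hu : ∀ n, ContinuousOn (u n) (Icc 0 1)) (huN : ∀ n, ∀ s ∈ Icc (0 : ℝ) 1, u n s ∈ N)
    (hsep : ∀ x y : M, x ≠ y → ∃ φ : M → ℝ, Continuous φ ∧ φ x ≠ φ y ∧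
      ∀ ε > 0, ∃ δ > 0, ∀ n, ∀ s ∈ Icc (0 : ℝ) 1, ∀ t ∈ Icc (0 : ℝ) 1, dist s t < δ →
        dist (φ (u n s)) (φ (u n t)) < ε) :
    ∃ z : ℝ → M, Continuous z ∧ ∃ σ : ℕ → ℕ, StrictMono σ ∧ UniformlyConverges (u ∘ σ) z ∧
      ∀ s ∈ Icc (0 : ℝ) 1, Tendsto (fun n ↦ u (σ n) s) atTop (𝓝 (z s)) := by
  let := TopologicalSpace.metrizableSpaceMetric M
  let f : ℕ → C(Icc (0 : ℝ) 1, M) := fun n ↦ ⟨fun s ↦ u n s, (hu n).domRestrict⟩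
  let fb : ℕ → BoundedContinuousFunction (Icc (0 : ℝ) 1) M := fun n ↦
    BoundedContinuousFunction.mkOfCompact (f n)
  have hequi : Equicontinuous ((↑) : range fb → Icc (0 : ℝ) 1 → M) := by
    intro s₀
    rw [Metric.equicontinuousAt_iff]
    by_contra! hcon
    obtain ⟨ε, hε, hcon⟩ := hcon
    have hcon' : ∀ k : ℕ, ∃ s : Icc (0 : ℝ) 1, dist s s₀ < 1 / ((k : ℝ) + 1) ∧
        ∃ n, ε ≤ dist (u n s₀) (u n s) := by
      intro k
      obtain ⟨s, hs, ⟨_, n, rfl⟩, hd⟩ := hcon (1 / ((k : ℝ) + 1)) (by positivity)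
      exact ⟨s, hs, n, hd⟩
    choose s hs n hn using hcon'
    -- If equicontinuity failed at s₀, pairs of values at parameters approaching s₀ would
    -- subconverge to distinct points a and b. A test function separating them contradicts the
    -- equicontinuity of its compositions with the curves.
    obtain ⟨⟨a, b⟩, -, τ, hτ, hlim⟩ := (hN.prod hN).tendsto_subseq
      (x := fun k ↦ (u (n k) s₀, u (n k) (s k)))
      fun k ↦ ⟨huN _ _ s₀.2, huN _ _ (s k).2⟩
    have ha : Tendsto (fun k ↦ u (n (τ k)) s₀) atTop (𝓝 a) :=
      (continuous_fst.tendsto (a, b)).comp hlim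
    have hb : Tendsto (fun k ↦ u (n (τ k)) (s (τ k))) atTop (𝓝 b) :=
      (continuous_snd.tendsto (a, b)).comp hlim
    have hab : a ≠ b := by
      have : ε ≤ dist a b := ge_of_tendsto (ha.dist hb) (Eventually.of_forall fun k ↦ hn _)
      exact dist_pos.1 (hε.trans_le this)
    obtain ⟨φ, hφ, hne, hφu⟩ := hsep a b hab
    have hd := ((hφ.tendsto a).comp ha).dist ((hφ.tendsto b).comp hb)
    obtain ⟨δ, hδ, hφδ⟩ := hφu (dist (φ a) (φ b) / 2) (half_pos (dist_pos.2 hne))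
    have hev : ∀ᶠ k in atTop, 1 / (((τ k : ℕ) : ℝ) + 1) < δ :=
      (tendsto_one_div_add_atTop_nhds_zero_nat.comp hτ.tendsto_atTop).eventually_lt_const hδ
    have hle : dist (φ a) (φ b) ≤ dist (φ a) (φ b) / 2 := by
      refine le_of_tendsto hd ?_
      filter_upwards [hev] with k hk
      refine (hφδ _ _ s₀.2 _ (s (τ k)).2 ?_).le
      rw [dist_comm]
      exact (hs (τ k)).trans hk
    linarith [dist_pos.2 hne]
  have hcpt := BoundedContinuousFunction.arzela_ascoli N hN (range fb)
    (by rintro _ s ⟨n, rfl⟩; exact huN n s s.2) hequi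
  obtain ⟨a, -, σ, hσ, hlim⟩ := hcpt.tendsto_subseq fun n ↦ subset_closure (mem_range_self n)
  have hlim' : Tendsto (f ∘ σ) atTop (𝓝 a.toContinuousMap) := by
    rw [ContinuousMap.tendsto_iff_tendstoUniformly]
    exact BoundedContinuousFunction.tendsto_iff_tendstoUniformly.1 hlim
  have hz : ∀ s : Icc (0 : ℝ) 1, IccExtend zero_le_one a (s : ℝ) = a s := fun s ↦
    IccExtend_val _ _ s
  refine ⟨IccExtend zero_le_one a, a.continuous.Icc_extend', σ, hσ,
    uniformlyConverges_of_tendsto hlim' (fun n s ↦ rfl) hz, fun s hs ↦ ?_⟩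
  have := (ContinuousMap.tendsto_iff_tendstoUniformly.1 hlim').tendsto_at ⟨s, hs⟩
  rw [show IccExtend zero_le_one a s = a ⟨s, hs⟩ from hz ⟨s, hs⟩]
  exact this

end ArzelaAscoli

/-! ### Smooth functions detecting points and tangent vectors -/

section SmoothFunctions

variable {E : Type*} [NormedAddCommGroup E] [NormedSpace ℝ E]
  {M : Type*} [TopologicalSpace M] [ChartedSpace E M] [IsManifold 𝓘(ℝ, E) ∞ M] [T2Space M]
  [FiniteDimensional ℝ E]

theorem exists_contMDiff_apply_ne {x y : M} (hxy : x ≠ y) :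
    ∃ φ : M → ℝ, ContMDiff 𝓘(ℝ, E) 𝓘(ℝ, ℝ) ∞ φ ∧ φ x ≠ φ y := by
  obtain ⟨f, -, hf⟩ := (SmoothBumpFunction.nhds_basis_tsupport (I := 𝓘(ℝ, E)) x).mem_iff.1
    (isOpen_compl_singleton.mem_nhds hxy)
  refine ⟨f, f.contMDiff, ?_⟩
  rw [f.eq_one, image_eq_zero_of_notMem_tsupport fun h ↦ hf h rfl]
  exact one_ne_zero

/-- A linear form on the chart, cut off by a bump function. This makes the differentials of smooth
functions a family without common zeros off the zero section, as the covering argument for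
homogeneous functions requires. -/
theorem exists_contMDiff_modelDiff_ne_zero (x : M) {v : E} (hv : v ≠ 0) :
    ∃ φ : M → ℝ, ContMDiff 𝓘(ℝ, E) 𝓘(ℝ, ℝ) ∞ φ ∧ modelDiff φ x v ≠ 0 := by
  have hx := mem_extChartAt_source (I := 𝓘(ℝ, E)) x
  have hinj : Function.Injective
      (mfderiv 𝓘(ℝ, E) 𝓘(ℝ, E) (extChartAt 𝓘(ℝ, E) x) x : E →L[ℝ] E) := by
    have := (isInvertible_mfderiv_extChartAt hx).injective
    exact this
  set e : E →L[ℝ] E := mfderiv 𝓘(ℝ, E) 𝓘(ℝ, E) (extChartAt 𝓘(ℝ, E) x) x with he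
  have hev : e v ≠ 0 := fun h0 ↦ hv (hinj (h0.trans (map_zero e).symm))
  obtain ⟨l, hl⟩ := SeparatingDual.exists_ne_zero (R := ℝ) hev
  obtain ⟨f⟩ : Nonempty (SmoothBumpFunction 𝓘(ℝ, E) x) := inferInstance
  have hle : ContMDiffOn 𝓘(ℝ, E) 𝓘(ℝ, ℝ) ∞ (fun y ↦ l (extChartAt 𝓘(ℝ, E) x y))
      (chartAt E x).source :=
    l.contMDiff.comp_contMDiffOn (contMDiffOn_extChartAt (n := ((⊤ : ℕ∞) : WithTop ℕ∞)))
  refine ⟨fun y ↦ f y • l (extChartAt 𝓘(ℝ, E) x y), f.contMDiff_smul hle, ?_⟩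
  have heq : (fun y ↦ f y • l (extChartAt 𝓘(ℝ, E) x y)) =ᶠ[𝓝 x]
      fun y ↦ l (extChartAt 𝓘(ℝ, E) x y) := by
    filter_upwards [f.eventuallyEq_one] with y hy
    rw [hy]
    simp
  have hd : HasMFDerivAt 𝓘(ℝ, E) 𝓘(ℝ, ℝ) (fun y ↦ l (extChartAt 𝓘(ℝ, E) x y)) x (l.comp e) :=
    l.hasMFDerivAt.comp x (mdifferentiableAt_extChartAt (mem_chart_source E x)).hasMFDerivAt
  have := (hd.congr_of_eventuallyEq heq).mfderiv
  rw [modelDiff, this]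
  exact hl

variable [CompleteSpace E] {g : LorentzMetric E M} {K : VField E M} {S : Set M}
  (h : IsStationary g K S)

include h

theorem IsStationary.continuousOnTangent_sqrt_riemForm :
    ContinuousOnTangent fun x v ↦ Real.sqrt (riemForm g K x v) :=
  Real.continuous_sqrt.comp h.continuousOnTangent_riemForm

omit h in
theorem sqrt_riemForm_smul (x : M) (v : E) {t : ℝ} (ht : 0 ≤ t) :
    Real.sqrt (riemForm g K x (t • v)) = t * Real.sqrt (riemForm g K x v) := by
  have e : riemForm g K x (t • v) = t ^ 2 * riemForm g K x v := by
    simp only [riemForm, map_smul, smul_apply, smul_eq_mul]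
    ring
  rw [e, Real.sqrt_mul (sq_nonneg t), Real.sqrt_sq ht]

omit h [T2Space M] [CompleteSpace E] [FiniteDimensional ℝ E] in
theorem abs_modelDiff_smul (φ : M → ℝ) (x : M) (v : E) {t : ℝ} (ht : 0 ≤ t) :
    |modelDiff φ x (t • v)| = t * |modelDiff φ x v| := by
  rw [map_smul, smul_eq_mul, abs_mul, abs_of_nonneg ht]

omit h [T2Space M] [CompleteSpace E] [FiniteDimensional ℝ E] in
theorem continuousOnTangent_abs_modelDiff {φ : M → ℝ} (hφ : ContMDiff 𝓘(ℝ, E) 𝓘(ℝ, ℝ) ∞ φ) :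
    ContinuousOnTangent fun x (v : E) ↦ |modelDiff φ x v| :=
  Continuous.abs (continuousOnTangent_modelDiff (hφ.of_le one_le_infty))

theorem IsStationary.exists_abs_modelDiff_le {φ : M → ℝ}
    (hφ : ContMDiff 𝓘(ℝ, E) 𝓘(ℝ, ℝ) ∞ φ) {N : Set M} (hN : IsCompact N) :
    ∃ C > 0, ∀ x ∈ N, ∀ v, |modelDiff φ x v| ≤ C * Real.sqrt (riemForm g K x v) :=
  exists_le_mul_of_homogeneous
    (continuousOnTangent_abs_modelDiff hφ) h.continuousOnTangent_sqrt_riemForm (fun x v _ ht ↦ abs_modelDiff_smul φ x v ht)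
    (fun x v _ ht ↦ sqrt_riemForm_smul x v ht)
    (fun _ _ hv ↦ Real.sqrt_pos.2 (h.riemForm_pos hv)) hN

/-- On a compact set the auxiliary Riemannian norm is controlled by the differentials of finitely
many smooth functions. -/
theorem IsStationary.exists_sqrt_riemForm_le {N : Set M} (hN : IsCompact N) :
    ∃ F : Finset {φ : M → ℝ // ContMDiff 𝓘(ℝ, E) 𝓘(ℝ, ℝ) ∞ φ}, ∃ C > 0, ∀ x ∈ N, ∀ v,
      Real.sqrt (riemForm g K x v) ≤ C * ∑ φ ∈ F, |modelDiff φ.1 x v| :=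
  exists_le_mul_sum_of_homogeneous h.continuousOnTangent_sqrt_riemForm
    (fun φ ↦ continuousOnTangent_abs_modelDiff φ.2)
    (fun x v _ ht ↦ sqrt_riemForm_smul x v ht) (fun φ x v _ ht ↦ abs_modelDiff_smul φ.1 x v ht)
    (fun _ _ _ ↦ abs_nonneg _)
    (fun x v hv ↦ by
      obtain ⟨φ, hφ, hne⟩ := exists_contMDiff_modelDiff_ne_zero x hv
      exact ⟨⟨φ, hφ⟩, abs_pos.2 hne⟩) hN

end SmoothFunctions

/-! ### Weak and uniform compactness of curves of bounded energy -/

section Compactness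

variable {E : Type*} [NormedAddCommGroup E] [NormedSpace ℝ E]
  {M : Type*} [TopologicalSpace M] [ChartedSpace E M] [IsManifold 𝓘(ℝ, E) ∞ M] [T2Space M]
  [FiniteDimensional ℝ E] [CompleteSpace E] {g : LorentzMetric E M} {K : VField E M} {S : Set M}

theorem isPrimitive_comp {φ : M → ℝ} (hφ : ContMDiff 𝓘(ℝ, E) 𝓘(ℝ, ℝ) 1 φ) {γ : ℝ → M}
    (hγ : ContMDiffOn 𝓘(ℝ, ℝ) 𝓘(ℝ, E) 1 γ (Icc 0 1)) :
    IsPrimitive (φ ∘ γ) fun s ↦ modelDiff φ (γ s) (velocityWithin (E := E) γ (Icc 0 1) s) := by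
  intro s hs
  have hc := (continuousOnTangent_modelDiff hφ).comp_velocityWithin hγ
    (uniqueDiffOn_Icc (zero_lt_one (α := ℝ)))
  refine intervalIntegral.integral_eq_sub_of_hasDerivAt_of_le hs.1
    ((hφ.continuous.comp_continuousOn hγ.continuousOn).mono (Icc_subset_Icc le_rfl hs.2))
    (fun t ht ↦ ?_) (integrableOn_interval hc (left_mem_Icc.2 zero_le_one) hs)
  have ht' : t ∈ Ioo (0 : ℝ) 1 := ⟨ht.1, ht.2.trans_le hs.2⟩
  exact ((hasVelocityWithinAt_of_contMDiffOn hγ (Ioo_subset_Icc_self ht')).hasDerivWithinAt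
    ((hφ.mdifferentiable one_ne_zero) _)).hasDerivAt (Icc_mem_nhds ht'.1 ht'.2)

variable (h : IsStationary g K S)

include h

/-- A curve whose compositions with smooth functions have square integrable derivatives has finite
energy. -/
theorem IsStationary.lintegral_riemInner_lt_top {z : ℝ → M} {N : Set M} (hN : IsCompact N)
    (hzN : ∀ s ∈ Icc (0 : ℝ) 1, z s ∈ N)
    (hz : ∀ φ : M → ℝ, ContMDiff 𝓘(ℝ, E) 𝓘(ℝ, ℝ) ∞ φ →
      ∃ W, MemLp W 2 (volume.restrict (Icc (0 : ℝ) 1)) ∧ IsPrimitive (φ ∘ z) W) :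
    ∫⁻ s in Icc (0 : ℝ) 1, ENNReal.ofReal
      (riemInner g K (z s) (velocity (E := E) z s) (velocity (E := E) z s)) < ⊤ := by
  obtain ⟨F, C, hC, hF⟩ := h.exists_sqrt_riemForm_le hN
  choose W hW hWp using fun φ : {φ : M → ℝ // ContMDiff 𝓘(ℝ, E) 𝓘(ℝ, ℝ) ∞ φ} ↦ hz φ.1 φ.2
  have hmem : MemLp (fun s ↦ C * ∑ φ ∈ F, |W φ s|) 2 (volume.restrict (Icc (0 : ℝ) 1)) :=
    (memLp_finsetSum F fun φ _ ↦ (hW φ).abs).const_mul C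
  refine lt_of_le_of_lt (lintegral_mono_ae ?_) hmem.integrable_sq.lintegral_lt_top
  have hae : ∀ᵐ s ∂volume.restrict (Icc (0 : ℝ) 1), ∀ φ ∈ F, HasDerivAt (φ.1 ∘ z) (W φ s) s :=
    (ae_ball_iff F.countable_toSet).2 fun φ _ ↦
      (hWp φ).ae_hasDerivAt (intervalIntegrable_of_memLp (hW φ))
  filter_upwards [hae, ae_restrict_mem measurableSet_Icc] with s hs hmem
  refine ENNReal.ofReal_le_ofReal ?_
  rw [riemInner_self]
  change riemForm g K (z s) (velocityWithin z (Icc 0 1) s) ≤ _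
  by_cases hd : MDifferentiableWithinAt 𝓘(ℝ, ℝ) 𝓘(ℝ, E) z (Icc 0 1) s
  · have hv := hasVelocityWithinAt_velocityWithin hd
    have hsum : ∑ φ ∈ F, |modelDiff φ.1 (z s) (velocityWithin z (Icc 0 1) s : E)| =
        ∑ φ ∈ F, |W φ s| := by
      refine Finset.sum_congr rfl fun φ hφ ↦ ?_
      have h1 := hv.hasDerivWithinAt ((φ.2.mdifferentiable (by simp)) (z s))
      rw [(uniqueDiffOn_Icc (zero_lt_one (α := ℝ)) s hmem).eq_deriv _ h1
        (hs φ hφ).hasDerivWithinAt]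
    rw [← hsum, ← Real.sqrt_le_left (mul_nonneg hC.le (Finset.sum_nonneg fun _ _ ↦ abs_nonneg _))]
    exact hF _ (hzN s hmem) _
  · have h0 : (velocityWithin z (Icc 0 1) s : E) = 0 := by
      rw [velocityWithin, mfderivWithin_zero_of_not_mdifferentiableWithinAt hd]
      rfl
    rw [h0]
    have : riemForm g K (z s) (0 : E) = 0 := by simp [riemForm]
    rw [this]
    positivity

/-- Bounded sequences of curves in a compact set have weakly convergent subsequences. -/
theorem IsStationary.exists_subseq_weaklyConverges [SecondCountableTopology M] {p q : M}
    {N : Set M} (hN : IsCompact N) {B : ℝ} {u : ℕ → ℝ → M}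
    (hu : ∀ n, ContMDiffOn 𝓘(ℝ, ℝ) 𝓘(ℝ, E) 1 (u n) (Icc 0 1))
    (hp : ∀ n, u n 0 = p) (hq : ∀ n, u n 1 = q) (huN : ∀ n, ∀ s ∈ Icc (0 : ℝ) 1, u n s ∈ N)
    (hB : ∀ n, ∫ s in (0 : ℝ)..1, riemForm g K (u n s) (velocityWithin (u n) (Icc 0 1) s) ≤ B) :
    ∃ z ∈ Omega1 g K p q, ∃ σ : ℕ → ℕ, StrictMono σ ∧
      WeaklyConverges E (u ∘ σ) z ∧ UniformlyConverges (u ∘ σ) z := by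
  have h01 : (0 : ℝ) ∈ Icc (0 : ℝ) 1 := left_mem_Icc.2 zero_le_one
  have h11 : (1 : ℝ) ∈ Icc (0 : ℝ) 1 := right_mem_Icc.2 zero_le_one
  have hU := uniqueDiffOn_Icc (zero_lt_one (α := ℝ))
  set w : (M → ℝ) → ℕ → ℝ → ℝ := fun φ n s ↦
    modelDiff φ (u n s) (velocityWithin (u n) (Icc 0 1) s : E) with hw
  have hwc : ∀ φ : M → ℝ, ContMDiff 𝓘(ℝ, E) 𝓘(ℝ, ℝ) ∞ φ → ∀ n, ContinuousOn (w φ n) (Icc 0 1) :=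
    fun φ hφ n ↦ (continuousOnTangent_modelDiff (hφ.of_le one_le_infty)).comp_velocityWithin
      (hu n) hU
  have hwp : ∀ φ : M → ℝ, ContMDiff 𝓘(ℝ, E) 𝓘(ℝ, ℝ) ∞ φ → ∀ n, IsPrimitive (φ ∘ u n) (w φ n) :=
    fun φ hφ n ↦ isPrimitive_comp (hφ.of_le one_le_infty) (hu n)
  have hwB : ∀ φ : M → ℝ, ContMDiff 𝓘(ℝ, E) 𝓘(ℝ, ℝ) ∞ φ →
      ∃ A, ∀ n, ∫ s in (0 : ℝ)..1, w φ n s ^ 2 ≤ A := by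
    intro φ hφ
    obtain ⟨C, hC, hCN⟩ := h.exists_abs_modelDiff_le hφ hN
    refine ⟨C ^ 2 * B, fun n ↦ ?_⟩
    have hr := integrableOn_interval
      (h.continuousOnTangent_riemForm.comp_velocityWithin (hu n) hU) h01 h11
    have h1 : ∫ s in (0 : ℝ)..1, w φ n s ^ 2 ≤ ∫ s in (0 : ℝ)..1,
        C ^ 2 * riemForm g K (u n s) (velocityWithin (u n) (Icc 0 1) s) := by
      refine intervalIntegral.integral_mono_on zero_le_one
        (integrableOn_interval ((hwc φ hφ n).pow 2) h01 h11) (hr.const_mul _) fun s hs ↦ ?_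
      have h2 := pow_le_pow_left₀ (abs_nonneg _)
        (hCN _ (huN n s hs) (velocityWithin (u n) (Icc 0 1) s)) 2
      rwa [sq_abs, mul_pow, Real.sq_sqrt (h.riemForm_nonneg _ _)] at h2
    rw [intervalIntegral.integral_const_mul] at h1
    exact h1.trans (mul_le_mul_of_nonneg_left (hB n) (sq_nonneg C))
  have : LocallyCompactSpace M := Manifold.locallyCompact_of_finiteDimensional 𝓘(ℝ, E)
  have : TopologicalSpace.MetrizableSpace M :=
    TopologicalSpace.metrizableSpace_of_t3_secondCountable M
  obtain ⟨z, hzc, σ, hσ, hunif, hpt⟩ := exists_subseq_uniformlyConverges hN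
    (fun n ↦ (hu n).continuousOn) huN fun x y hxy ↦ by
      obtain ⟨φ, hφ, hne⟩ := exists_contMDiff_apply_ne (E := E) hxy
      refine ⟨φ, hφ.continuous, hne, fun ε hε ↦ ?_⟩
      obtain ⟨A, hA⟩ := hwB φ hφ
      -- From the Hölder bound: the squared increment is at most A |t - s|. The summand 1 avoids
      -- division by zero.
      refine ⟨ε ^ 2 / (|A| + 1), by positivity, fun n ↦ ?_⟩
      have key : ∀ s ∈ Icc (0 : ℝ) 1, ∀ t ∈ Icc (0 : ℝ) 1, s ≤ t →
          dist s t < ε ^ 2 / (|A| + 1) → dist (φ (u n s)) (φ (u n t)) < ε := by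
        intro s hs t ht hst hd
        rw [dist_comm, Real.dist_eq, abs_of_nonneg (sub_nonneg.2 hst),
          lt_div_iff₀ (by positivity)] at hd
        have h1 : (φ (u n t) - φ (u n s)) ^ 2 ≤ A * (t - s) :=
          (hwp φ hφ n).abs_sub_sq_le (hwc φ hφ n) (hA n) hs ht hst
        rw [dist_comm, Real.dist_eq]
        refine abs_lt_of_sq_lt_sq ?_ hε.le
        nlinarith [le_abs_self A, sub_nonneg.2 hst]
      intro s hs t ht hd
      rcases le_total s t with hst | hst
      · exact key s hs t ht hst hd
      · rw [dist_comm] at hd ⊢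
        exact key t ht s hs hst hd
  have hlim : ∀ φ : M → ℝ, ContMDiff 𝓘(ℝ, E) 𝓘(ℝ, ℝ) ∞ φ →
      ∃ W, MemLp W 2 (volume.restrict (Icc (0 : ℝ) 1)) ∧ IsPrimitive (φ ∘ z) W ∧
      ∀ ψ, MemLp ψ 2 (volume.restrict (Icc (0 : ℝ) 1)) →
        Tendsto (fun n ↦ ∫ s in (0 : ℝ)..1, w φ (σ n) s * ψ s) atTop
          (𝓝 (∫ s in (0 : ℝ)..1, W s * ψ s)) := by
    intro φ hφ
    obtain ⟨A, hA⟩ := hwB φ hφ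
    exact exists_weak_limit_derivative (fun n ↦ hwc φ hφ (σ n)) (fun n ↦ hwp φ hφ (σ n))
      (fun n ↦ hA (σ n)) fun s hs ↦ (hφ.continuous.tendsto _).comp (hpt s hs)
  have hzN : ∀ s ∈ Icc (0 : ℝ) 1, z s ∈ N := fun s hs ↦
    hN.isClosed.mem_of_tendsto (hpt s hs) (Eventually.of_forall fun n ↦ huN _ s hs)
  refine ⟨z, ⟨hzc.continuousOn, fun φ hφ ↦ ?_, ?_, ?_, ?_⟩, σ, hσ, fun φ hφ ψ hψ ↦ ⟨?_, ?_⟩,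
    hunif⟩
  · obtain ⟨W, hW, hWp, -⟩ := hlim φ hφ
    exact hWp.absolutelyContinuousOnInterval (intervalIntegrable_of_memLp hW)
  · refine tendsto_nhds_unique (hpt 0 h01) ?_
    simp only [hp, tendsto_const_nhds]
  · refine tendsto_nhds_unique (hpt 1 h11) ?_
    simp only [hq, tendsto_const_nhds]
  · refine h.lintegral_riemInner_lt_top hN hzN fun φ hφ ↦ ?_
    obtain ⟨W, hW, hWp, -⟩ := hlim φ hφ
    exact ⟨W, hW, hWp⟩
  · obtain ⟨C, hC⟩ := hN.exists_bound_of_continuousOn hφ.continuous.continuousOn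
    have hψi := intervalIntegrable_of_memLp hψ
    have hsub : uIoc (0 : ℝ) 1 ⊆ Icc 0 1 := by
      rw [uIoc_of_le zero_le_one]
      exact Ioc_subset_Icc_self
    refine intervalIntegral.tendsto_integral_filter_of_dominated_convergence
      (fun s ↦ C * ‖ψ s‖) (Eventually.of_forall fun n ↦ ?_)
      (Eventually.of_forall fun n ↦ Eventually.of_forall fun s hs ↦ ?_)
      (hψi.norm.const_mul C) (Eventually.of_forall fun s hs ↦ ?_)
    · refine AEStronglyMeasurable.mul ?_ hψi.aestronglyMeasurable_restrict_uIoc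
      exact ((hφ.continuous.comp_continuousOn (hu (σ n)).continuousOn).mono
        hsub).aestronglyMeasurable measurableSet_uIoc
    · rw [norm_mul]
      exact mul_le_mul_of_nonneg_right (hC _ (huN _ s (hsub hs))) (norm_nonneg _)
    · exact (((hφ.continuous.tendsto _).comp (hpt s (hsub hs)))).mul_const _
  · obtain ⟨W, hW, hWp, hWlim⟩ := hlim φ hφ
    -- The weak convergence is stated for the classical derivative on ℝ, which agrees with the L²
    -- density almost everywhere on [0, 1].
    have hderiv : ∀ {G V : ℝ → ℝ}, IsPrimitive G V → IntervalIntegrable V volume 0 1 →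
        ∫ s in (0 : ℝ)..1, deriv G s * ψ s = ∫ s in (0 : ℝ)..1, V s * ψ s := by
      intro G V hG hV
      rw [intervalIntegral_eq_integral_Icc, intervalIntegral_eq_integral_Icc]
      refine integral_congr_ae ?_
      filter_upwards [hG.ae_hasDerivAt hV] with s hs
      rw [hs.deriv]
    rw [hderiv hWp (intervalIntegrable_of_memLp hW)]
    refine (hWlim ψ hψ).congr fun n ↦ ?_
    exact (hderiv (hwp φ hφ (σ n)) (integrableOn_interval (hwc φ hφ (σ n)) h01 h11)).symm

theorem IsStationary.isPseudoCoercive [SecondCountableTopology M]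
    (hS : IsCompleteHypersurface g S) (p q : M) : IsPseudoCoercive g K p q (C1K g K p q) := by
  intro c u hu hact
  obtain ⟨N, hN, B, hB⟩ := h.exists_energy_bound hS p q c
  exact h.exists_subseq_weaklyConverges hN (fun n ↦ (hu n).1) (fun n ↦ (hu n).2.1)
    (fun n ↦ (hu n).2.2.1) (fun n ↦ (hB _ (hu n) (hact n)).1) fun n ↦ (hB _ (hu n) (hact n)).2

end Compactness

end StationarySpacetime

end

theorem mainTheorem2
    {E : Type*} [NormedAddCommGroup E] [NormedSpace ℝ E] [FiniteDimensional ℝ E]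
    {M : Type*} [TopologicalSpace M] [ChartedSpace E M] [IsManifold 𝓘(ℝ, E) ∞ M]
    [T2Space M] [SecondCountableTopology M] [ConnectedSpace M]
    (g : StationarySpacetime.LorentzMetric E M)
    (K : StationarySpacetime.VField E M)
    (hK_timelike : StationarySpacetime.IsTimelikeField g K)
    (hK_killing : StationarySpacetime.IsKilling g K)
    (hK_complete : StationarySpacetime.IsCompleteField K)
    (S : Set M)
    (hS_spacelike : StationarySpacetime.IsSpacelikeHypersurface g S)
    (hS_cauchy : StationarySpacetime.IsCauchyHypersurface g S)
    (hS_complete : StationarySpacetime.IsCompleteHypersurface g S) :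
    ∀ p q : M, StationarySpacetime.IsPseudoCoercive g K p q
      (StationarySpacetime.C1K g K p q) := by
  have : CompleteSpace E := FiniteDimensional.complete ℝ E
  exact StationarySpacetime.IsStationary.isPseudoCoercive
    ⟨hK_timelike, hK_killing, hK_complete, hS_spacelike, hS_cauchy⟩ hS_complete
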